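/- Let $B\ge 0$ be fixed. Let $S$ be a nonempty set of $L$ monomials in fermionic creation and annihilation operators on $n$ modes, each of the form $a_p^\dagger a_q$ or $a_p^\dagger a_q^\dagger a_r a_s$ with $p<q$, $r<s$, and let $$\mathcal H=\sum_{t\in S}h_t\,t ,\qquad h_t\in\mathbb R,\quad |h_t|\le B ,$$ be the corresponding Hamiltonian, regarded as a $2^n\times 2^n$ matrix in the occupation basis. Let $0<\varepsilon\le 1/2$. All constants hidden in $\mathcal O(\cdot)$ depend only on $B$. There is a word length $m_b=m_b(L,\varepsilon)\ge 1$ with $m_b=\mathcal O(\log(L/\varepsilon))$ such that the following holds. (a) For every integer $1\le\lambda\le L$ there is a Clifford+T circuit $U$ on $n$ system qubits and $a$ ancilla qubits with $$\bigl\|\mathcal H-\alpha\,(\langle 0^a|\otimes I)\,U\,(|0^a\rangle\otimes I)\bigr\|\le\varepsilon ,\qquad 0<\alpha=\mathcal O(L),\qquad a=\mathcal O(\lambda m_b),$$ that uses $$\mathcal O\!\left(n+\left\lceil L/\lambda\right\rceil+\lambda m_b\right)$$ T gates. The circuit has the form $D\,O_C\,O_A\,D$, where the validation qubit is first set to $|1\rangle$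 and: * $D$ applies a Hadamard gate to each of the $k$ qubits of an index register, in which every $t\in S$ has its own index. * $O_A=O_B\,O_S\,O_B$. The data-lookup oracle $O_B$ maps $|t\rangle|0^{m_b}\rangle$ to $|t\rangle|b_t\rangle$, where the $m_b$-bit word $b_t$ (a sign bit $s$ and an integer $0\le v<2^{m_b-1}$) stands for $r_t=(-1)^{s}v/2^{m_b-1}$ and $|h_t-\alpha 2^{-k}r_t|\le\varepsilon/L$. It is a SELECT-SWAP circuit with $\lambda$ words: SELECT, controlled on the high part of the index, loads a group of $\lambda$ words; SWAP, controlled on the low part, moves the requested word to the front; the word is copied by CNOT gates; SWAP and SELECT are undone. The direct-sampling oracle $O_S$ maps $|b\rangle|0^{m_b-1}\rangle|0\rangle$ to $|b\rangle|0^{m_b-1}\rangle\bigl(r_b|0\rangle+((-1)^{s}-r_b)|1\rangle\bigr)+|b\rangle|\Psi\rangle$, where $\Psi$ is orthogonal to $|0^{m_b-1}\rangle$ in the middle register. * The sparsity oracle $O_C$ maps $|t\rangle|1\rangle|j\rangle$ to $\pm|t\rangle|0\rangle|c\rangle$ if $t|j\rangle=\pm|c\rangle$, and to itself if $t|j\rangle=0$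 (the middle qubit is the validation qubit). It is a product of $\mathcal O(1)$ pieces. Each piece is a SWAP-UP circuit (controlled on the index of $t$, it permutes the system qubits so that the content of one of the modes of $t$ comes first), or the inverse of one, or a circuit with $\mathcal O(m_b)$ T gates. (b) If moreover $\log_2(L/\varepsilon)\le n+L$, then for a suitable $\lambda\in[1,L]$ there is such a circuit, with $\alpha=\mathcal O(L)$ and $a=\mathcal O(\lambda m_b)$, whose T count and T depth are both $$\mathcal O\!\left(n+\sqrt{L\,m_b}\right).$$ -/

import Mathlib

open scoped Matrix Matrix.Norms.L2Operator

noncomputable section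

namespace FermionEncoding

/-! ### Clifford + T circuits -/

/-- The Clifford + T gate set on a set `Q` of qubits. -/
inductive Gate (Q : Type) where
  | hadamard (q : Q)
  | phase (q : Q)
  | phaseInv (q : Q)
  | t (q : Q)
  | tInv (q : Q)
  | cnot (control target : Q) (hne : control ≠ target)

/-- A circuit is a list of gates; the head of the list is applied first. -/
abbrev Circuit (Q : Type) := List (Gate Q)

/-- The computational basis state `|x⟩`. -/
def ket {Q : Type} [DecidableEq Q] [Fintype Q] (x : Q → Bool) : (Q → Bool) → ℂ :=
  Pi.single x 1

/-- The one-qubit matrix `M` on qubit `q`, tensored with the identity on all other qubits. -/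
def onQubit {Q : Type} [DecidableEq Q] [Fintype Q] (q : Q) (M : Matrix Bool Bool ℂ) :
    Matrix (Q → Bool) (Q → Bool) ℂ :=
  Matrix.of fun y x => if y = Function.update x q (y q) then M (y q) (x q) else 0

/-- The one-qubit diagonal matrix `diag(1, z)`. -/
def phaseMatrix (z : ℂ) : Matrix Bool Bool ℂ :=
  Matrix.diagonal fun b => if b then z else 1

/-- The one-qubit Hadamard matrix. -/
def hadamardMatrix : Matrix Bool Bool ℂ :=
  Matrix.of fun y x => (if y && x then -1 else 1) / (Real.sqrt 2 : ℂ)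

namespace Gate

variable {Q : Type}

/-- The unitary matrix of a gate. -/
def matrix [DecidableEq Q] [Fintype Q] : Gate Q → Matrix (Q → Bool) (Q → Bool) ℂ
  | hadamard q => onQubit q hadamardMatrix
  | phase q => onQubit q (phaseMatrix Complex.I)
  | phaseInv q => onQubit q (phaseMatrix (-Complex.I))
  | t q => onQubit q (phaseMatrix (Complex.exp (Real.pi / 4 * Complex.I)))
  | tInv q => onQubit q (phaseMatrix (Complex.exp (-(Real.pi / 4 * Complex.I))))
  | cnot a b _ => Matrix.of fun y x => if y = Function.update x b (xor (x b) (x a)) then 1 else 0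

/-- The inverse gate. -/
def inv : Gate Q → Gate Q
  | hadamard q => hadamard q
  | phase q => phaseInv q
  | phaseInv q => phase q
  | t q => tInv q
  | tInv q => t q
  | cnot a b hne => cnot a b hne

/-- The number of `T` gates (or inverses of `T` gates) in a single gate. -/
def tCount : Gate Q → ℕ
  | t _ => 1
  | tInv _ => 1
  | _ => 0

/-- How a gate updates the number of `T` layers needed on each wire so far. -/
def tLayer [DecidableEq Q] (d : Q → ℕ) : Gate Q → Q → ℕ
  | t q => Function.update d q (d q + 1)
  | tInv q => Function.update d q (d q + 1)
  | cnot a b _ => Function.update (Function.update d a (max (d a) (d b))) b (max (d a) (d b))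
  | _ => d

end Gate

namespace Circuit

variable {Q : Type}

/-- The unitary matrix of a circuit. -/
def matrix [DecidableEq Q] [Fintype Q] : Circuit Q → Matrix (Q → Bool) (Q → Bool) ℂ
  | [] => 1
  | g :: c => matrix c * g.matrix

/-- The inverse circuit. -/
def inv (c : Circuit Q) : Circuit Q := (c.map Gate.inv).reverse

/-- The T count: the number of `T` and `T†` gates. -/
def tCount (c : Circuit Q) : ℕ := (c.map Gate.tCount).sum

/-- The T depth: the least number of layers of `T` gates, that is, the largest number of `T` gates
on a path through the circuit. -/
def tDepth [DecidableEq Q] [Fintype Q] (c : Circuit Q) : ℕ :=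
  Finset.univ.sup (c.foldl Gate.tLayer fun _ => 0)

/-- The Pauli `X` gate on qubit `q`, as `H S S H`. -/
def pauliX (q : Q) : Circuit Q := [.hadamard q, .phase q, .phase q, .hadamard q]

end Circuit

/-! ### Block encodings -/

/-- `U`, acting on the system qubits `Fin n` and on the ancillas `A`, is an
`(α, |A|, ε)`-block-encoding of `M`. -/
def IsBlockEncoding {n : ℕ} {A : Type} [DecidableEq A] [Fintype A] (α ε : ℝ)
    (M : Matrix (Fin n → Bool) (Fin n → Bool) ℂ)
    (U : Matrix (A ⊕ Fin n → Bool) (A ⊕ Fin n → Bool) ℂ) : Prop :=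
  0 < α ∧ U ∈ Matrix.unitaryGroup (A ⊕ Fin n → Bool) ℂ ∧
    ‖M - (α : ℂ) • U.submatrix (Sum.elim fun _ => false) (Sum.elim fun _ => false)‖ ≤ ε

/-! ### Second-quantized Hamiltonians in the occupation basis -/

/-- The annihilation operator of mode `p`:
`a_p |j⟩ = (-1)^(j_0 + ... + j_{p-1}) |j with bit p cleared⟩` if `j_p = 1`, and `0` otherwise. -/
def annihilate {n : ℕ} (p : Fin n) : Matrix (Fin n → Bool) (Fin n → Bool) ℂ :=
  Matrix.of fun i j =>
    if j p = true ∧ i = Function.update j p false then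
      (-1) ^ (Finset.univ.filter fun q : Fin n => q < p ∧ j q = true).card
    else 0

/-- The creation operator of mode `p`. -/
def create {n : ℕ} (p : Fin n) : Matrix (Fin n → Bool) (Fin n → Bool) ℂ := (annihilate p)ᴴ

/-- The labels of one-body monomials `a†_p a_q` and of two-body monomials
`a†_p a†_q a_r a_s` with `p < q` and `r < s`. -/
inductive Term (n : ℕ) where
  | one (p q : Fin n)
  | two (p q r s : Fin n) (hpq : p < q) (hrs : r < s)

namespace Term

variable {n : ℕ}

/-- The monomial with the given label. -/
def monomial : Term n → Matrix (Fin n → Bool) (Fin n → Bool) ℂ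
  | one p q => create p * annihilate q
  | two p q r s _ _ => create p * create q * annihilate r * annihilate s

/-- The modes on which a monomial acts. -/
def modes : Term n → Finset (Fin n)
  | one p q => {p, q}
  | two p q r s _ _ => {p, q, r, s}

end Term

/-- The Hamiltonian `∑ h_{pq} a†_p a_q + ∑ h_{pqrs} a†_p a†_q a_r a_s`, summed over the set `S` of
monomials that occur in it; its number of coefficients is `L = S.card`. -/
def hamiltonian {n : ℕ} (S : Finset (Term n)) (h : Term n → ℝ) :
    Matrix (Fin n → Bool) (Fin n → Bool) ℂ :=
  ∑ t ∈ S, (h t : ℂ) • t.monomial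

/-! ### Registers -/

/-- The ancilla qubits. A data word consists of a sign bit and `m` magnitude bits, so that the word
length is `m_b = m + 1`. -/
inductive Ancilla (kh kl lam m w : ℕ) where
  /-- index register, most significant part -/
  | hi (i : Fin kh)
  /-- index register, least significant part -/
  | lo (i : Fin kl)
  /-- the `lam` words of the data-lookup circuit -/
  | cell (i : Fin lam) (b : Fin (m + 1))
  /-- the word that has been looked up -/
  | word (b : Fin (m + 1))
  /-- the register that is diffused in direct sampling -/
  | sample (b : Fin m)
  /-- the qubit that carries the sampled amplitude -/
  | amp
  /-- the validation qubit -/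
  | valid
  /-- further work qubits -/
  | work (i : Fin w)
  deriving DecidableEq, Fintype

/-- All qubits: the ancillas and one system qubit for each of the `n` modes. -/
abbrev Qubit (n kh kl lam m w : ℕ) := Ancilla kh kl lam m w ⊕ Fin n

/-- The contents of the index register. -/
abbrev Address (kh kl : ℕ) := (Fin kh → Bool) × (Fin kl → Bool)

/-- A data word: bit `0` is the sign, bit `i + 1` has weight `2 ^ i`. -/
abbrev Word (m : ℕ) := Fin (m + 1) → Bool

/-- The sign `(-1)^(b_0)` of a data word. -/
def Word.sign {m : ℕ} (b : Word m) : ℝ := if b 0 then -1 else 1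

/-- The number `r_b = (-1)^(b_0) b_1 / 2^m` that is represented by a data word. -/
def Word.value {m : ℕ} (b : Word m) : ℝ :=
  b.sign * (Nat.ofBits (fun i : Fin m => b i.succ) : ℝ) / 2 ^ m

section Registers

variable {n kh kl lam m w : ℕ}

/-- The index held by a basis state. -/
def address (x : Qubit n kh kl lam m w → Bool) : Address kh kl :=
  (fun i => x (.inl (.hi i)), fun i => x (.inl (.lo i)))

/-- The data word held by the word register of a basis state. -/
def wordOf (x : Qubit n kh kl lam m w → Bool) : Word m := fun b => x (.inl (.word b))

/-- The occupation numbers held by the system register of a basis state. -/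
def occupation (x : Qubit n kh kl lam m w → Bool) : Fin n → Bool := fun p => x (.inr p)

/-- All work qubits are `0`. -/
def WorkClean (x : Qubit n kh kl lam m w → Bool) : Prop := ∀ i, x (.inl (.work i)) = false

/-- All qubits of the data-lookup cells are `0`. -/
def CellsClean (x : Qubit n kh kl lam m w → Bool) : Prop := ∀ i b, x (.inl (.cell i b)) = false

/-- The basis state `x` with the occupation numbers replaced by `j`. -/
def setOccupation (x : Qubit n kh kl lam m w → Bool) (j : Fin n → Bool) :
    Qubit n kh kl lam m w → Bool :=
  Sum.elim (fun a => x (.inl a)) j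

/-- The basis state `x` with the cell contents replaced by `v`. -/
def setCells (x : Qubit n kh kl lam m w → Bool) (v : Fin lam → Word m) :
    Qubit n kh kl lam m w → Bool
  | .inl (.cell i b) => v i b
  | q => x q

/-! ### Building blocks of the circuit -/

/-- SELECT: controlled on the most significant part `g` of the index, the `lam` words
`data g 0, ..., data g (lam - 1)` of group `g` are loaded into the cells (bitwise XOR). -/
def IsSelect (data : (Fin kh → Bool) → Fin lam → Word m)
    (c : Circuit (Qubit n kh kl lam m w)) : Prop :=
  ∀ x, WorkClean x →
    c.matrix *ᵥ ket x =
      ket (setCells x fun i b => xor (x (.inl (.cell i b))) (data (address x).1 i b))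

/-- SWAP: controlled on the least significant part `l` of the index, the cells are permuted so
that the `l`-th one becomes the leading one. -/
def IsSwap (c : Circuit (Qubit n kh kl lam m w)) : Prop :=
  ∃ σ : (Fin kl → Bool) → Equiv.Perm (Fin lam),
    (∀ (l : Fin kl → Bool) (i : Fin lam), i.val = 0 → Nat.ofBits l < lam →
      (σ l i).val = Nat.ofBits l) ∧
    ∀ x, WorkClean x →
      c.matrix *ᵥ ket x =
        ket (setCells x fun i b => x (.inl (.cell (σ (address x).2 i) b)))

/-- Direct sampling: `|b⟩|0^m⟩|0⟩ ↦ |b⟩|0^m⟩ (r_b |0⟩ + (sgn_b - r_b) |1⟩) + |b⟩|Ψ⟩`, where the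
sampling register of `Ψ` is orthogonal to `|0^m⟩`. -/
def IsSampling (c : Circuit (Qubit n kh kl lam m w)) : Prop :=
  ∀ x, WorkClean x → (∀ b, x (.inl (.sample b)) = false) → x (.inl .amp) = false →
    ∀ y,
      ((∃ q, y q ≠ x q ∧ q ≠ .inl .amp ∧ ∀ b, q ≠ .inl (.sample b)) → c.matrix y x = 0) ∧
      ((∀ q, q ≠ .inl .amp → y q = x q) →
        c.matrix y x =
          if y (.inl .amp) then (((wordOf x).sign - (wordOf x).value : ℝ) : ℂ)
          else ((wordOf x).value : ℂ))

/-- SWAP-UP: controlled on the index of a monomial `t`, the system qubits are permuted so that the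
content of qubit `f t` is moved to the first system qubit. -/
def IsSwapUp (S : Finset (Term n)) (addr : Term n → Address kh kl) (f : Term n → Fin n)
    (c : Circuit (Qubit n kh kl lam m w)) : Prop :=
  ∃ π : Address kh kl → Equiv.Perm (Fin n),
    (∀ t ∈ S, ∀ i : Fin n, i.val = 0 → π (addr t) i = f t) ∧
    ∀ x, WorkClean x → CellsClean x →
      c.matrix *ᵥ ket x = ket (setOccupation x fun p => occupation x (π (address x) p))

/-- The sparsity oracle: on `|t⟩|1⟩|j⟩`, where `1` is the content of the validation qubit, it
returns `±|t⟩|0⟩|c(j,t)⟩` if the monomial `t` maps `|j⟩` to `±|c(j,t)⟩`, and it returns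
`|t⟩|1⟩|j⟩` if the monomial annihilates `|j⟩`. -/
def IsSparsityOracle (S : Finset (Term n)) (addr : Term n → Address kh kl)
    (c : Circuit (Qubit n kh kl lam m w)) : Prop :=
  ∀ t ∈ S, ∀ x, WorkClean x → CellsClean x → x (.inl .valid) = true → address x = addr t →
    ((∃ i, t.monomial i (occupation x) ≠ 0) →
      c.matrix *ᵥ ket x =
        ∑ i, t.monomial i (occupation x) •
          ket (setOccupation (Function.update x (.inl .valid) false) i)) ∧
    ((∀ i, t.monomial i (occupation x) = 0) → c.matrix *ᵥ ket x = ket x)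

end Registers

/-! ### The complete circuit -/

/-- The four building blocks of the block encoding circuit. -/
structure Oracles (n kh kl lam m w : ℕ) where
  select : Circuit (Qubit n kh kl lam m w)
  swap : Circuit (Qubit n kh kl lam m w)
  sampling : Circuit (Qubit n kh kl lam m w)
  sparsity : Circuit (Qubit n kh kl lam m w)

namespace Oracles

variable {n kh kl lam m w : ℕ}

/-- CNOT gates that copy the leading cell to the word register. -/
def copy (n kh kl lam m w : ℕ) : Circuit (Qubit n kh kl lam m w) :=
  if hlam : 0 < lam then
    (List.finRange (m + 1)).map fun b =>
      Gate.cnot (.inl (.cell ⟨0, hlam⟩ b)) (.inl (.word b)) (by simp)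
  else []

/-- The diffusion operator: a Hadamard gate on every qubit of the index register. -/
def diffusion (n kh kl lam m w : ℕ) : Circuit (Qubit n kh kl lam m w) :=
  ((List.finRange kh).map fun i => Gate.hadamard (.inl (.hi i))) ++
    (List.finRange kl).map fun i => Gate.hadamard (.inl (.lo i))

/-- The SELECT-SWAP data-lookup oracle `O_B`. -/
def lookup (C : Oracles n kh kl lam m w) : Circuit (Qubit n kh kl lam m w) :=
  C.select ++ C.swap ++ copy n kh kl lam m w ++ Circuit.inv C.swap ++ Circuit.inv C.select

/-- The amplitude oracle `O_A`: look up, sample, and uncompute the word by looking it up again. -/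
def amplitude (C : Oracles n kh kl lam m w) : Circuit (Qubit n kh kl lam m w) :=
  C.lookup ++ C.sampling ++ C.lookup

/-- The complete circuit: diffusion, `O_A`, `O_C`, diffusion (the validation qubit starts
in `|1⟩`). -/
def circuit (C : Oracles n kh kl lam m w) : Circuit (Qubit n kh kl lam m w) :=
  Circuit.pauliX (.inl .valid) ++ diffusion n kh kl lam m w ++ C.amplitude ++ C.sparsity ++
    diffusion n kh kl lam m w

/-- The circuit block encodes the Hamiltonian with coefficients `h t`, `t ∈ S`, to precision `ε`
with subnormalization `α`, by the following construction.
* Every monomial has its own index, and the `(m + 1)`-bit data word at this index represents its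
  coefficient to precision `ε / L`, up to the common factor `α / 2 ^ (kh + kl)`.
* The data words are looked up by SELECT and SWAP, and turned into amplitudes by direct sampling.
* The sparsity oracle consists of at most `K` pieces, each of which is a SWAP-UP circuit for one of
  the modes of the indexed monomial, or the inverse of such a circuit, or a circuit with at most
  `K (m + 1)` `T` gates. -/
structure Encodes (C : Oracles n kh kl lam m w) (K : ℝ) (S : Finset (Term n)) (h : Term n → ℝ)
    (α ε : ℝ) : Prop where
  blockEncoding : IsBlockEncoding α ε (hamiltonian S h) (Circuit.matrix C.circuit)
  oracles : ∃ (addr : Term n → Address kh kl) (data : (Fin kh → Bool) → Fin lam → Word m),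
    Set.InjOn addr S ∧
    (∀ t ∈ S, ∃ i : Fin lam, i.val = Nat.ofBits (addr t).2 ∧
      |h t - α / 2 ^ (kh + kl) * (data (addr t).1 i).value| ≤ ε / S.card) ∧
    IsSelect data C.select ∧
    IsSwap C.swap ∧
    IsSampling C.sampling ∧
    IsSparsityOracle S addr C.sparsity ∧
    ∃ pieces : List (Circuit (Qubit n kh kl lam m w)),
      C.sparsity = pieces.flatten ∧ (pieces.length : ℝ) ≤ K ∧
      ∀ c ∈ pieces,
        (∃ f : Term n → Fin n, (∀ t ∈ S, f t ∈ t.modes) ∧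
          (IsSwapUp S addr f c ∨ ∃ d, IsSwapUp S addr f d ∧ c = Circuit.inv d)) ∨
        (Circuit.tCount c : ℝ) ≤ K * (m + 1)

end Oracles

end FermionEncoding

end

/-!
The unitary behind the block encoding is written out gate by gate.

*Table lookup.* Unary iteration walks the binary tree of all values of an address register, and
at each leaf holds a qubit that is `1` exactly if the register has the value of this leaf
(`sends_unary`); it costs `T` gates in proportion to the number of leaves. With CNOT fan-outs at the
leaves it gives SELECT (`sends_selectCircuit`), and with controlled swaps it gives SWAP
(`sends_swapCircuit`). SWAP-UP looks up a short code of the mode `f t`, swaps the qubit of this mode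
with the first system qubit by another unary iteration, and then uncomputes the code. Only the modes
that occur in `S` need codes, so that the code fits into a data word.

*Direct sampling.* The sampling register is put into a uniform superposition of its `2 ^ m` values.
For a magnitude `v`, the bit of `v` at the position of the leading one of the register value `s`
is `1` for exactly `v` values of `s`, and it is computed by a ripple of `O(m)` Toffoli gates. So the
amplitude that returns to the blank register is `± v / 2 ^ m`, which is the value of the data word
(`isSampling_samplingCircuit`).

*Sparsity oracle.* Since `a†_p a_q = a†_p a_p a†_p a_q`, every monomial is a product of four ladder
operators, and the leading bit of the index tells whether they are of the one-body or of the
two-body pattern. One ladder operator is a bit flip of a mode after SWAP-UP, which is recorded as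
failed in a flag qubit if the mode has the wrong occupation. Its Jordan–Wigner sign is the phase
read off in the basis of prefix parities, which a ladder of CNOT gates reaches. All of this is
controlled by the validation qubit. This qubit is cleared if no flag is raised, and then the four
steps are undone under the control of the validation qubit, so that they are undone exactly for the
states that the monomial annihilates (`isSparsityOracle_sparsityPieces`).

*Block encoding.* The two diffusion layers average over the index register, and the validation qubit
discards the failed states, so that the encoded block is `2 ^ (-k) ∑ r_t t`, summed over `S`
(indices outside of `S` hold the word `0`). Each monomial has norm at most `1`, so that an error of
`ε / L` in each coefficient adds up to an error of at most `ε` (`isBlockEncoding_circuit`).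

*Cost.* SELECT costs `O(L / λ)`, SWAP costs `O(λ m_b)` and the swap of the addressed mode costs
`O(n)` `T` gates, and everything else costs `O(m_b)` (`exists_oracles`). The choice
`λ = ⌈√(L / m_b)⌉`, or `λ = 1` if `m_b > L`, balances the first two (`exists_lam`), and the `T` depth
is at most the `T` count.
-/

set_option linter.unusedSectionVars false

noncomputable section

namespace FermionEncoding

section

/-! ### Action of circuits on basis states -/

variable {Q : Type} [DecidableEq Q] [Fintype Q]

theorem Circuit.matrix_append (c d : Circuit Q) : matrix (c ++ d) = matrix d * matrix c := by
  induction c with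
  | nil => simp [Circuit.matrix]
  | cons g c ih => simp [Circuit.matrix, ih, Matrix.mul_assoc]

theorem mulVec_ket (M : Matrix (Q → Bool) (Q → Bool) ℂ) (x y : Q → Bool) :
    (M *ᵥ ket x) y = M y x := by
  simp [ket]

theorem ket_apply (x y : Q → Bool) : ket x y = if y = x then 1 else 0 := by
  simp [ket, Pi.single_apply]

theorem matrix_ext_ket {M N : Matrix (Q → Bool) (Q → Bool) ℂ}
    (h : ∀ x, M *ᵥ ket x = N *ᵥ ket x) : M = N := by
  ext y x
  rw [← mulVec_ket M, h, mulVec_ket]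

theorem onQubit_mulVec_ket (q : Q) (M : Matrix Bool Bool ℂ) (x : Q → Bool) :
    onQubit q M *ᵥ ket x = M false (x q) • ket (Function.update x q false) +
      M true (x q) • ket (Function.update x q true) := by
  ext y
  rw [mulVec_ket]
  simp only [onQubit, Matrix.of_apply, Pi.add_apply, Pi.smul_apply, ket_apply, smul_eq_mul]
  cases hy : y q
  · have : y ≠ Function.update x q true := fun h => by rw [h] at hy; simp at hy
    simp [this]
  · have : y ≠ Function.update x q false := fun h => by rw [h] at hy; simp at hy
    simp [this]

theorem phaseMatrix_mulVec_ket (q : Q) (z : ℂ) (x : Q → Bool) :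
    onQubit q (phaseMatrix z) *ᵥ ket x = (if x q then z else 1) • ket x := by
  rw [onQubit_mulVec_ket]
  cases h : x q
  · rw [← h, Function.update_eq_self]; simp [phaseMatrix, h]
  · rw [← h, Function.update_eq_self]; simp [phaseMatrix, h]

theorem cnot_mulVec_ket (a b : Q) (hne : a ≠ b) (x : Q → Bool) :
    (Gate.cnot a b hne).matrix *ᵥ ket x = ket (Function.update x b (xor (x b) (x a))) := by
  ext y
  rw [mulVec_ket, ket_apply]
  simp [Gate.matrix]

theorem onQubit_mul (q : Q) (M N : Matrix Bool Bool ℂ) :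
    onQubit q M * onQubit q N = onQubit q (M * N) := by
  refine matrix_ext_ket fun x => ?_
  rw [← Matrix.mulVec_mulVec, onQubit_mulVec_ket, Matrix.mulVec_add, Matrix.mulVec_smul,
    Matrix.mulVec_smul, onQubit_mulVec_ket, onQubit_mulVec_ket, onQubit_mulVec_ket]
  simp only [Function.update_self, Function.update_idem, Matrix.mul_apply, Fintype.univ_bool,
    Finset.sum_insert, Finset.mem_singleton, Bool.true_eq_false, not_false_eq_true,
    Finset.sum_singleton]
  module

theorem onQubit_one (q : Q) : onQubit q 1 = 1 := by
  refine matrix_ext_ket fun x => ?_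
  rw [← Matrix.diagonal_one, show (Matrix.diagonal fun _ => (1 : ℂ) : Matrix Bool Bool ℂ)
    = phaseMatrix 1 by simp [phaseMatrix], phaseMatrix_mulVec_ket]
  simp

theorem conjTranspose_onQubit (q : Q) (M : Matrix Bool Bool ℂ) :
    (onQubit q M)ᴴ = onQubit q Mᴴ := by
  ext y x
  simp only [Matrix.conjTranspose_apply, onQubit, Matrix.of_apply]
  have : x = Function.update y q (x q) ↔ y = Function.update x q (y q) := by
    constructor <;> intro h <;> rw [h] <;> simp
  by_cases h : y = Function.update x q (y q)
  · rw [if_pos h, if_pos (this.2 h)]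
  · rw [if_neg h, if_neg (fun h' => h (this.1 h'))]; simp

theorem hadamardMatrix_conjTranspose : hadamardMatrixᴴ = hadamardMatrix := by
  ext y x
  cases y <;> cases x <;> simp [hadamardMatrix, Matrix.conjTranspose_apply]

theorem hadamardMatrix_mul_self : hadamardMatrix * hadamardMatrix = 1 := by
  have h : ((Real.sqrt 2 : ℝ) : ℂ) * (Real.sqrt 2 : ℝ) = 2 := by
    rw [← Complex.ofReal_mul, Real.mul_self_sqrt (by norm_num)]; norm_num
  have h' : ((Real.sqrt 2 : ℝ) : ℂ)⁻¹ * ((Real.sqrt 2 : ℝ) : ℂ)⁻¹ = 1 / 2 := by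
    rw [← mul_inv, h]; norm_num
  ext y x
  cases y <;> cases x <;> simp [hadamardMatrix, Matrix.mul_apply, div_eq_mul_inv, h']
  norm_num

theorem phaseMatrix_conjTranspose (z : ℂ) :
    (phaseMatrix z)ᴴ = phaseMatrix (star z) := by
  ext y x
  cases y <;> cases x <;> simp [phaseMatrix]

theorem phaseMatrix_mul (z z' : ℂ) : phaseMatrix z * phaseMatrix z' = phaseMatrix (z * z') := by
  ext y x
  cases y <;> cases x <;> simp [phaseMatrix]

theorem phaseMatrix_one : phaseMatrix 1 = 1 := by
  simp [phaseMatrix]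

theorem star_exp_quarter :
    star (Complex.exp (Real.pi / 4 * Complex.I)) = Complex.exp (-(Real.pi / 4 * Complex.I)) := by
  rw [Complex.star_def, ← Complex.exp_conj]
  congr 1
  simp [Complex.conj_ofNat]

theorem exp_quarter_mul_inv :
    Complex.exp (-(Real.pi / 4 * Complex.I)) * Complex.exp (Real.pi / 4 * Complex.I) = 1 := by
  rw [← Complex.exp_add]; simp

theorem exp_quarter_pow_four : Complex.exp (Real.pi / 4 * Complex.I) ^ 4 = -1 := by
  rw [← Complex.exp_nat_mul, ← Complex.exp_pi_mul_I]
  congr 1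
  push_cast
  ring

theorem cnot_mul_self (a b : Q) (hne : a ≠ b) :
    (Gate.cnot a b hne).matrix * (Gate.cnot a b hne).matrix = 1 := by
  refine matrix_ext_ket fun x => ?_
  rw [← Matrix.mulVec_mulVec, cnot_mulVec_ket, cnot_mulVec_ket]
  simp [Function.update_of_ne hne]

theorem Gate.matrix_inv (g : Gate Q) : g.inv.matrix = g.matrixᴴ := by
  cases g with
  | hadamard q => simp [Gate.inv, Gate.matrix, conjTranspose_onQubit, hadamardMatrix_conjTranspose]
  | phase q => simp [Gate.inv, Gate.matrix, conjTranspose_onQubit, phaseMatrix_conjTranspose]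
  | phaseInv q => simp [Gate.inv, Gate.matrix, conjTranspose_onQubit, phaseMatrix_conjTranspose]
  | t q =>
    simp only [Gate.inv, Gate.matrix, conjTranspose_onQubit, phaseMatrix_conjTranspose,
      star_exp_quarter]
  | tInv q =>
    simp only [Gate.inv, Gate.matrix, conjTranspose_onQubit, phaseMatrix_conjTranspose,
      ← star_exp_quarter, star_star]
  | cnot a b hne =>
    ext y x
    simp only [Gate.inv, Gate.matrix, Matrix.conjTranspose_apply, Matrix.of_apply]
    have : x = Function.update y b (xor (y b) (y a)) ↔
        y = Function.update x b (xor (x b) (x a)) := by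
      constructor <;> intro h <;> rw [h] <;> simp [Function.update_of_ne hne]
    simp only [this]
    split_ifs <;> simp

theorem Gate.inv_matrix_mul (g : Gate Q) : g.inv.matrix * g.matrix = 1 := by
  cases g with
  | hadamard q => simp [Gate.inv, Gate.matrix, onQubit_mul, hadamardMatrix_mul_self, onQubit_one]
  | phase q => simp [Gate.inv, Gate.matrix, onQubit_mul, phaseMatrix_mul, phaseMatrix_one,
      onQubit_one]
  | phaseInv q => simp [Gate.inv, Gate.matrix, onQubit_mul, phaseMatrix_mul, phaseMatrix_one,
      onQubit_one]
  | t q => simp only [Gate.inv, Gate.matrix, onQubit_mul, phaseMatrix_mul, exp_quarter_mul_inv,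
      phaseMatrix_one, onQubit_one]
  | tInv q => simp only [Gate.inv, Gate.matrix, onQubit_mul, phaseMatrix_mul,
      mul_comm (Complex.exp (Real.pi / 4 * Complex.I)), exp_quarter_mul_inv,
      phaseMatrix_one, onQubit_one]
  | cnot a b hne => exact cnot_mul_self a b hne

theorem Circuit.inv_append (c d : Circuit Q) : inv (c ++ d) = inv d ++ inv c := by
  simp [Circuit.inv]

theorem Circuit.inv_inv (c : Circuit Q) : inv (inv c) = c := by
  have h : ∀ g : Gate Q, g.inv.inv = g := fun g => by cases g <;> rfl
  simp [Circuit.inv, List.map_reverse, Function.comp_def, h]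

theorem Circuit.tCount_append (c d : Circuit Q) : tCount (c ++ d) = tCount c + tCount d := by
  simp [Circuit.tCount]

theorem Circuit.tCount_inv (c : Circuit Q) : tCount (inv c) = tCount c := by
  have h : ∀ g : Gate Q, g.inv.tCount = g.tCount := fun g => by cases g <;> rfl
  simp [Circuit.tCount, Circuit.inv, List.map_reverse, Function.comp_def, h]

theorem Circuit.matrix_inv (c : Circuit Q) : matrix (inv c) = (matrix c)ᴴ := by
  induction c with
  | nil => simp [Circuit.inv, Circuit.matrix]
  | cons g c ih =>
    rw [show g :: c = [g] ++ c from rfl, inv_append, matrix_append, matrix_append, ih,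
      Matrix.conjTranspose_mul]
    simp [Circuit.inv, Circuit.matrix, Gate.matrix_inv]

theorem Circuit.matrix_inv_mul (c : Circuit Q) : matrix (inv c) * matrix c = 1 := by
  induction c with
  | nil => simp [Circuit.inv, Circuit.matrix]
  | cons g c ih =>
    rw [show g :: c = [g] ++ c from rfl, inv_append, matrix_append, matrix_append]
    calc matrix (inv [g]) * matrix (inv c) * (matrix c * matrix [g])
        = matrix (inv [g]) * (matrix (inv c) * matrix c) * matrix [g] := by
          simp only [Matrix.mul_assoc]
      _ = 1 := by rw [ih]; simpa [Circuit.inv, Circuit.matrix] using g.inv_matrix_mul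

theorem Circuit.matrix_mem_unitaryGroup (c : Circuit Q) :
    matrix c ∈ Matrix.unitaryGroup (Q → Bool) ℂ := by
  rw [Matrix.mem_unitaryGroup_iff', Matrix.star_eq_conjTranspose, ← matrix_inv, matrix_inv_mul]

/-- Each `T` gate adds at most one layer, so the depth is bounded by the count. -/
theorem Circuit.tDepth_le_tCount (c : Circuit Q) : tDepth c ≤ tCount c := by
  have key : ∀ (c : Circuit Q) (d : Q → ℕ) (N : ℕ), (∀ q, d q ≤ N) →
      ∀ q, c.foldl Gate.tLayer d q ≤ N + tCount c := by
    intro c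
    induction c with
    | nil => intro d N h q; simpa [Circuit.tCount] using h q
    | cons g c ih =>
      intro d N h q
      rw [List.foldl_cons]
      have := ih (Gate.tLayer d g) (N + g.tCount) ?_ q
      · simpa [Circuit.tCount, add_assoc] using this
      · intro q
        have hq := h q
        cases g with
        | t a =>
          by_cases hqa : q = a
          · subst hqa; simpa [Gate.tLayer, Gate.tCount] using hq
          · simp [Gate.tLayer, Gate.tCount, Function.update_of_ne hqa]; omega
        | tInv a =>
          by_cases hqa : q = a
          · subst hqa; simpa [Gate.tLayer, Gate.tCount] using hq
          · simp [Gate.tLayer, Gate.tCount, Function.update_of_ne hqa]; omega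
        | cnot a b hne =>
          have ha := h a
          have hb := h b
          simp only [Gate.tLayer, Gate.tCount, Function.update_apply]
          split_ifs <;> simp <;> omega
        | _ => simpa [Gate.tLayer, Gate.tCount] using hq
  refine Finset.sup_le fun q _ => ?_
  simpa using key c (fun _ => 0) 0 (fun _ => le_rfl) q

/-- The circuit maps the basis state `x` to the basis state `y`. -/
def Sends (c : Circuit Q) (x y : Q → Bool) : Prop := c.matrix *ᵥ ket x = ket y

theorem Circuit.append_mulVec (c d : Circuit Q) (v : (Q → Bool) → ℂ) :
    matrix (c ++ d) *ᵥ v = matrix d *ᵥ (matrix c *ᵥ v) := by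
  rw [matrix_append, Matrix.mulVec_mulVec]

theorem Sends.nil (x : Q → Bool) : Sends [] x x := by simp [Sends, Circuit.matrix]

theorem Sends.append {c d : Circuit Q} {x y z : Q → Bool} (h : Sends c x y) (h' : Sends d y z) :
    Sends (c ++ d) x z := by
  rw [Sends, Circuit.append_mulVec, h, h']

theorem Circuit.inv_mulVec_of_eq_smul {c : Circuit Q} {x y : Q → Bool} {z z' : ℂ}
    (h : matrix c *ᵥ ket x = z • ket y) (hz : z' * z = 1) :
    matrix (inv c) *ᵥ ket y = z' • ket x := by
  have : ket y = z' • (matrix c *ᵥ ket x) := by rw [h, smul_smul, hz, one_smul]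
  rw [this, Matrix.mulVec_smul, Matrix.mulVec_mulVec, matrix_inv_mul, Matrix.one_mulVec]

theorem Sends.inv {c : Circuit Q} {x y : Q → Bool} (h : Sends c x y) :
    Sends (Circuit.inv c) y x := by
  have := Circuit.inv_mulVec_of_eq_smul (c := c) (x := x) (y := y) (z := 1) (z' := 1)
    (by rw [one_smul]; exact h) (by simp)
  rwa [one_smul] at this

theorem Sends.congr {c : Circuit Q} {x y y' : Q → Bool} (h : Sends c x y) (hy : y = y') :
    Sends c x y' := hy ▸ h

/-- Conjugation of a circuit `d` by a circuit `c`. -/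
theorem Sends.conj {c d : Circuit Q} {x y x' y' : Q → Bool} {z : ℂ} (h : Sends c x y)
    (hd : d.matrix *ᵥ ket y = z • ket y') (h' : Sends c x' y') :
    Circuit.matrix (c ++ d ++ Circuit.inv c) *ᵥ ket x = z • ket x' := by
  rw [Circuit.append_mulVec, Circuit.append_mulVec, h, hd, Matrix.mulVec_smul, h'.inv]

theorem Sends.conj' {c d : Circuit Q} {x y x' y' : Q → Bool} (h : Sends c x y)
    (hd : Sends d y y') (h' : Sends c x' y') : Sends (c ++ d ++ Circuit.inv c) x x' :=
  (h.append hd).append h'.inv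

/-! ### Reversible logic from Clifford and T gates -/

/-- Conjugation by a Hadamard gate turns a conditional sign flip on a qubit into a conditional
bit flip. -/
theorem sends_hadamard_conj {q : Q} {d : Circuit Q} {x : Q → Bool} (f : Bool)
    (h : ∀ b, d.matrix *ᵥ ket (Function.update x q b) =
      (if f && b then -1 else 1 : ℂ) • ket (Function.update x q b)) :
    Sends ([.hadamard q] ++ d ++ [.hadamard q]) x (Function.update x q (xor (x q) f)) := by
  have hs : ((Real.sqrt 2 : ℝ) : ℂ) * (Real.sqrt 2 : ℝ) = 2 := by
    rw [← Complex.ofReal_mul, Real.mul_self_sqrt (by norm_num)]; norm_num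
  have h' : ((Real.sqrt 2 : ℝ) : ℂ)⁻¹ * ((Real.sqrt 2 : ℝ) : ℂ)⁻¹ = 1 / 2 := by
    rw [← mul_inv, hs]; norm_num
  have hH : ∀ x : Q → Bool, Circuit.matrix [Gate.hadamard q] *ᵥ ket x =
      hadamardMatrix false (x q) • ket (Function.update x q false) +
      hadamardMatrix true (x q) • ket (Function.update x q true) := by
    intro x
    rw [← onQubit_mulVec_ket]
    simp [Circuit.matrix, Gate.matrix]
  rw [Sends, Circuit.append_mulVec, Circuit.append_mulVec, hH, Matrix.mulVec_add,
    Matrix.mulVec_smul, Matrix.mulVec_smul, h, h, Matrix.mulVec_add, Matrix.mulVec_smul,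
    Matrix.mulVec_smul, Matrix.mulVec_smul, Matrix.mulVec_smul, hH, hH]
  simp only [Function.update_self, Function.update_idem]
  cases f <;> cases x q <;> simp [hadamardMatrix, div_eq_mul_inv, smul_smul, h'] <;>
    module

theorem sends_pauliX (q : Q) (x : Q → Bool) :
    Sends (Circuit.pauliX q) x (Function.update x q (!x q)) := by
  have := sends_hadamard_conj (q := q) (d := [.phase q, .phase q]) (x := x) true ?_
  · simpa [Circuit.pauliX] using this
  · intro b
    have h : Circuit.matrix [Gate.phase q, Gate.phase q] = onQubit q (phaseMatrix (-1)) := by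
      simp [Circuit.matrix, Gate.matrix, onQubit_mul, phaseMatrix_mul]
    rw [h, phaseMatrix_mulVec_ket]
    simp

/-- The controlled NOT gate, and the empty circuit if control and target coincide. -/
def cx (a b : Q) : Circuit Q := if h : a ≠ b then [.cnot a b h] else []

theorem sends_cx {a b : Q} (h : a ≠ b) (x : Q → Bool) :
    Sends (cx a b) x (Function.update x b (xor (x b) (x a))) := by
  rw [Sends, cx, dif_pos h]
  simpa [Circuit.matrix] using cnot_mulVec_ket a b h x

theorem tCount_cx (a b : Q) : Circuit.tCount (cx a b) = 0 := by
  rw [cx]; split_ifs <;> rfl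

/-- A phase gate applied to the parity of two qubits. -/
theorem cx_phase_cx {a b : Q} (hab : a ≠ b) {g : Gate Q} {z : ℂ}
    (hg : g.matrix = onQubit b (phaseMatrix z)) (x : Q → Bool) :
    Circuit.matrix (cx a b ++ [g] ++ cx a b) *ᵥ ket x =
      (if xor (x b) (x a) then z else 1 : ℂ) • ket x := by
  rw [Circuit.append_mulVec, Circuit.append_mulVec, sends_cx hab,
    show Circuit.matrix [g] = g.matrix by simp [Circuit.matrix], hg, phaseMatrix_mulVec_ket,
    Matrix.mulVec_smul, sends_cx hab]
  simp [Function.update_of_ne hab]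

theorem smul_append {c d : Circuit Q} {x : Q → Bool} {z z' : ℂ}
    (h : c.matrix *ᵥ ket x = z • ket x) (h' : d.matrix *ᵥ ket x = z' • ket x) :
    Circuit.matrix (c ++ d) *ᵥ ket x = (z * z') • ket x := by
  rw [Circuit.append_mulVec, h, Matrix.mulVec_smul, h', smul_smul]

/-- The controlled sign flip. -/
def cz (a b : Q) : Circuit Q := [.phase a] ++ [.phase b] ++ (cx a b ++ [.phaseInv b] ++ cx a b)

theorem single_mulVec {g : Gate Q} {q : Q} {z : ℂ} (hg : g.matrix = onQubit q (phaseMatrix z))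
    (x : Q → Bool) :
    Circuit.matrix [g] *ᵥ ket x = (if x q then z else 1 : ℂ) • ket x := by
  rw [show Circuit.matrix [g] = g.matrix by simp [Circuit.matrix], hg, phaseMatrix_mulVec_ket]

theorem cz_mulVec_ket {a b : Q} (h : a ≠ b) (x : Q → Bool) :
    (cz a b).matrix *ᵥ ket x = (if x a && x b then -1 else 1 : ℂ) • ket x := by
  rw [cz, smul_append (smul_append (single_mulVec rfl x) (single_mulVec rfl x))
    (cx_phase_cx h rfl x)]
  congr 1
  cases x a <;> cases x b <;> simp

theorem tCount_cz (a b : Q) : Circuit.tCount (cz a b) = 0 := by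
  simp only [cz, Circuit.tCount_append, tCount_cx]
  rfl

/-- The doubly controlled sign flip, from the expansion
`4abc = a + b + c - (a ⊕ b) - (a ⊕ c) - (b ⊕ c) + (a ⊕ b ⊕ c)`. -/
def ccz (a b c : Q) : Circuit Q :=
  [.t a] ++ [.t b] ++ [.t c] ++ (cx a b ++ [.tInv b] ++ cx a b) ++ (cx a c ++ [.tInv c] ++ cx a c) ++
    (cx b c ++ [.tInv c] ++ cx b c) ++ (cx a c ++ (cx b c ++ [.t c] ++ cx b c) ++ cx a c)

theorem ccz_mulVec_ket {a b c : Q} (hab : a ≠ b) (hac : a ≠ c) (hbc : b ≠ c) (x : Q → Bool) :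
    (ccz a b c).matrix *ᵥ ket x = (if x a && x b && x c then -1 else 1 : ℂ) • ket x := by
  have h7 : Circuit.matrix (cx a c ++ (cx b c ++ [.t c] ++ cx b c) ++ cx a c) *ᵥ ket x =
      (if xor (xor (x c) (x a)) (x b) then Complex.exp (Real.pi / 4 * Complex.I) else 1 : ℂ) •
        ket x := by
    rw [Circuit.append_mulVec, Circuit.append_mulVec, sends_cx hac, cx_phase_cx hbc rfl,
      Matrix.mulVec_smul, sends_cx hac]
    simp [Function.update_of_ne hac, Function.update_of_ne hbc]
  rw [ccz, smul_append (smul_append (smul_append (smul_append (smul_append (smul_append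
    (single_mulVec rfl x) (single_mulVec rfl x)) (single_mulVec rfl x)) (cx_phase_cx hab rfl x))
    (cx_phase_cx hac rfl x)) (cx_phase_cx hbc rfl x)) h7]
  congr 1
  have h4 := exp_quarter_pow_four
  have h1 := exp_quarter_mul_inv
  -- The phases `ω` and `ω'` cancel for every value of the three qubits except `111`, where `ω ^ 4`
  -- remains.
  set ω := Complex.exp (Real.pi / 4 * Complex.I)
  set ω' := Complex.exp (-(Real.pi / 4 * Complex.I))
  have h4' : ω * ω * ω * ω = -1 := by rw [← h4]; ring
  cases x a <;> cases x b <;> cases x c <;> simp <;> first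
    | linear_combination h1
    | linear_combination (ω * ω' + 1) * h1
    | linear_combination h4'

/-- The Toffoli gate. -/
def ccx (a b c : Q) : Circuit Q := [.hadamard c] ++ ccz a b c ++ [.hadamard c]

theorem sends_ccx {a b c : Q} (hab : a ≠ b) (hac : a ≠ c) (hbc : b ≠ c) (x : Q → Bool) :
    Sends (ccx a b c) x (Function.update x c (xor (x c) (x a && x b))) := by
  refine sends_hadamard_conj _ fun y => ?_
  rw [ccz_mulVec_ket hab hac hbc]
  simp [Function.update_of_ne hac, Function.update_of_ne hbc]

theorem tCount_ccx (a b c : Q) : Circuit.tCount (ccx a b c) = 7 := by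
  simp only [ccx, ccz, Circuit.tCount_append, tCount_cx]
  rfl

/-- The controlled swap of two qubits. -/
def cswap (c a b : Q) : Circuit Q := cx b a ++ ccx c a b ++ cx b a

theorem sends_cswap {a b c : Q} (hab : a ≠ b) (hca : c ≠ a) (hcb : c ≠ b) (x : Q → Bool) :
    Sends (cswap c a b) x (if x c then x ∘ Equiv.swap a b else x) := by
  have := ((sends_cx hab.symm x).append (sends_ccx hca hcb hab _)).append (sends_cx hab.symm _)
  rw [cswap]
  convert this using 1
  funext q
  by_cases hqa : q = a
  · subst hqa
    cases hc : x c <;> simp [hc, Function.update_of_ne hab, Function.update_of_ne hab.symm,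
      Function.update_of_ne hca]
  · by_cases hqb : q = b
    · subst hqb
      cases hc : x c <;> simp [hc, Function.update_of_ne hab, Function.update_of_ne hab.symm,
        Function.update_of_ne hca]
      cases x a <;> cases x q <;> rfl
    · cases hc : x c <;> simp [Function.update_of_ne hqa, Function.update_of_ne hqb,
        Equiv.swap_apply_of_ne_of_ne hqa hqb]

theorem tCount_cswap (a b c : Q) : Circuit.tCount (cswap c a b) = 7 := by
  simp only [cswap, Circuit.tCount_append, tCount_cx, tCount_ccx]

end

section

variable {Q : Type} [DecidableEq Q] [Fintype Q]

/-! ### Unary iteration -/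

/-- Unary iteration over the values of the address qubits in the list. The qubit `wk d` is the
control; the qubits `wk (d + 1), wk (d + 2), …` hold the controls of the deeper levels of the
binary tree. At the leaf with address `bs`, the circuit `leaf bs c` is run, where `c` is a qubit
that holds `1` if and only if `wk d` does and the address qubits have the value `bs`. -/
def unary (wk : ℕ → Q) (leaf : List Bool → Q → Circuit Q) : ℕ → List Q → Circuit Q
  | d, [] => leaf [] (wk d)
  | d, a :: as =>
    ccx (wk d) a (wk (d + 1)) ++ unary wk (fun bs => leaf (true :: bs)) (d + 1) as ++
      cx (wk d) (wk (d + 1)) ++ unary wk (fun bs => leaf (false :: bs)) (d + 1) as ++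
      cx (wk d) (wk (d + 1)) ++ ccx (wk d) a (wk (d + 1))

/-- Correctness of unary iteration. `φ bs` is the action of the leaf with address `bs`; it may neither
change the address qubits nor depend on or change the work qubits. Between the two branches at a
node, a CNOT gate turns the control `w ∧ a` into `w ∧ ¬a`. -/
theorem sends_unary {wk : ℕ → Q} {N : ℕ} (hinj : ∀ i j, i ≤ N → j ≤ N → wk i = wk j → i = j)
    (as : List Q) :
    ∀ (leaf : List Bool → Q → Circuit Q) (φ : List Bool → (Q → Bool) → Q → Bool) (d : ℕ),
    d + as.length ≤ N →
    (∀ bs i x, i ≤ N → Sends (leaf bs (wk i)) x (if x (wk i) then φ bs x else x)) →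
    (∀ bs x, ∀ a ∈ as, φ bs x a = x a) →
    (∀ bs x i b, i ≤ N → φ bs (Function.update x (wk i) b) = Function.update (φ bs x) (wk i) b) →
    (∀ a ∈ as, ∀ i ≤ N, wk i ≠ a) →
    ∀ x, (∀ i, d < i → i ≤ N → x (wk i) = false) →
      Sends (unary wk leaf d as) x (if x (wk d) then φ (as.map x) x else x) := by
  induction as with
  | nil =>
    intro leaf φ d hd hleaf _ _ _ x _
    simpa [unary] using hleaf [] d x (by simpa using hd)
  | cons a as ih =>
    intro leaf φ d hd hleaf hφa hφw hdisj x hx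
    simp only [List.length_cons] at hd
    have hw : wk d ≠ wk (d + 1) := fun h => by
      have := hinj _ _ (by omega) (by omega) h; omega
    have hda : wk d ≠ a := hdisj a (by simp) d (by omega)
    have hwa : wk (d + 1) ≠ a := hdisj a (by simp) (d + 1) (by omega)
    have hx1 : x (wk (d + 1)) = false := hx _ (by omega) (by omega)
    have hφself : ∀ bs x i, i ≤ N → φ bs x (wk i) = x (wk i) := fun bs x i hi => by
      have := congrFun (hφw bs x i (x (wk i)) hi) (wk i)
      simpa using this
    have hmap : ∀ (x : Q → Bool) b, as.map (Function.update x (wk (d + 1)) b) = as.map x := by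
      intro x b
      refine List.map_congr_left fun a' ha' => Function.update_of_ne ?_ _ _
      exact (hdisj a' (by simp [ha']) (d + 1) (by omega)).symm
    have step : ∀ (e : Bool) (y : Q → Bool) (c : Bool),
        (∀ i, d + 1 < i → i ≤ N → y (wk i) = false) →
        Sends (unary wk (fun bs => leaf (e :: bs)) (d + 1) as) (Function.update y (wk (d + 1)) c)
          (Function.update (if c then φ (e :: as.map y) y else y) (wk (d + 1)) c) := by
      intro e y c hy
      have := ih (fun bs => leaf (e :: bs)) (fun bs => φ (e :: bs)) (d + 1) (by omega)
        (fun bs i x hi => hleaf _ i x hi) (fun bs x a' ha' => hφa _ x a' (by simp [ha']))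
        (fun bs x i b hi => hφw _ x i b hi) (fun a' ha' => hdisj a' (by simp [ha']))
        (Function.update y (wk (d + 1)) c) ?_
      · simp only [Function.update_self, hmap] at this
        convert this using 1
        cases c <;> simp [hφw _ _ _ _ (show d + 1 ≤ N by omega)]
      · intro i hi hiN
        rw [Function.update_of_ne, hy i hi hiN]
        intro h
        have := hinj _ _ hiN (by omega) h
        omega
    have hclean : ∀ i, d + 1 < i → i ≤ N → x (wk i) = false := fun i hi => hx i (by omega)
    have hx0 : Function.update x (wk (d + 1)) false = x := by rw [← hx1, Function.update_eq_self]
    have e1 := sends_ccx hda hw hwa.symm x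
    rw [hx1, Bool.false_xor] at e1
    have e2 := step true x (x (wk d) && x a) hclean
    set y := if (x (wk d) && x a) then φ (true :: as.map x) x else x with hy
    have hyd : ∀ i, i ≤ N → y (wk i) = x (wk i) := by
      intro i hi
      rw [hy]; split_ifs
      · exact hφself _ _ i hi
      · rfl
    have hya : ∀ a' ∈ a :: as, y a' = x a' := by
      intro a' ha'
      rw [hy]; split_ifs
      · exact hφa _ _ a' ha'
      · rfl
    have hymap : as.map y = as.map x := List.map_congr_left fun a' ha' => hya a' (by simp [ha'])
    have e3 := sends_cx hw (Function.update y (wk (d + 1)) (x (wk d) && x a))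
    rw [Function.update_self, Function.update_idem, Function.update_of_ne hw, hyd d (by omega)] at e3
    have e4 := step false y (xor (x (wk d) && x a) (x (wk d)))
      (fun i hi hiN => by rw [hyd i hiN, hclean i hi hiN])
    rw [hymap] at e4
    set z := if xor (x (wk d) && x a) (x (wk d)) then φ (false :: as.map x) y else y with hz
    have hzd : z (wk d) = x (wk d) := by
      rw [hz]; split_ifs
      · rw [hφself _ _ d (by omega), hyd d (by omega)]
      · exact hyd d (by omega)
    have hza : z a = x a := by
      rw [hz]; split_ifs
      · rw [hφa _ _ a (by simp), hya a (by simp)]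
      · exact hya a (by simp)
    have hzw : z (wk (d + 1)) = false := by
      rw [hz]; split_ifs
      · rw [hφself _ _ _ (by omega), hyd _ (by omega), hx1]
      · rw [hyd _ (by omega), hx1]
    have e5 := sends_cx hw (Function.update z (wk (d + 1)) (xor (x (wk d) && x a) (x (wk d))))
    rw [Function.update_self, Function.update_idem, Function.update_of_ne hw, hzd] at e5
    have e6 := sends_ccx hda hw hwa.symm (Function.update z (wk (d + 1))
      (xor (xor (x (wk d) && x a) (x (wk d))) (x (wk d))))
    rw [Function.update_self, Function.update_idem, Function.update_of_ne hw, hzd,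
      Function.update_of_ne hwa.symm, hza] at e6
    have := ((((e1.append e2).append e3).append e4).append e5).append e6
    rw [unary]
    convert this using 1
    have hz0 : Function.update z (wk (d + 1)) false = z := by rw [← hzw, Function.update_eq_self]
    cases h1 : x (wk d) <;> cases h2 : x a <;> simp [hz0] <;> simp [hz, hy, h1, h2]

/-- The additive constant `14`, two Toffoli gates at an inner node, makes the bound inductive. -/
theorem tCount_unary_le {wk : ℕ → Q} {τ : ℕ} (as : List Q) :
    ∀ (leaf : List Bool → Q → Circuit Q) (d : ℕ),
    (∀ bs q, Circuit.tCount (leaf bs q) ≤ τ) →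
    Circuit.tCount (unary wk leaf d as) + 14 ≤ 2 ^ as.length * (τ + 14) := by
  induction as with
  | nil => intro leaf d h; simpa [unary] using h [] (wk d)
  | cons a as ih =>
    intro leaf d h
    have h1 := ih (fun bs => leaf (true :: bs)) (d + 1) fun bs q => h _ q
    have h2 := ih (fun bs => leaf (false :: bs)) (d + 1) fun bs q => h _ q
    simp only [unary, Circuit.tCount_append, tCount_ccx, tCount_cx, List.length_cons, pow_succ]
    linarith

/-- Unary iteration over the values of the address register `e`, with `wk 0` as the control at the
root, which is set to `1`. -/
def iterate (wk : ℕ → Q) {k : ℕ} (e : Fin k → Q) (leaf : (Fin k → Bool) → Q → Circuit Q) :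
    Circuit Q :=
  Circuit.pauliX (wk 0) ++
    unary wk (fun bs => leaf fun i => bs.getD i false) 0 ((List.finRange k).map e) ++
    Circuit.pauliX (wk 0)

theorem sends_iterate {wk : ℕ → Q} {N k : ℕ}
    (hinj : ∀ i j, i ≤ N → j ≤ N → wk i = wk j → i = j) (hk : k ≤ N) {e : Fin k → Q}
    {leaf : (Fin k → Bool) → Q → Circuit Q} (φ : (Fin k → Bool) → (Q → Bool) → Q → Bool)
    (hleaf : ∀ g i x, i ≤ N → Sends (leaf g (wk i)) x (if x (wk i) then φ g x else x))
    (hφa : ∀ g x i, φ g x (e i) = x (e i))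
    (hφw : ∀ g x i b, i ≤ N → φ g (Function.update x (wk i) b) = Function.update (φ g x) (wk i) b)
    (hdisj : ∀ j, ∀ i ≤ N, wk i ≠ e j) (x : Q → Bool) (hx : ∀ i ≤ N, x (wk i) = false) :
    Sends (iterate wk e leaf) x (φ (fun i => x (e i)) x) := by
  have h0 : x (wk 0) = false := hx 0 (by omega)
  have e1 := sends_pauliX (wk 0) x
  rw [h0, Bool.not_false] at e1
  have e2 := sends_unary hinj ((List.finRange k).map e)
    (fun bs => leaf fun i => bs.getD i false) (fun bs => φ fun i => bs.getD i false) 0 (by simpa)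
    (fun bs i x hi => hleaf _ i x hi)
    (fun bs x a ha => by
      obtain ⟨i, _, rfl⟩ := List.mem_map.1 ha
      exact hφa _ x i)
    (fun bs x i b hi => hφw _ x i b hi)
    (fun a ha i hi => by
      obtain ⟨j, _, rfl⟩ := List.mem_map.1 ha
      exact hdisj j i hi)
    (Function.update x (wk 0) true) (fun i hi hiN => by
      rw [Function.update_of_ne, hx i hiN]
      intro h
      have := hinj _ _ hiN (by omega) h
      omega)
  have hg : (fun i : Fin k => (((List.finRange k).map e).map
      (Function.update x (wk 0) true)).getD i false) = fun i => x (e i) := by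
    funext i
    rw [List.getD_eq_getElem _ _ (by simp)]
    simp [Function.update_of_ne (hdisj i 0 (by omega)).symm]
  rw [hg, Function.update_self, if_pos rfl, hφw _ _ _ _ (by omega)] at e2
  have e3 := sends_pauliX (wk 0) (Function.update (φ (fun i => x (e i)) x) (wk 0) true)
  rw [Function.update_self, Function.update_idem] at e3
  have := (e1.append e2).append e3
  rw [iterate]
  convert this using 1
  have h := hφw (fun i => x (e i)) x 0 false (by omega)
  rw [Bool.not_true, ← h, ← h0, Function.update_eq_self]

theorem tCount_iterate_le {wk : ℕ → Q} {τ k : ℕ} {e : Fin k → Q}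
    {leaf : (Fin k → Bool) → Q → Circuit Q} (h : ∀ g q, Circuit.tCount (leaf g q) ≤ τ) :
    Circuit.tCount (iterate wk e leaf) ≤ 2 ^ k * (τ + 14) := by
  have := tCount_unary_le (wk := wk) ((List.finRange k).map e)
    (fun bs => leaf fun i => bs.getD i false) 0 (fun bs q => h _ q)
  have hX : Circuit.tCount (Circuit.pauliX (wk 0)) = 0 := rfl
  simp only [List.length_map, List.length_finRange] at this
  simp only [iterate, Circuit.tCount_append, hX]
  omega

/-! ### Controlled operations on several qubits -/

/-- CNOT gates from one control to several targets. -/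
def fanout (c : Q) (ts : List Q) : Circuit Q := (ts.map (cx c)).flatten

theorem sends_fanout {c : Q} (ts : List Q) (hnd : ts.Nodup) (hc : c ∉ ts) (x : Q → Bool) :
    Sends (fanout c ts) x (fun q => xor (x q) (decide (q ∈ ts) && x c)) := by
  induction ts generalizing x with
  | nil => simpa [fanout] using Sends.nil x
  | cons a ts ih =>
    rw [List.nodup_cons] at hnd
    simp only [List.mem_cons, not_or] at hc
    have := (sends_cx hc.1 x).append (ih hnd.2 hc.2 (Function.update x a (xor (x a) (x c))))
    change Sends (cx c a ++ fanout c ts) _ _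
    convert this using 1
    funext q
    rw [Function.update_of_ne hc.1]
    by_cases hq : q = a
    · subst hq; simp [hnd.1]
    · simp [hq]

theorem tCount_fanout (c : Q) (ts : List Q) : Circuit.tCount (fanout c ts) = 0 := by
  induction ts with
  | nil => rfl
  | cons a ts ih =>
    rw [fanout] at ih ⊢
    rw [List.map_cons, List.flatten_cons, Circuit.tCount_append, tCount_cx, ih]

/-- Controlled swaps of the qubits `f b` and `g b` for all `b` in a list. -/
def cswaps (c : Q) {ι : Type} (f g : ι → Q) (bs : List ι) : Circuit Q :=
  (bs.map fun b => cswap c (f b) (g b)).flatten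

/-- The permutation of the qubits that exchanges `f b` and `g b` for all `b` in a list. -/
def swaps {ι : Type} (f g : ι → Q) (bs : List ι) : Equiv.Perm Q :=
  (bs.map fun b => Equiv.swap (f b) (g b)).prod

theorem sends_cswaps {c : Q} {ι : Type} {f g : ι → Q} (hfg : ∀ b b', f b ≠ g b')
    (hcf : ∀ b, c ≠ f b) (hcg : ∀ b, c ≠ g b) (bs : List ι) (x : Q → Bool) :
    Sends (cswaps c f g bs) x (if x c then x ∘ swaps f g bs else x) := by
  induction bs generalizing x with
  | nil => simpa [cswaps, swaps] using Sends.nil x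
  | cons b bs ih =>
    have := (sends_cswap (hfg b b) (hcf b) (hcg b) x).append (ih _)
    change Sends (cswap c (f b) (g b) ++ cswaps c f g bs) _ _
    convert this using 1
    cases hc : x c
    · simp [hc]
    · simp [hc, swaps, Function.comp_assoc, Equiv.swap_apply_of_ne_of_ne (hcf b) (hcg b)]

theorem swaps_apply {ι : Type} {f g : ι → Q} (hf : Function.Injective f)
    (hg : Function.Injective g) (hfg : ∀ b b', f b ≠ g b') (bs : List ι) (hnd : bs.Nodup) :
    (∀ b ∈ bs, swaps f g bs (f b) = g b) ∧ (∀ b ∈ bs, swaps f g bs (g b) = f b) ∧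
      ∀ q, (∀ b ∈ bs, q ≠ f b ∧ q ≠ g b) → swaps f g bs q = q := by
  induction bs with
  | nil => simp [swaps]
  | cons a bs ih =>
    rw [List.nodup_cons] at hnd
    obtain ⟨h1, h2, h3⟩ := ih hnd.2
    have hs : ∀ q, swaps f g (a :: bs) q = Equiv.swap (f a) (g a) (swaps f g bs q) := by
      intro q; simp [swaps]
    have hne : ∀ b ∈ bs, b ≠ a := fun b hb h => hnd.1 (h ▸ hb)
    refine ⟨fun b hb => ?_, fun b hb => ?_, fun q hq => ?_⟩
    · rw [hs]
      rcases List.mem_cons.1 hb with rfl | hb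
      · rw [h3 _ fun b' hb' => ⟨fun h => hne b' hb' (hf h).symm, hfg _ _⟩, Equiv.swap_apply_left]
      · rw [h1 b hb, Equiv.swap_apply_of_ne_of_ne (hfg _ _).symm
          fun h => hne b hb (hg h)]
    · rw [hs]
      rcases List.mem_cons.1 hb with rfl | hb
      · rw [h3 _ fun b' hb' => ⟨(hfg _ _).symm, fun h => hne b' hb' (hg h).symm⟩,
          Equiv.swap_apply_right]
      · rw [h2 b hb, Equiv.swap_apply_of_ne_of_ne (fun h => hne b hb (hf h)) (hfg _ _)]
    · rw [hs, h3 q fun b hb => hq b (by simp [hb]),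
        Equiv.swap_apply_of_ne_of_ne (hq a (by simp)).1 (hq a (by simp)).2]

theorem tCount_cswaps (c : Q) {ι : Type} (f g : ι → Q) (bs : List ι) :
    Circuit.tCount (cswaps c f g bs) = 7 * bs.length := by
  induction bs with
  | nil => rfl
  | cons b bs ih =>
    rw [cswaps] at ih ⊢
    rw [List.map_cons, List.flatten_cons, Circuit.tCount_append, tCount_cswap, ih, List.length_cons]
    ring

end

section

/-! ### Data lookup -/

variable {n kh kl lam m : ℕ}

/-- The register of qubits with `m + 8` work qubits: `m + 2` scratch qubits and six auxiliary
qubits. -/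
abbrev Wire (n kh kl lam m : ℕ) := Qubit n kh kl lam m (m + 2 + 6)

/-- The `i`-th scratch qubit, for `i ≤ m + 1` (indices are taken modulo `m + 2`). -/
def scratch (i : ℕ) : Wire n kh kl lam m := .inl (.work (Fin.castAdd 6 (Fin.ofNat (m + 2) i)))

/-- The `i`-th auxiliary qubit. -/
def aux (i : Fin 6) : Wire n kh kl lam m := .inl (.work (Fin.natAdd (m + 2) i))

/-- All scratch qubits are `0`; the auxiliary qubits are arbitrary. -/
def ScratchClean (x : Wire n kh kl lam m → Bool) : Prop := ∀ i ≤ m + 1, x (scratch i) = false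

theorem WorkClean.scratchClean {x : Wire n kh kl lam m → Bool} (h : WorkClean x) :
    ScratchClean x := fun _ _ => h _

theorem scratch_inj (i j : ℕ) (hi : i ≤ m + 1) (hj : j ≤ m + 1)
    (h : (scratch i : Wire n kh kl lam m) = scratch j) : i = j := by
  simp only [scratch, Sum.inl.injEq, Ancilla.work.injEq, Fin.ext_iff, Fin.val_castAdd,
    Fin.val_ofNat] at h
  rwa [Nat.mod_eq_of_lt (by omega), Nat.mod_eq_of_lt (by omega)] at h

theorem scratch_ne_aux (i : ℕ) (j : Fin 6) : (scratch i : Wire n kh kl lam m) ≠ aux j := by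
  simp only [scratch, aux, ne_eq, Sum.inl.injEq, Ancilla.work.injEq, Fin.ext_iff, Fin.val_castAdd,
    Fin.val_natAdd, Fin.val_ofNat]
  have := Nat.mod_lt i (show 0 < m + 2 by omega)
  omega

theorem aux_inj {i j : Fin 6} : (aux i : Wire n kh kl lam m) = aux j ↔ i = j := by
  simp [aux]

/-- SELECT by unary iteration over the most significant part of the index. -/
def selectCircuit (data : (Fin kh → Bool) → Fin lam → Word m) : Circuit (Wire n kh kl lam m) :=
  iterate scratch (fun i => .inl (.hi i)) fun g c =>
    fanout c ((Finset.univ.filter fun p : Fin lam × Fin (m + 1) => data g p.1 p.2 = true).toList.map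
      fun p => .inl (.cell p.1 p.2))

theorem sends_selectCircuit (hkh : kh ≤ m + 1) (data : (Fin kh → Bool) → Fin lam → Word m)
    (x : Wire n kh kl lam m → Bool) (hx : ScratchClean x) :
    Sends (selectCircuit data) x
      (setCells x fun i b => xor (x (.inl (.cell i b))) (data (address x).1 i b)) := by
  refine sends_iterate (N := m + 1) scratch_inj hkh
    (fun g x => setCells x fun i b => xor (x (.inl (.cell i b))) (data g i b)) ?_ ?_ ?_ ?_ x hx
  · intro g i x _
    have hcell : Function.Injective fun p : Fin lam × Fin (m + 1) =>
        (.inl (.cell p.1 p.2) : Wire n kh kl lam m) := by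
      rintro ⟨a, b⟩ ⟨c, d⟩ h
      simpa using h
    convert sends_fanout _ ((Finset.nodup_toList _).map hcell) ?_ x using 1
    · funext q
      rcases q with (_ | _ | ⟨i', b⟩ | _ | _ | _ | _ | _) | p
      case inl.cell =>
        cases hc : x (scratch i) <;> simp [setCells]
      all_goals cases hc : x (scratch i) <;> simp [setCells]
    · simp [scratch]
  · intro g x i; rfl
  · intro g x i b _
    funext q
    rcases q with (_ | _ | ⟨i', b⟩ | _ | _ | _ | _ | _) | p <;>
      simp [setCells, scratch, Function.update_apply]
  · intro j i _; simp [scratch]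

theorem tCount_selectCircuit_le (data : (Fin kh → Bool) → Fin lam → Word m) :
    Circuit.tCount (selectCircuit data : Circuit (Wire n kh kl lam m)) ≤ 14 * 2 ^ kh := by
  have := tCount_iterate_le (wk := (scratch : ℕ → Wire n kh kl lam m)) (τ := 0)
    (e := fun i : Fin kh => .inl (.hi i)) (leaf := fun g c =>
    fanout c ((Finset.univ.filter fun p : Fin lam × Fin (m + 1) => data g p.1 p.2 = true).toList.map
      fun p => .inl (.cell p.1 p.2))) (fun g q => (tCount_fanout _ _).le)
  rw [selectCircuit]
  linarith

/-- SWAP by unary iteration over the least significant part `l` of the index: the words `0` and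
`l` are exchanged. -/
def swapCircuit : Circuit (Wire n kh kl lam m) :=
  iterate scratch (fun i => .inl (.lo i)) fun l c =>
    if h : 0 < Nat.ofBits l ∧ Nat.ofBits l < lam then
      cswaps c (fun b => .inl (.cell ⟨0, h.1.trans h.2⟩ b)) (fun b => .inl (.cell ⟨_, h.2⟩ b))
        (List.finRange (m + 1))
    else []

/-- The exchange of the words `0` and `l`; the identity if `l` is not the number of a word. -/
def wordSwap (lam : ℕ) (l : Fin kl → Bool) : Equiv.Perm (Fin lam) :=
  if h : 0 < Nat.ofBits l ∧ Nat.ofBits l < lam then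
    Equiv.swap ⟨0, h.1.trans h.2⟩ ⟨_, h.2⟩
  else 1

theorem wordSwap_val (l : Fin kl → Bool) (i : Fin lam) (hi : i.val = 0)
    (hl : Nat.ofBits l < lam) : (wordSwap lam l i).val = Nat.ofBits l := by
  rw [wordSwap]
  split_ifs with h
  · rw [show i = ⟨0, h.1.trans h.2⟩ from Fin.ext hi, Equiv.swap_apply_left]
  · simp; omega

theorem sends_swapCircuit (hkl : kl ≤ m + 1) (x : Wire n kh kl lam m → Bool)
    (hx : ScratchClean x) :
    Sends swapCircuit x
      (setCells x fun i b => x (.inl (.cell (wordSwap lam (address x).2 i) b))) := by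
  refine sends_iterate (N := m + 1) scratch_inj hkl
    (fun l x => setCells x fun i b => x (.inl (.cell (wordSwap lam l i) b))) ?_ ?_ ?_ ?_ x hx
  · intro l i x _
    split_ifs with h hc hc
    · have hne : ∀ b b' : Fin (m + 1), (.inl (.cell ⟨0, h.1.trans h.2⟩ b) : Wire n kh kl lam m) ≠
          .inl (.cell ⟨Nat.ofBits l, h.2⟩ b') := by
        intro b b' h'
        simp only [Sum.inl.injEq, Ancilla.cell.injEq, Fin.mk.injEq] at h'
        omega
      convert sends_cswaps hne ?_ ?_ _ x using 1
      · rw [if_pos hc]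
        obtain ⟨h1, h2, h3⟩ := swaps_apply
          (f := fun b => (.inl (.cell ⟨0, h.1.trans h.2⟩ b) : Wire n kh kl lam m))
          (g := fun b => .inl (.cell ⟨Nat.ofBits l, h.2⟩ b))
          (fun b b' h => by simpa using h) (fun b b' h => by simpa using h) hne
          (List.finRange (m + 1)) (List.nodup_finRange _)
        funext q
        rw [Function.comp_apply]
        rcases q with (_ | _ | ⟨i', b⟩ | _ | _ | _ | _ | _) | p
        case inl.cell =>
          simp only [setCells, wordSwap, dif_pos h]
          by_cases hi0 : i' = ⟨0, h.1.trans h.2⟩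
          · subst hi0; rw [Equiv.swap_apply_left, h1 b (by simp)]
          · by_cases hil : i' = ⟨_, h.2⟩
            · subst hil; rw [Equiv.swap_apply_right, h2 b (by simp)]
            · rw [Equiv.swap_apply_of_ne_of_ne hi0 hil, h3]
              simp [hi0, hil]
        all_goals rw [h3 _ (by simp)]; simp [setCells]
      · simp [scratch]
      · simp [scratch]
    · have hne : ∀ b b' : Fin (m + 1), (.inl (.cell ⟨0, h.1.trans h.2⟩ b) : Wire n kh kl lam m) ≠
          .inl (.cell ⟨Nat.ofBits l, h.2⟩ b') := by
        intro b b' h'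
        simp only [Sum.inl.injEq, Ancilla.cell.injEq, Fin.mk.injEq] at h'
        omega
      convert sends_cswaps hne ?_ ?_ _ x using 1
      · rw [if_neg hc]
      · simp [scratch]
      · simp [scratch]
    · convert Sends.nil x using 1
      funext q
      rcases q with (_ | _ | ⟨i', b⟩ | _ | _ | _ | _ | _) | p <;> simp [setCells, wordSwap, h]
    · exact Sends.nil x
  · intro g x i; rfl
  · intro g x i b _
    funext q
    rcases q with (_ | _ | ⟨i', b⟩ | _ | _ | _ | _ | _) | p <;>
      simp [setCells, scratch, Function.update_apply]
  · intro j i _; simp [scratch]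

theorem tCount_swapCircuit_le :
    Circuit.tCount (swapCircuit : Circuit (Wire n kh kl lam m)) ≤ 21 * (2 ^ kl * (m + 1)) := by
  have := tCount_iterate_le (wk := (scratch : ℕ → Wire n kh kl lam m)) (τ := 7 * (m + 1))
    (e := fun i : Fin kl => .inl (.lo i)) (leaf := fun l c =>
    if h : 0 < Nat.ofBits l ∧ Nat.ofBits l < lam then
      cswaps c (fun b => .inl (.cell ⟨0, h.1.trans h.2⟩ b)) (fun b => .inl (.cell ⟨_, h.2⟩ b))
        (List.finRange (m + 1))
    else []) (fun g q => by
      split_ifs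
      · rw [tCount_cswaps, List.length_finRange]
      · simp [Circuit.tCount])
  rw [swapCircuit]
  refine this.trans ?_
  calc 2 ^ kl * (7 * (m + 1) + 14) ≤ 2 ^ kl * (21 * (m + 1)) := by gcongr; omega
    _ = _ := by ring

/-- The word that SELECT and SWAP move to the leading cell. -/
def lookedUp (data : (Fin kh → Bool) → Fin lam → Word m) (i0 : Fin lam) (a : Address kh kl) :
    Word m :=
  data a.1 (wordSwap lam a.2 i0)

theorem sends_selectSwap (hkh : kh ≤ m + 1) (hkl : kl ≤ m + 1)
    (data : (Fin kh → Bool) → Fin lam → Word m)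
    (x : Wire n kh kl lam m → Bool) (hx : ScratchClean x) (hc : CellsClean x) :
    Sends (selectCircuit data ++ swapCircuit) x
      (setCells x fun i b => data (address x).1 (wordSwap lam (address x).2 i) b) := by
  have h1 := sends_selectCircuit hkh data x hx
  have h2 := sends_swapCircuit hkl (setCells x fun i b =>
    xor (x (.inl (.cell i b))) (data (address x).1 i b)) hx
  convert h1.append h2 using 1
  funext q
  rcases q with (_ | _ | ⟨i', b⟩ | _ | _ | _ | _ | _) | p
  case inl.cell =>
    simp only [setCells, hc _ _, Bool.false_xor]
    rfl
  all_goals rfl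

/-- The basis state `x` with the word `v` added to its word register. -/
def xorWord (x : Wire n kh kl lam m → Bool) (v : Word m) : Wire n kh kl lam m → Bool
  | .inl (.word b) => xor (x (.inl (.word b))) (v b)
  | q => x q

/-- The data-lookup oracle: conjugation of the copying CNOT gates by SELECT and SWAP. -/
theorem sends_lookup (hkh : kh ≤ m + 1) (hkl : kl ≤ m + 1)
    (data : (Fin kh → Bool) → Fin lam → Word m) (i0 : Fin lam) (hi0 : i0.val = 0)
    (C : Oracles n kh kl lam m (m + 2 + 6)) (hs : C.select = selectCircuit data)
    (hw : C.swap = swapCircuit)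
    (x : Wire n kh kl lam m → Bool) (hx : ScratchClean x) (hc : CellsClean x) :
    Sends C.lookup x (xorWord x (lookedUp data i0 (address x))) := by
  have hlook : C.lookup = (selectCircuit data ++ swapCircuit) ++ Oracles.copy n kh kl lam m _ ++
      Circuit.inv (selectCircuit data ++ swapCircuit) := by
    simp [Oracles.lookup, hs, hw, Circuit.inv_append]
  have hlam : 0 < lam := hi0 ▸ i0.isLt
  have hi0' : i0 = ⟨0, hlam⟩ := Fin.ext hi0
  have hcopy : ∀ (bs : List (Fin (m + 1))), bs.Nodup → ∀ (x : Wire n kh kl lam m → Bool),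
      Sends (bs.map fun b => Gate.cnot (.inl (.cell ⟨0, hlam⟩ b)) (.inl (.word b)) (by simp)) x
        (xorWord x fun b => decide (b ∈ bs) && x (.inl (.cell i0 b))) := by
    intro bs
    induction bs with
    | nil =>
      intro _ x
      refine (Sends.nil x).congr (funext fun q => ?_)
      rcases q with (_ | _ | ⟨i', b⟩ | _ | _ | _ | _ | _) | p <;> simp [xorWord]
    | cons a bs ih =>
      intro hnd x
      rw [List.nodup_cons] at hnd
      have h1 : Sends [Gate.cnot (.inl (.cell ⟨0, hlam⟩ a)) (.inl (.word a)) (by simp)] x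
          (Function.update x (.inl (.word a))
            (xor (x (.inl (.word a))) (x (.inl (.cell ⟨0, hlam⟩ a))))) := by
        rw [Sends, ← cnot_mulVec_ket _ _ (by simp)]
        simp [Circuit.matrix]
      refine (h1.append (ih hnd.2 _)).congr (funext fun q => ?_)
      rcases q with (_ | _ | ⟨i', b⟩ | b | _ | _ | _ | _) | p
      case inl.word =>
        by_cases hb : b = a
        · subst hb; simp [xorWord, hnd.1, hi0']
        · simp [xorWord, hb]
      all_goals simp [xorWord]
  have e := Sends.conj' (sends_selectSwap hkh hkl data x hx hc)
    (d := Oracles.copy n kh kl lam m (m + 2 + 6)) (by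
      rw [Oracles.copy, dif_pos hlam]
      exact hcopy (List.finRange (m + 1)) (List.nodup_finRange _) _)
    (x' := xorWord x (lookedUp data i0 (address x))) (by
      convert sends_selectSwap hkh hkl data _ ?_ ?_ using 1
      · funext q
        rcases q with (_ | _ | ⟨i', b⟩ | b | _ | _ | _ | _) | p
        case inl.word => simp [xorWord, setCells, lookedUp]
        all_goals simp [xorWord, setCells, address]
      · exact hx
      · exact hc)
  rw [hlook]
  exact e

theorem tCount_lookup_le (data : (Fin kh → Bool) → Fin lam → Word m)
    (C : Oracles n kh kl lam m (m + 2 + 6)) (hs : C.select = selectCircuit data)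
    (hw : C.swap = swapCircuit) :
    Circuit.tCount C.lookup ≤ 28 * 2 ^ kh + 42 * (2 ^ kl * (m + 1)) := by
  have h1 := tCount_selectCircuit_le (n := n) (kl := kl) data
  have h2 := tCount_swapCircuit_le (n := n) (kh := kh) (kl := kl) (lam := lam) (m := m)
  have h3 : Circuit.tCount (Oracles.copy n kh kl lam m (m + 2 + 6)) = 0 := by
    rw [Oracles.copy]
    split_ifs
    · simp [Circuit.tCount, Function.comp_def, Gate.tCount]
    · rfl
  simp only [Oracles.lookup, Circuit.tCount_append, Circuit.tCount_inv, hs, hw, h3]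
  omega

/-! ### SWAP-UP -/

/-- SWAP-UP: the code of a mode is looked up by SELECT and SWAP, and unary iteration over the first
`k` bits of the code exchanges the system qubit `p0` with the decoded mode. -/
def swapUp (p0 : Fin n) (i0 : Fin lam) {k : ℕ} (hk : k ≤ m + 1)
    (data : (Fin kh → Bool) → Fin lam → Word m) (dec : (Fin k → Bool) → Fin n) :
    Circuit (Wire n kh kl lam m) :=
  (selectCircuit data ++ swapCircuit) ++
    iterate scratch (fun i => .inl (.cell i0 (Fin.castLE hk i))) (fun g c =>
      if dec g = p0 then [] else cswap c (.inr p0) (.inr (dec g))) ++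
    Circuit.inv (selectCircuit data ++ swapCircuit)

theorem sends_swapUp (hkh : kh ≤ m + 1) (hkl : kl ≤ m + 1) (p0 : Fin n) (i0 : Fin lam) {k : ℕ}
    (hk : k ≤ m + 1) (data : (Fin kh → Bool) → Fin lam → Word m) (dec : (Fin k → Bool) → Fin n)
    (x : Wire n kh kl lam m → Bool) (hx : ScratchClean x) (hc : CellsClean x) :
    Sends (swapUp p0 i0 hk data dec) x (setOccupation x fun p => occupation x
      (Equiv.swap p0 (dec fun i => lookedUp data i0 (address x) (Fin.castLE hk i)) p)) := by
  have key : ∀ y : Wire n kh kl lam m → Bool, ScratchClean y →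
      Sends (iterate scratch (fun i => .inl (.cell i0 (Fin.castLE hk i))) (fun g c =>
        if dec g = p0 then [] else cswap c (.inr p0) (.inr (dec g)))) y
        (setOccupation y fun p => occupation y
          (Equiv.swap p0 (dec fun i => y (.inl (.cell i0 (Fin.castLE hk i)))) p)) := by
    intro y hy
    refine sends_iterate (N := m + 1) scratch_inj hk
      (fun g y => setOccupation y fun p => occupation y (Equiv.swap p0 (dec g) p)) ?_ ?_ ?_ ?_ y hy
    · intro g i y _
      split_ifs with h hs hs
      · convert Sends.nil y using 1
        funext q
        rcases q with q | p <;> simp [setOccupation, occupation, h]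
      · exact Sends.nil y
      · convert sends_cswap (a := .inr p0) (b := .inr (dec g)) ?_ ?_ ?_ y using 1
        · rw [if_pos hs]
          funext q
          rcases q with q | p
          · rw [Function.comp_apply, Equiv.swap_apply_of_ne_of_ne (by simp) (by simp)]
            simp [setOccupation]
          · simp only [setOccupation, occupation, Function.comp_apply, Sum.elim_inr]
            simp only [Equiv.swap_apply_def, Sum.inr.injEq]
            split_ifs <;> rfl
        · simpa using Ne.symm h
        · simp [scratch]
        · simp [scratch]
      · convert sends_cswap (a := .inr p0) (b := .inr (dec g)) ?_ ?_ ?_ y using 1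
        · rw [if_neg hs]
        · simpa using Ne.symm h
        · simp [scratch]
        · simp [scratch]
    · intro g y i; rfl
    · intro g y i b _
      funext q
      rcases q with q | p
      · simp [setOccupation, Function.update_apply, scratch]
      · simp [setOccupation, occupation, Function.update_apply, scratch]
    · intro j i _; simp [scratch]
  have e1 := sends_selectSwap hkh hkl data x hx hc
  set y := setCells x fun i b => data (address x).1 (wordSwap lam (address x).2 i) b with hy
  have hyc : ScratchClean y := hx
  have e2 := key y hyc
  have hdec : (fun i => y (.inl (.cell i0 (Fin.castLE hk i)))) =
      fun i => lookedUp data i0 (address x) (Fin.castLE hk i) := rfl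
  have hocc : occupation y = occupation x := rfl
  rw [hdec, hocc] at e2
  set j := fun p => occupation x
      (Equiv.swap p0 (dec fun i => lookedUp data i0 (address x) (Fin.castLE hk i)) p)
  have hx' : ScratchClean (setOccupation x j) := hx
  have hc' : CellsClean (setOccupation x j) := hc
  refine Sends.conj' e1 e2 ((sends_selectSwap hkh hkl data _ hx' hc').congr (funext fun q => ?_))
  rcases q with (_ | _ | ⟨i', b⟩ | b | _ | _ | _ | _) | p <;> rfl

theorem isSwapUp_swapUp (hkh : kh ≤ m + 1) (hkl : kl ≤ m + 1) (p0 : Fin n) (hp0 : p0.val = 0)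
    (i0 : Fin lam) {k : ℕ} (hk : k ≤ m + 1) (data : (Fin kh → Bool) → Fin lam → Word m)
    (dec : (Fin k → Bool) → Fin n) (S : Finset (Term n)) (addr : Term n → Address kh kl)
    (f : Term n → Fin n)
    (hf : ∀ t ∈ S, dec (fun i => lookedUp data i0 (addr t) (Fin.castLE hk i)) = f t) :
    IsSwapUp S addr f (swapUp p0 i0 hk data dec : Circuit (Wire n kh kl lam m)) := by
  refine ⟨fun a => Equiv.swap p0 (dec fun i => lookedUp data i0 a (Fin.castLE hk i)), ?_, ?_⟩
  · intro t ht i hi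
    simp only [hf t ht]
    rw [show i = p0 from Fin.ext (hi.trans hp0.symm), Equiv.swap_apply_left]
  · intro x hx hc
    exact sends_swapUp hkh hkl p0 i0 hk data dec x hx.scratchClean hc

theorem tCount_swapUp_le (p0 : Fin n) (i0 : Fin lam) {k : ℕ}
    (hk : k ≤ m + 1) (data : (Fin kh → Bool) → Fin lam → Word m) (dec : (Fin k → Bool) → Fin n) :
    Circuit.tCount (swapUp p0 i0 hk data dec : Circuit (Wire n kh kl lam m)) ≤
      28 * 2 ^ kh + 42 * (2 ^ kl * (m + 1)) + 21 * 2 ^ k := by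
  have h1 := tCount_selectCircuit_le (n := n) (kl := kl) data
  have h2 := tCount_swapCircuit_le (n := n) (kh := kh) (kl := kl) (lam := lam) (m := m)
  have h3 := tCount_iterate_le (wk := (scratch : ℕ → Wire n kh kl lam m)) (τ := 7)
    (e := fun i => .inl (.cell i0 (Fin.castLE hk i))) (leaf := fun g c =>
      if dec g = p0 then [] else cswap c (.inr p0) (.inr (dec g))) (fun g q => by
      split_ifs
      · simp [Circuit.tCount]
      · rw [tCount_cswap])
  simp only [swapUp, Circuit.tCount_append, Circuit.tCount_inv]
  omega

end

section

/-! ### Hadamard layers -/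

section Layer

variable {Q : Type} [DecidableEq Q] [Fintype Q]

theorem hadamardLayer_apply (qs : List Q) (hnd : qs.Nodup) (y x : Q → Bool) :
    Circuit.matrix (qs.map Gate.hadamard) y x =
      if ∀ q, q ∉ qs → y q = x q then (qs.map fun q => hadamardMatrix (y q) (x q)).prod else 0 := by
  induction qs generalizing x with
  | nil =>
    simp only [List.map_nil, Circuit.matrix, Matrix.one_apply, List.not_mem_nil, not_false_eq_true,
      true_implies, List.prod_nil, funext_iff]
  | cons a qs ih =>
    rw [List.nodup_cons] at hnd
    have hmap : ∀ b, (qs.map fun q => hadamardMatrix (y q) (Function.update x a b q)) =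
        qs.map fun q => hadamardMatrix (y q) (x q) := fun b =>
      List.map_congr_left fun q hq => by
        rw [Function.update_of_ne fun h : q = a => hnd.1 (by rwa [← h])]
    have hcond : ∀ b, (∀ q, q ∉ qs → y q = Function.update x a b q) ↔
        (y a = b ∧ ∀ q, q ∉ a :: qs → y q = x q) := by
      intro b
      constructor
      · intro h
        refine ⟨by simpa using h a hnd.1, fun q hq => ?_⟩
        simp only [List.mem_cons, not_or] at hq
        simpa [hq.1] using h q hq.2
      · rintro ⟨h1, h2⟩ q hq
        by_cases hqa : q = a
        · subst hqa; simpa using h1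
        · simpa [hqa] using h2 q (by simp [hqa, hq])
    rw [List.map_cons, Circuit.matrix, ← mulVec_ket (_ * _), ← Matrix.mulVec_mulVec, Gate.matrix,
      onQubit_mulVec_ket, Matrix.mulVec_add, Matrix.mulVec_smul, Matrix.mulVec_smul]
    simp only [Pi.add_apply, Pi.smul_apply, mulVec_ket, ih hnd.2, hmap, hcond, smul_eq_mul,
      List.map_cons, List.prod_cons]
    by_cases hq : ∀ q, q ∉ a :: qs → y q = x q
    · rw [if_pos hq]
      cases y a <;> simp [and_iff_left hq, -List.mem_cons]
    · rw [if_neg hq, if_neg fun h => hq h.2, if_neg fun h => hq h.2]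
      simp

/-- The amplitude `2 ^ (-k / 2)` of a uniform superposition of the values of `k` qubits. -/
def layerCoeff (k : ℕ) : ℂ := (1 / (Real.sqrt 2 : ℂ)) ^ k

theorem layerCoeff_mul_self (k : ℕ) : layerCoeff k * layerCoeff k = 1 / 2 ^ k := by
  have h : ((Real.sqrt 2 : ℝ) : ℂ) * (Real.sqrt 2 : ℝ) = 2 := by
    rw [← Complex.ofReal_mul, Real.mul_self_sqrt (by norm_num)]; norm_num
  rw [layerCoeff, ← mul_pow, div_mul_div_comm, h]
  simp

theorem hadamardLayer_apply_of_left (qs : List Q) (hnd : qs.Nodup) (y x : Q → Bool)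
    (hy : ∀ q ∈ qs, y q = false) :
    Circuit.matrix (qs.map Gate.hadamard) y x =
      if ∀ q, q ∉ qs → y q = x q then layerCoeff qs.length else 0 := by
  rw [hadamardLayer_apply qs hnd]
  congr 1
  rw [layerCoeff, ← List.prod_replicate, ← List.map_const']
  congr 1
  exact List.map_congr_left fun q hq => by simp [hadamardMatrix, hy q hq]

theorem hadamardLayer_apply_of_right (qs : List Q) (hnd : qs.Nodup) (y x : Q → Bool)
    (hx : ∀ q ∈ qs, x q = false) :
    Circuit.matrix (qs.map Gate.hadamard) y x =
      if ∀ q, q ∉ qs → y q = x q then layerCoeff qs.length else 0 := by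
  rw [hadamardLayer_apply qs hnd]
  congr 1
  rw [layerCoeff, ← List.prod_replicate, ← List.map_const']
  congr 1
  exact List.map_congr_left fun q hq => by simp [hadamardMatrix, hx q hq]

variable {ι : Type} [Fintype ι] [DecidableEq ι]

/-- Setting the qubits in `qs` to all possible values runs over the basis states that agree with `x`
on the other qubits. -/
theorem sum_extend {M : Type*} [AddCommMonoid M] {e : ι → Q} (he : Function.Injective e)
    {qs : List Q} (hqs : ∀ q, q ∈ qs ↔ ∃ i, e i = q) (x : Q → Bool) (F : (Q → Bool) → M) :
    ∑ s : ι → Bool, F (Function.extend e s x) =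
      ∑ z, if ∀ q, q ∉ qs → x q = z q then F z else 0 := by
  rw [← Finset.sum_filter]
  refine Finset.sum_bij' (fun s _ => Function.extend e s x) (fun z _ i => z (e i)) ?_ ?_ ?_ ?_ ?_
  · intro s _
    rw [Finset.mem_filter]
    refine ⟨Finset.mem_univ _, fun q hq => ?_⟩
    rw [Function.extend_apply']
    rwa [hqs] at hq
  · intro z _; simp
  · intro s _
    funext i
    exact he.extend_apply _ _ _
  · intro z hz
    funext q
    by_cases hq : ∃ i, e i = q
    · obtain ⟨i, rfl⟩ := hq
      exact he.extend_apply _ _ _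
    · rw [Function.extend_apply' _ _ _ hq]
      exact (Finset.mem_filter.1 hz).2 q (by rwa [hqs])
  · intro s _; rfl

/-- A layer of Hadamard gates prepares a uniform superposition. -/
theorem hadamardLayer_mulVec_ket {e : ι → Q} (he : Function.Injective e)
    {qs : List Q} (hqs : ∀ q, q ∈ qs ↔ ∃ i, e i = q) (hnd : qs.Nodup) (x : Q → Bool)
    (hx : ∀ q ∈ qs, x q = false) :
    Circuit.matrix (qs.map Gate.hadamard) *ᵥ ket x =
      layerCoeff qs.length • ∑ s : ι → Bool, ket (Function.extend e s x) := by
  ext y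
  rw [mulVec_ket, hadamardLayer_apply_of_right qs hnd y x hx, sum_extend he hqs]
  simp only [Pi.smul_apply, Finset.sum_apply, smul_eq_mul]
  rw [Finset.sum_eq_single y]
  · have : (∀ q, q ∉ qs → x q = y q) ↔ ∀ q, q ∉ qs → y q = x q :=
      forall₂_congr fun _ _ => eq_comm
    simp only [this]
    split_ifs <;> simp [ket_apply]
  · intro z _ hz
    split_ifs
    · simp [ket_apply, hz.symm]
    · simp
  · simp

/-- A layer of Hadamard gates followed by a projection to `0` sums the amplitudes. -/
theorem hadamardLayer_mulVec_apply {e : ι → Q} (he : Function.Injective e)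
    {qs : List Q} (hqs : ∀ q, q ∈ qs ↔ ∃ i, e i = q) (hnd : qs.Nodup) (y : Q → Bool)
    (hy : ∀ q ∈ qs, y q = false) (v : (Q → Bool) → ℂ) :
    (Circuit.matrix (qs.map Gate.hadamard) *ᵥ v) y =
      layerCoeff qs.length * ∑ s : ι → Bool, v (Function.extend e s y) := by
  rw [Matrix.mulVec, dotProduct, sum_extend he hqs, Finset.mul_sum]
  refine Finset.sum_congr rfl fun z _ => ?_
  rw [hadamardLayer_apply_of_left qs hnd y z hy]
  split_ifs <;> simp

end Layer

/-! ### Direct sampling -/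

/-- The bit of `v` at the position of the leading `1` of `s`, and `false` if `s = 0`. -/
def leadingBit : (m : ℕ) → (Fin m → Bool) → (Fin m → Bool) → Bool
  | 0, _, _ => false
  | m + 1, s, v =>
    if s (Fin.last m) then v (Fin.last m)
    else leadingBit m (fun i => s i.castSucc) fun i => v i.castSucc

theorem ofBits_castSucc : ∀ {m : ℕ} (v : Fin (m + 1) → Bool),
    Nat.ofBits v = 2 ^ m * (v (Fin.last m)).toNat + Nat.ofBits fun i => v i.castSucc
  | 0, v => by simp [Nat.ofBits_succ]
  | m + 1, v => by
    rw [Nat.ofBits_succ, ofBits_castSucc, Nat.ofBits_succ fun i => v (Fin.castSucc i)]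
    simp only [Function.comp_def, Fin.succ_last, Fin.succ_castSucc, Fin.castSucc_zero, pow_succ]
    ring

/-- A number `s < 2 ^ m` has its leading `1` at position `i` in `2 ^ i` cases; so the leading bit
selects `v` out of `2 ^ m` numbers. -/
theorem sum_leadingBit : ∀ {m : ℕ} (v : Fin m → Bool),
    ∑ s : Fin m → Bool, (leadingBit m s v).toNat = Nat.ofBits v
  | 0, v => by simp [leadingBit]
  | m + 1, v => by
    rw [← (Fin.snocEquiv fun _ : Fin (m + 1) => Bool).sum_comp, Fintype.sum_prod_type,
      Fintype.sum_bool, ofBits_castSucc]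
    simp [leadingBit, Fin.snocEquiv, sum_leadingBit]

variable {n kh kl lam m : ℕ}

/-- The `i`-th magnitude bit of the word. -/
def magnitude (i : Fin m) : Wire n kh kl lam m := .inl (.word i.succ)

/-- The `i`-th qubit of the sampling register. -/
def sampleWire (i : Fin m) : Wire n kh kl lam m := .inl (.sample i)

/-- Computes the leading bit for the first `i + 1` positions from the one for the first `i`
positions. -/
def rippleStep (i : Fin m) : Circuit (Wire n kh kl lam m) :=
  cx (scratch i) (scratch (i + 1)) ++ cx (scratch i) (magnitude i) ++
    ccx (sampleWire i) (magnitude i) (scratch (i + 1)) ++ cx (scratch i) (magnitude i)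

theorem sends_rippleStep (i : Fin m) (x : Wire n kh kl lam m → Bool)
    (hx : x (scratch (i + 1)) = false) :
    Sends (rippleStep i) x (Function.update x (scratch (i + 1))
      (if x (sampleWire i) then x (magnitude i) else x (scratch i))) := by
  have hne : (scratch i : Wire n kh kl lam m) ≠ scratch (i + 1) := fun h => by
    have := scratch_inj (i : ℕ) (i + 1) (by omega) (by omega) h
    omega
  have h1 : (scratch i : Wire n kh kl lam m) ≠ magnitude i := by simp [scratch, magnitude]
  have h2 : (scratch (i + 1) : Wire n kh kl lam m) ≠ magnitude i := by simp [scratch, magnitude]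
  have h3 : (sampleWire i : Wire n kh kl lam m) ≠ magnitude i := by simp [sampleWire, magnitude]
  have h4 : (sampleWire i : Wire n kh kl lam m) ≠ scratch (i + 1) := by simp [sampleWire, scratch]
  refine ((((sends_cx hne x).append (sends_cx h1 _)).append
    (sends_ccx h3 h4 h2.symm _)).append (sends_cx h1 _)).congr (funext fun q => ?_)
  by_cases hq1 : q = scratch (i + 1)
  · subst hq1
    simp only [Function.update_self, Function.update_of_ne h2, Function.update_of_ne h2.symm,
      Function.update_of_ne h4, Function.update_of_ne hne, Function.update_of_ne h3, hx]
    cases x (sampleWire i) <;> cases x (magnitude i) <;> cases x (scratch i) <;> rfl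
  · by_cases hq2 : q = magnitude i
    · subst hq2
      simp [Function.update_of_ne h2.symm, Function.update_of_ne h1, Function.update_of_ne hne]
    · simp [hq1, hq2]

/-- Computes the leading bits for all positions below `k`. -/
def ripple : ℕ → Circuit (Wire n kh kl lam m)
  | 0 => []
  | k + 1 => ripple k ++ if h : k < m then rippleStep ⟨k, h⟩ else []

/-- The ripple leaves the leading bit in the scratch qubit `k`. Its intermediate results stay in the
other scratch qubits of `y`; as it ignores the amplitude qubit, it can be undone after that qubit has
been changed. -/
theorem exists_sends_ripple (x : Wire n kh kl lam m → Bool) (hx : ScratchClean x) :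
    ∀ (k : ℕ) (hk : k ≤ m), ∃ y : Wire n kh kl lam m → Bool,
      (∀ b, Sends (ripple k) (Function.update x (.inl .amp) b)
        (Function.update y (.inl .amp) b)) ∧
      (∀ i, y (sampleWire i) = x (sampleWire i)) ∧ (∀ i, y (magnitude i) = x (magnitude i)) ∧
      y (scratch k) = leadingBit k (fun i => x (sampleWire (Fin.castLE hk i)))
        (fun i => x (magnitude (Fin.castLE hk i))) ∧
      ∀ i, k < i → i ≤ m + 1 → y (scratch i) = false := by
  intro k
  induction k with
  | zero =>
    intro hk
    exact ⟨x, fun b => Sends.nil _, fun _ => rfl, fun _ => rfl, hx 0 (by omega),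
      fun i _ hi => hx i hi⟩
  | succ k ih =>
    intro hk
    obtain ⟨y, h1, h2, h3, h4, h5⟩ := ih (by omega)
    have ha : ∀ i, (scratch i : Wire n kh kl lam m) ≠ .inl .amp := fun i => by simp [scratch]
    refine ⟨Function.update y (scratch (k + 1)) (if x (sampleWire ⟨k, hk⟩) then
      x (magnitude ⟨k, hk⟩) else y (scratch k)), fun b => ?_, fun i => ?_, fun i => ?_, ?_,
      fun i hi hi' => ?_⟩
    · have e := sends_rippleStep ⟨k, hk⟩ (Function.update y (.inl .amp) b) (by
        rw [Function.update_of_ne (ha _)]; exact h5 (k + 1) (by omega) (by omega))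
      have hs : (sampleWire ⟨k, hk⟩ : Wire n kh kl lam m) ≠ .inl .amp := by simp [sampleWire]
      have hm : (magnitude ⟨k, hk⟩ : Wire n kh kl lam m) ≠ .inl .amp := by simp [magnitude]
      rw [Function.update_of_ne hs, Function.update_of_ne hm, Function.update_of_ne (ha _), h2, h3,
        Function.update_comm (ha _).symm] at e
      rw [ripple, dif_pos (show k < m from hk)]
      exact (h1 b).append e
    · rw [Function.update_of_ne (by simp [sampleWire, scratch]), h2]
    · rw [Function.update_of_ne (by simp [magnitude, scratch]), h3]
    · rw [Function.update_self, h4]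
      rfl
    · rw [Function.update_of_ne, h5 i (by omega) hi']
      intro h
      have := scratch_inj i (k + 1) hi' (by omega) h
      omega

theorem tCount_ripple_le (k : ℕ) :
    Circuit.tCount (ripple k : Circuit (Wire n kh kl lam m)) ≤ 7 * k := by
  induction k with
  | zero => simp [ripple, Circuit.tCount]
  | succ k ih =>
    rw [ripple, Circuit.tCount_append]
    split_ifs
    · simp only [rippleStep, Circuit.tCount_append, tCount_cx, tCount_ccx]; omega
    · simp [Circuit.tCount] at ih ⊢; omega

/-- Flips the amplitude qubit if the leading bit is `0`. -/
def compareCircuit : Circuit (Wire n kh kl lam m) :=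
  ripple m ++ (cx (scratch m) (.inl .amp) ++ Circuit.pauliX (.inl .amp)) ++ Circuit.inv (ripple m)

theorem sends_compareCircuit (x : Wire n kh kl lam m → Bool) (hx : ScratchClean x) :
    Sends compareCircuit x (Function.update x (.inl .amp) (xor (x (.inl .amp))
      !leadingBit m (fun i => x (sampleWire i)) fun i => x (magnitude i))) := by
  obtain ⟨y, h1, -, -, h4, -⟩ := exists_sends_ripple x hx m le_rfl
  have ha : (scratch m : Wire n kh kl lam m) ≠ .inl .amp := by simp [scratch]
  have e1 := h1 (x (.inl .amp))
  rw [Function.update_eq_self] at e1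
  refine e1.conj' (((sends_cx ha _).append (sends_pauliX _ _)).congr ?_) (h1 _)
  simp only [Function.update_self, Function.update_idem, Function.update_of_ne ha, h4]
  simp

/-- The direct-sampling oracle. -/
def samplingCircuit : Circuit (Wire n kh kl lam m) :=
  [.phase (.inl (.word 0)), .phase (.inl (.word 0))] ++
    ((List.finRange m).map sampleWire).map Gate.hadamard ++ compareCircuit ++
    ((List.finRange m).map sampleWire).map Gate.hadamard

theorem sampleWire_injective :
    Function.Injective (sampleWire : Fin m → Wire n kh kl lam m) :=
  fun i j h => by simpa [sampleWire] using h

theorem samplingCircuit_apply (x y : Wire n kh kl lam m → Bool) (hx : ScratchClean x)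
    (hs : ∀ b, x (.inl (.sample b)) = false) (ha : x (.inl .amp) = false) :
    Circuit.matrix samplingCircuit y x = (wordOf x).sign * (layerCoeff m *
      ∑ s : Fin m → Bool, Circuit.matrix (((List.finRange m).map sampleWire).map Gate.hadamard) y
        (Function.update (Function.extend sampleWire s x) (.inl .amp)
          !leadingBit m s fun i => x (magnitude i))) := by
  have hZ : Circuit.matrix [Gate.phase (.inl (.word 0)), Gate.phase (.inl (.word 0))] *ᵥ ket x =
      ((wordOf x).sign : ℂ) • ket x := by
    have h : Circuit.matrix [Gate.phase (.inl (.word 0)), Gate.phase (.inl (.word 0))] =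
        onQubit (.inl (.word 0) : Wire n kh kl lam m) (phaseMatrix (-1)) := by
      simp [Circuit.matrix, Gate.matrix, onQubit_mul, phaseMatrix_mul]
    rw [h, phaseMatrix_mulVec_ket]
    congr 1
    by_cases h0 : x (.inl (.word 0)) = true <;> simp [Word.sign, wordOf, h0]
  have hqs : ∀ q : Wire n kh kl lam m, q ∈ (List.finRange m).map sampleWire ↔
      ∃ i, sampleWire i = q := by simp
  have hnd : ((List.finRange m).map (sampleWire : Fin m → Wire n kh kl lam m)).Nodup :=
    (List.nodup_finRange m).map sampleWire_injective
  -- For the register value `s`, the amplitude qubit becomes the negated leading bit.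
  have hcmp : ∀ s : Fin m → Bool, Circuit.matrix compareCircuit *ᵥ
      ket (Function.extend sampleWire s x) =
      ket (Function.update (Function.extend sampleWire s x) (.inl .amp)
          !leadingBit m s fun i => x (magnitude i)) := by
    intro s
    have hout : ∀ q : Wire n kh kl lam m, (∀ i, sampleWire i ≠ q) →
        Function.extend sampleWire s x q = x q := fun q hq =>
      Function.extend_apply' _ _ _ (by simpa using hq)
    refine (sends_compareCircuit _ fun i hi => ?_).congr ?_
    · rw [hout _ (by simp [sampleWire, scratch]), hx i hi]
    · congr 1
      rw [hout _ (by simp [sampleWire]), ha, Bool.false_xor]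
      congr 2
      · funext i; exact sampleWire_injective.extend_apply _ _ _
      · funext i; exact hout _ (by simp [sampleWire, magnitude])
  rw [← mulVec_ket (Circuit.matrix samplingCircuit), samplingCircuit, Circuit.append_mulVec,
    Circuit.append_mulVec, Circuit.append_mulVec, hZ, Matrix.mulVec_smul,
    hadamardLayer_mulVec_ket sampleWire_injective hqs hnd x (by simpa [sampleWire] using hs)]
  simp only [Matrix.mulVec_smul, Matrix.mulVec_sum, hcmp, Pi.smul_apply, Finset.sum_apply,
    mulVec_ket, smul_eq_mul, List.length_map, List.length_finRange]

theorem samplingCircuit_apply_eq_zero (x y : Wire n kh kl lam m → Bool) (hx : ScratchClean x)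
    (hs : ∀ b, x (.inl (.sample b)) = false) (ha : x (.inl .amp) = false)
    (h : ∃ q, y q ≠ x q ∧ q ≠ .inl .amp ∧ ∀ b, q ≠ .inl (.sample b)) :
    Circuit.matrix samplingCircuit y x = 0 := by
  obtain ⟨q, hq, hqa, hqs⟩ := h
  rw [samplingCircuit_apply x y hx hs ha, Finset.sum_eq_zero, mul_zero, mul_zero]
  intro s _
  rw [hadamardLayer_apply _ ((List.nodup_finRange m).map sampleWire_injective), if_neg]
  intro h
  have hqs' : ¬∃ i, (sampleWire i : Wire n kh kl lam m) = q := by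
    rintro ⟨i, rfl⟩; exact hqs i rfl
  have := h q (by simpa using hqs')
  rw [Function.update_of_ne hqa, Function.extend_apply' _ _ _ hqs'] at this
  exact hq this

theorem samplingCircuit_apply_of_eq (x y : Wire n kh kl lam m → Bool) (hx : ScratchClean x)
    (hs : ∀ b, x (.inl (.sample b)) = false) (ha : x (.inl .amp) = false)
    (h : ∀ q, q ≠ .inl .amp → y q = x q) :
    Circuit.matrix samplingCircuit y x =
      if y (.inl .amp) then (((wordOf x).sign - (wordOf x).value : ℝ) : ℂ)
      else ((wordOf x).value : ℂ) := by
  rw [samplingCircuit_apply x y hx hs ha]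
  have hterm : ∀ s : Fin m → Bool,
      Circuit.matrix (((List.finRange m).map sampleWire).map Gate.hadamard) y
        (Function.update (Function.extend sampleWire s x) (.inl .amp)
          !leadingBit m s fun i => x (magnitude i)) =
      layerCoeff m * (if y (.inl .amp) then 1 - ((leadingBit m s fun i => x (magnitude i)).toNat : ℂ)
        else ((leadingBit m s fun i => x (magnitude i)).toNat : ℂ)) := by
    intro s
    rw [hadamardLayer_apply_of_left _ ((List.nodup_finRange m).map sampleWire_injective) _ _ (by
      intro q hq
      obtain ⟨i, _, rfl⟩ := List.mem_map.1 hq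
      rw [h _ (by simp [sampleWire])]
      exact hs i)]
    have hiff : (∀ q, q ∉ (List.finRange m).map sampleWire → y q =
        Function.update (Function.extend sampleWire s x) (.inl .amp)
          (!leadingBit m s fun i => x (magnitude i)) q) ↔
        y (.inl .amp) = !leadingBit m s fun i => x (magnitude i) := by
      constructor
      · intro h'
        have := h' (.inl .amp) (by simp [sampleWire])
        rwa [Function.update_self] at this
      · intro h' q hq
        by_cases hqa : q = .inl .amp
        · subst hqa; rw [h', Function.update_self]
        · rw [Function.update_of_ne hqa, Function.extend_apply' _ _ _ (by simpa using hq), h q hqa]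
    simp only [hiff, List.length_map, List.length_finRange]
    cases y (.inl .amp) <;> cases (leadingBit m s fun i => x (magnitude i)) <;> simp
  rw [Finset.sum_congr rfl fun s _ => hterm s, ← Finset.mul_sum]
  -- The two Hadamard layers contribute `layerCoeff m ^ 2 = 2 ^ (-m)`.
  have hsum : (∑ s : Fin m → Bool, ((leadingBit m s fun i => x (magnitude i)).toNat : ℂ)) =
      (Nat.ofBits (fun i => wordOf x i.succ) : ℂ) := by
    rw [← sum_leadingBit]
    push_cast
    rfl
  have hval : (((wordOf x).value : ℝ) : ℂ) =
      (wordOf x).sign * (Nat.ofBits (fun i => wordOf x i.succ) : ℂ) / 2 ^ m := by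
    rw [Word.value]; push_cast; rfl
  cases y (.inl .amp)
  · simp only [Bool.false_eq_true, if_false]
    rw [hsum, hval, ← mul_assoc (layerCoeff m), layerCoeff_mul_self]
    ring
  · simp only [if_true]
    rw [Finset.sum_sub_distrib, hsum, Complex.ofReal_sub, hval, ← mul_assoc (layerCoeff m),
      layerCoeff_mul_self]
    simp
    field_simp

theorem isSampling_samplingCircuit :
    IsSampling (samplingCircuit : Circuit (Wire n kh kl lam m)) := fun x hx hs ha y =>
  ⟨samplingCircuit_apply_eq_zero x y hx.scratchClean hs ha,
    samplingCircuit_apply_of_eq x y hx.scratchClean hs ha⟩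

theorem tCount_hadamardLayer {Q : Type} (qs : List Q) :
    Circuit.tCount (qs.map Gate.hadamard) = 0 := by
  simp [Circuit.tCount, Function.comp_def, Gate.tCount]

theorem tCount_samplingCircuit_le :
    Circuit.tCount (samplingCircuit : Circuit (Wire n kh kl lam m)) ≤ 14 * m := by
  have h1 := tCount_ripple_le (n := n) (kh := kh) (kl := kl) (lam := lam) (m := m) m
  have h2 : Circuit.tCount [Gate.phase (.inl (.word 0) : Wire n kh kl lam m),
    Gate.phase (.inl (.word 0))] = 0 := rfl
  have h3 : Circuit.tCount (Circuit.pauliX (.inl .amp : Wire n kh kl lam m)) = 0 := rfl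
  simp only [samplingCircuit, compareCircuit, Circuit.tCount_append, Circuit.tCount_inv,
    tCount_cx, tCount_hadamardLayer, h2, h3]
  omega

end

section

/-! ### Ladder operators -/

section Ladder

variable {n : ℕ}

/-- The Jordan–Wigner sign `(-1)^(j_0 + ... + j_{p-1})`. -/
def jwSign (p : Fin n) (j : Fin n → Bool) : ℂ :=
  (-1) ^ (Finset.univ.filter fun q : Fin n => q < p ∧ j q = true).card

theorem jwSign_mul_self (p : Fin n) (j : Fin n → Bool) : jwSign p j * jwSign p j = 1 := by
  rw [jwSign, ← mul_pow]; simp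

/-- The occupation numbers `j` with the one of mode `p` flipped. -/
def flipMode (p : Fin n) (j : Fin n → Bool) : Fin n → Bool := Function.update j p (!j p)

theorem jwSign_update (p : Fin n) (j : Fin n → Bool) (b : Bool) :
    jwSign p (Function.update j p b) = jwSign p j := by
  rw [jwSign, jwSign]
  congr 2
  refine Finset.filter_congr fun q _ => and_congr_right fun hq => ?_
  rw [Function.update_of_ne hq.ne]

/-- The annihilation operator for `d = true` and the creation operator for `d = false`: it acts on
a basis state if and only if the occupation number of the mode is `d`. -/
def ladderOp (d : Bool) (p : Fin n) : Matrix (Fin n → Bool) (Fin n → Bool) ℂ :=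
  if d then annihilate p else create p

theorem ladderOp_mulVec_ket (d : Bool) (p : Fin n) (j : Fin n → Bool) :
    ladderOp d p *ᵥ ket j = if j p = d then jwSign p j • ket (flipMode p j) else 0 := by
  ext i
  rw [mulVec_ket]
  cases d
  · simp only [ladderOp, Bool.false_eq_true, if_false, create, annihilate,
      Matrix.conjTranspose_apply, Matrix.of_apply]
    by_cases hj : j p = false
    · rw [if_pos hj, Pi.smul_apply, ket_apply]
      by_cases hi : i = flipMode p j
      · subst hi
        have : j = Function.update (flipMode p j) p false := by
          rw [flipMode, Function.update_idem, ← hj, Function.update_eq_self]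
        rw [if_pos ⟨by simp [flipMode, hj], this⟩, if_pos rfl]
        rw [smul_eq_mul, mul_one, ← jwSign_update p j (!j p), star_pow, star_neg, star_one]
        rfl
      · rw [if_neg hi, if_neg]
        · simp
        · rintro ⟨h1, h2⟩
          refine hi ?_
          rw [h2, flipMode, Function.update_idem, Function.update_self, Bool.not_false, ← h1,
            Function.update_eq_self]
    · rw [if_neg hj, if_neg]
      · simp
      · rintro ⟨-, h2⟩
        rw [h2] at hj
        simp at hj
  · simp only [ladderOp, if_true, annihilate, Matrix.of_apply]
    by_cases hj : j p = true
    · rw [if_pos hj, Pi.smul_apply, ket_apply, flipMode, hj, Bool.not_true]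
      by_cases hi : i = Function.update j p false <;> simp [hi, jwSign]
    · simp [hj]

/-- The operator `a†_p a_p` is a diagonal projection. -/
theorem norm_annihilate_le (p : Fin n) : ‖annihilate p‖ ≤ 1 := by
  have h : (annihilate p)ᴴ * annihilate p =
      Matrix.diagonal fun j : Fin n → Bool => if j p = true then (1 : ℂ) else 0 := by
    refine matrix_ext_ket fun j => ?_
    have h1 := ladderOp_mulVec_ket true p j
    have h2 := ladderOp_mulVec_ket false p (flipMode p j)
    simp only [ladderOp, if_true, Bool.false_eq_true, if_false, create] at h1 h2
    rw [← Matrix.mulVec_mulVec, h1]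
    have hd : (Matrix.diagonal fun j : Fin n → Bool => if j p = true then (1 : ℂ) else 0) *ᵥ ket j =
        (if j p = true then (1 : ℂ) else 0) • ket j := by
      ext i
      rw [mulVec_ket, Pi.smul_apply, ket_apply, Matrix.diagonal_apply]
      by_cases hij : i = j <;> simp [hij]
    rw [hd]
    by_cases hj : j p = true
    · rw [if_pos hj, if_pos hj, Matrix.mulVec_smul, h2, if_pos (by simp [flipMode, hj]), smul_smul,
        one_smul]
      have hs : jwSign p (flipMode p j) = jwSign p j := jwSign_update _ _ _
      have hf : flipMode p (flipMode p j) = j := by simp [flipMode]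
      rw [hs, hf, jwSign_mul_self, one_smul]
    · rw [if_neg hj, if_neg hj, Matrix.mulVec_zero, zero_smul]
  have h2 := Matrix.l2_opNorm_conjTranspose_mul_self (annihilate p)
  rw [h, Matrix.l2_opNorm_diagonal] at h2
  have h3 : ‖fun j : Fin n → Bool => if j p = true then (1 : ℂ) else 0‖ ≤ 1 := by
    refine (pi_norm_le_iff_of_nonneg zero_le_one).2 fun j => ?_
    split_ifs <;> simp
  nlinarith [norm_nonneg (annihilate p)]

theorem norm_create_le (p : Fin n) : ‖create p‖ ≤ 1 := by
  rw [create, Matrix.l2_opNorm_conjTranspose]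
  exact norm_annihilate_le p

theorem norm_mul_le_one {M N : Matrix (Fin n → Bool) (Fin n → Bool) ℂ} (hM : ‖M‖ ≤ 1)
    (hN : ‖N‖ ≤ 1) : ‖M * N‖ ≤ 1 :=
  (Matrix.l2_opNorm_mul M N).trans (mul_le_one₀ hM (norm_nonneg _) hN)

theorem Term.norm_monomial_le (t : Term n) : ‖t.monomial‖ ≤ 1 := by
  cases t with
  | one p q => exact norm_mul_le_one (norm_create_le _) (norm_annihilate_le _)
  | two p q r s _ _ =>
    exact norm_mul_le_one (norm_mul_le_one (norm_mul_le_one (norm_create_le _) (norm_create_le _))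
      (norm_annihilate_le _)) (norm_annihilate_le _)

/-- Whether a monomial is a two-body monomial. -/
def Term.isTwo : Term n → Bool
  | .one _ _ => false
  | .two _ _ _ _ _ _ => true

/-- The modes on which the four ladder operators act whose product is the given monomial, the
rightmost operator first. A one-body monomial is written as `a†_p a_q = a†_p a_p a†_p a_q`. -/
def Term.mode : Term n → Fin 4 → Fin n
  | .one p q => ![q, p, p, p]
  | .two p q r s _ _ => ![s, r, q, p]

theorem Term.mode_mem (t : Term n) (i : Fin 4) : t.mode i ∈ t.modes := by
  cases t <;> fin_cases i <;> simp [Term.mode, Term.modes]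

/-- The kinds of the four ladder operators: annihilation (`true`) or creation (`false`). -/
def wanted (two : Bool) : Fin 4 → Bool := ![true, two, !two, false]

/-- The occupation numbers after the first `k` of four ladder operators. -/
def path (μ : Fin 4 → Fin n) (j : Fin n → Bool) : ℕ → Fin n → Bool
  | 0 => j
  | k + 1 => flipMode (μ (Fin.ofNat 4 k)) (path μ j k)

/-- None of the four ladder operators annihilates the state. -/
def Survives (two : Bool) (μ : Fin 4 → Fin n) (j : Fin n → Bool) : Prop :=
  ∀ i : Fin 4, path μ j i (μ i) = wanted two i

/-- The product of the four Jordan–Wigner signs. -/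
def pathSign (μ : Fin 4 → Fin n) (j : Fin n → Bool) : ℂ := ∏ i : Fin 4, jwSign (μ i) (path μ j i)

theorem pathSign_mul_self (μ : Fin 4 → Fin n) (j : Fin n → Bool) :
    pathSign μ j * pathSign μ j = 1 := by
  rw [pathSign, ← Finset.prod_mul_distrib]
  exact Finset.prod_eq_one fun i _ => jwSign_mul_self _ _

theorem Term.monomial_eq_prod (t : Term n) :
    t.monomial = ladderOp (wanted t.isTwo 3) (t.mode 3) * ladderOp (wanted t.isTwo 2) (t.mode 2) *
      ladderOp (wanted t.isTwo 1) (t.mode 1) * ladderOp (wanted t.isTwo 0) (t.mode 0) := by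
  cases t with
  | one p q =>
    -- `a†_p a_q = a†_p a_p a†_p a_q` pads a one-body monomial to four ladder operators.
    have h : create p * annihilate p * create p = create p := by
      refine matrix_ext_ket fun j => ?_
      have h1 := fun j => ladderOp_mulVec_ket true p j
      have h2 := fun j => ladderOp_mulVec_ket false p j
      simp only [ladderOp, if_true, Bool.false_eq_true, if_false] at h1 h2
      have hf : ∀ j, flipMode p (flipMode p j) = j := fun j => by simp [flipMode]
      have hs : ∀ j, jwSign p (flipMode p j) = jwSign p j := fun j => jwSign_update _ _ _
      rw [← Matrix.mulVec_mulVec, ← Matrix.mulVec_mulVec, h2]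
      by_cases hj : j p = false
      · rw [if_pos hj, Matrix.mulVec_smul, h1, if_pos (by simp [flipMode, hj]), hf, hs, smul_smul,
          jwSign_mul_self, one_smul, h2, if_pos hj]
      · rw [if_neg hj]; simp
    simp [Term.monomial, Term.mode, Term.isTwo, wanted, ladderOp, h]
  | two p q r s _ _ => simp [Term.monomial, Term.mode, Term.isTwo, wanted, ladderOp]

open Classical in
/-- A monomial maps a basis state to a basis state up to a sign, or annihilates it. -/
theorem Term.monomial_mulVec_ket (t : Term n) (j : Fin n → Bool) :
    t.monomial *ᵥ ket j = if Survives t.isTwo t.mode j then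
      pathSign t.mode j • ket (path t.mode j 4) else 0 := by
  have hp0 : path t.mode j 0 = j := rfl
  have hS : Survives t.isTwo t.mode j ↔
      (path t.mode j 0 (t.mode 0) = wanted t.isTwo 0 ∧
       path t.mode j 1 (t.mode 1) = wanted t.isTwo 1 ∧
       path t.mode j 2 (t.mode 2) = wanted t.isTwo 2 ∧
       path t.mode j 3 (t.mode 3) = wanted t.isTwo 3) := by
    simp [Survives, Fin.forall_fin_succ]
  rw [t.monomial_eq_prod, ← Matrix.mulVec_mulVec, ← Matrix.mulVec_mulVec, ← Matrix.mulVec_mulVec]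
  conv_lhs => rw [← hp0]
  rw [ladderOp_mulVec_ket]
  by_cases h0 : path t.mode j 0 (t.mode 0) = wanted t.isTwo 0
  swap
  · rw [if_neg h0, if_neg (fun h => h0 (hS.1 h).1)]; simp
  rw [if_pos h0]
  simp only [Matrix.mulVec_smul]
  rw [show flipMode (t.mode 0) (path t.mode j 0) =
    path t.mode j 1 from rfl, ladderOp_mulVec_ket]
  by_cases h1 : path t.mode j 1 (t.mode 1) = wanted t.isTwo 1
  swap
  · rw [if_neg h1, if_neg (fun h => h1 (hS.1 h).2.1)]; simp
  rw [if_pos h1]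
  simp only [Matrix.mulVec_smul]
  rw [show flipMode (t.mode 1) (path t.mode j 1) = path t.mode j 2 from rfl, ladderOp_mulVec_ket]
  by_cases h2 : path t.mode j 2 (t.mode 2) = wanted t.isTwo 2
  swap
  · rw [if_neg h2, if_neg (fun h => h2 (hS.1 h).2.2.1)]; simp
  rw [if_pos h2]
  simp only [Matrix.mulVec_smul]
  rw [show flipMode (t.mode 2) (path t.mode j 2) = path t.mode j 3 from rfl, ladderOp_mulVec_ket]
  by_cases h3 : path t.mode j 3 (t.mode 3) = wanted t.isTwo 3
  swap
  · rw [if_neg h3, if_neg (fun h => h3 (hS.1 h).2.2.2)]; simp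
  rw [if_pos h3, if_pos (hS.2 ⟨h0, h1, h2, h3⟩), smul_smul, smul_smul, smul_smul, pathSign,
    Fin.prod_univ_four]
  rfl

/-- The parity of the occupation numbers of the modes below `k`. -/
def parityBelow (j : Fin n → Bool) : ℕ → Bool
  | 0 => false
  | k + 1 => xor (parityBelow j k) (if h : k < n then j ⟨k, h⟩ else false)

theorem jwSign_eq_parityBelow (p : Fin n) (j : Fin n → Bool) :
    jwSign p j = if parityBelow j p then -1 else 1 := by
  have key : ∀ k : ℕ, k ≤ n →
      (-1 : ℂ) ^ (Finset.univ.filter fun q : Fin n => q.val < k ∧ j q = true).card =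
        if parityBelow j k then -1 else 1 := by
    intro k
    induction k with
    | zero => simp [parityBelow]
    | succ k ih =>
      intro hk
      specialize ih (by omega)
      rw [parityBelow, dif_pos (show k < n from hk)]
      cases hj : j ⟨k, hk⟩
      · rw [Bool.xor_false, ← ih]
        congr 2
        ext q
        simp only [Finset.mem_filter, Finset.mem_univ, true_and]
        constructor
        · rintro ⟨h1, h2⟩
          refine ⟨lt_of_le_of_ne (by omega) fun h => ?_, h2⟩
          rw [show q = ⟨k, hk⟩ from Fin.ext h, hj] at h2
          simp at h2
        · rintro ⟨h1, h2⟩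
          exact ⟨by omega, h2⟩
      · have : (Finset.univ.filter fun q : Fin n => q.val < k + 1 ∧ j q = true) =
            insert ⟨k, hk⟩ (Finset.univ.filter fun q : Fin n => q.val < k ∧ j q = true) := by
          ext q
          simp only [Finset.mem_filter, Finset.mem_univ, true_and, Finset.mem_insert, Fin.ext_iff]
          constructor
          · rintro ⟨h1, h2⟩
            by_cases h : q.val = k
            · exact Or.inl h
            · exact Or.inr ⟨by omega, h2⟩
          · rintro (h | ⟨h1, h2⟩)
            · exact ⟨by omega, by rw [show q = ⟨k, hk⟩ from Fin.ext h, hj]⟩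
            · exact ⟨by omega, h2⟩
        rw [this, Finset.card_insert_of_notMem (by simp), pow_succ, ih]
        cases parityBelow j k <;> simp
  have := key p p.2.le
  rw [← this, jwSign]
  rfl

end Ladder

end

section

/-! ### The sparsity oracle -/

variable {n kh kl lam m : ℕ}

/-- CNOT gates along the system register that replace the occupation number of every mode `p ≤ k` by
the parity of the occupation numbers of the modes up to and including `p`. -/
def parityCircuit : ℕ → Circuit (Wire n kh kl lam m)
  | 0 => []
  | k + 1 => parityCircuit k ++
      if h : k + 1 < n then cx (.inr ⟨k, by omega⟩) (.inr ⟨k + 1, h⟩) else []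

theorem sends_parityCircuit (x : Wire n kh kl lam m → Bool) (k : ℕ) :
    Sends (parityCircuit k) x (setOccupation x fun p =>
      if p.val ≤ k then parityBelow (occupation x) (p.val + 1) else occupation x p) := by
  induction k with
  | zero =>
    refine (Sends.nil x).congr (funext fun q => ?_)
    rcases q with q | p
    · rfl
    · by_cases hp : p.val = 0
      · have hn : 0 < n := p.pos
        have : p = ⟨0, hn⟩ := Fin.ext hp
        simp [setOccupation, occupation, parityBelow, this]
      · simp [setOccupation, occupation, hp]
  | succ k ih =>
    rw [parityCircuit]
    split_ifs with h
    · refine (ih.append (sends_cx (by simp) _)).congr (funext fun q => ?_)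
      rcases q with q | p
      · rfl
      · by_cases hp : p.val = k + 1
        · have : p = ⟨k + 1, h⟩ := Fin.ext hp
          subst this
          have e : parityBelow (occupation x) (k + 1 + 1) =
              xor (parityBelow (occupation x) (k + 1)) (occupation x ⟨k + 1, h⟩) := by
            rw [parityBelow, dif_pos h]
          simp [setOccupation, e, Bool.xor_comm]
        · have h1 : p ≠ ⟨k + 1, h⟩ := fun h' => hp (by rw [h'])
          have h2 : p.val ≤ k + 1 ↔ p.val ≤ k := by omega
          simp [setOccupation, h1, h2]
    · refine (ih.append (Sends.nil _)).congr (funext fun q => ?_)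
      rcases q with q | p
      · rfl
      · have h2 : p.val ≤ k + 1 ↔ p.val ≤ k := by omega
        simp [setOccupation, h2]

theorem tCount_parityCircuit (k : ℕ) :
    Circuit.tCount (parityCircuit k : Circuit (Wire n kh kl lam m)) = 0 := by
  induction k with
  | zero => rfl
  | succ k ih =>
    rw [parityCircuit, Circuit.tCount_append, ih]
    split_ifs
    · rw [tCount_cx]
    · rfl

/-- The validation qubit. -/
abbrev validWire : Wire n kh kl lam m := .inl .valid

/-- The `i`-th flag, which records that the `i`-th ladder operator annihilates the state. -/
def flag (i : Fin 4) : Wire n kh kl lam m := aux (Fin.castAdd 2 i)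

theorem scratch_ne_flag (i : ℕ) (j : Fin 4) : (scratch i : Wire n kh kl lam m) ≠ flag j :=
  scratch_ne_aux _ _

/-- The circuit acts as a SWAP-UP circuit that exchanges the system qubit `p0` with the mode
`μ a`, where `a` is the index. -/
def ActsAsSwapUp (p0 : Fin n) (μ : Address kh kl → Fin n) (U : Circuit (Wire n kh kl lam m)) :
    Prop :=
  ∀ x, ScratchClean x → CellsClean x →
    Sends U x (setOccupation x fun p => occupation x (Equiv.swap p0 (μ (address x)) p))

section Flip

variable {Q : Type} [DecidableEq Q] [Fintype Q]

/-- A flip of the qubit `p` and a sign flip if it holds `1`, both controlled by `v`, with the flag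
`f` for the wrong content. The wanted content is `c0`, plus the content of `h` if `c1 = true`. -/
def flipCircuit (v p f h : Q) (c0 c1 : Bool) : Circuit Q :=
  cz v p ++ (((ccx v p f ++ (if c1 then ccx v h f else [])) ++ (if c0 then cx v f else [])) ++
    cx v p)

theorem flipCircuit_mulVec_ket {v p f h : Q} (h1 : v ≠ p) (h2 : v ≠ f) (h3 : p ≠ f) (h4 : v ≠ h)
    (h5 : h ≠ f) (c0 c1 : Bool) (x : Q → Bool) :
    Circuit.matrix (flipCircuit v p f h c0 c1) *ᵥ ket x =
      (if x v && x p then -1 else 1 : ℂ) • ket (Function.update (Function.update x f (xor (x f)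
        (x v && xor (x p) (xor c0 (c1 && x h))))) p (xor (x p) (x v))) := by
  have e3 : ∀ y : Q → Bool, Sends (if c1 then ccx v h f else []) y
        (Function.update y f (xor (y f) (y v && (c1 && y h)))) := by
    intro y
    cases c1
    · exact (Sends.nil y).congr (by simp)
    · exact (sends_ccx h4 h2 h5 y).congr (by simp)
  have e4 : ∀ y : Q → Bool, Sends (if c0 then cx v f else []) y
        (Function.update y f (xor (y f) (y v && c0))) := by
    intro y
    cases c0
    · exact (Sends.nil y).congr (by simp)
    · exact (sends_cx h2 y).congr (by simp)
  have e := (((sends_ccx h1 h2 h3 x).append (e3 _)).append (e4 _)).append (sends_cx h1 _)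
  rw [flipCircuit, Circuit.append_mulVec, cz_mulVec_ket h1, Matrix.mulVec_smul, e]
  congr 2
  simp only [Function.update_idem, Function.update_self, Function.update_of_ne h2,
    Function.update_of_ne h3, Function.update_of_ne h5]
  congr 2
  cases x v <;> cases x p <;> cases c0 <;> cases c1 <;> cases x h <;> cases x f <;> rfl

theorem tCount_flipCircuit_le (v p f h : Q) (c0 c1 : Bool) :
    Circuit.tCount (flipCircuit v p f h c0 c1) ≤ 14 := by
  cases c0 <;> cases c1 <;>
    simp [flipCircuit, Circuit.tCount_append, tCount_cz, tCount_ccx, tCount_cx]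

end Flip

/-- The pieces of one step: a controlled ladder operator, which acts also on the states that it should
annihilate, but raises the flag `f` there. In the parity basis, the first controlled sign flip applies
the Jordan–Wigner sign times `(-1)^(j_p)`; the sign flip in `flipCircuit` removes the excess factor.
The wanted occupation number is `c0`, plus the leading index bit if `c1 = true`. -/
def stepPieces (p0 : Fin n) (U : Circuit (Wire n (kh + 1) kl lam m)) (f : Fin 4) (c0 c1 : Bool) :
    List (Circuit (Wire n (kh + 1) kl lam m)) :=
  [parityCircuit n, U, cz validWire (.inr p0), Circuit.inv U, Circuit.inv (parityCircuit n),
    U, flipCircuit validWire (.inr p0) (flag f) (.inl (.hi 0)) c0 c1, Circuit.inv U]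

/-- The action of a step on a basis state with validation qubit `1`, up to the sign; the wanted
occupation number is `d`. -/
def stepMap (p : Fin n) (f : Fin 4) (d : Bool) (x : Wire n (kh + 1) kl lam m → Bool) :
    Wire n (kh + 1) kl lam m → Bool :=
  Function.update (setOccupation x (flipMode p (occupation x))) (flag f)
    (xor (x (flag f)) (xor (occupation x p) d))

theorem occupation_stepMap (p : Fin n) (f : Fin 4) (d : Bool)
    (x : Wire n (kh + 1) kl lam m → Bool) :
    occupation (stepMap p f d x) = flipMode p (occupation x) := by
  funext q
  simp [stepMap, occupation, flag, aux, setOccupation]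

theorem address_stepMap (p : Fin n) (f : Fin 4) (d : Bool)
    (x : Wire n (kh + 1) kl lam m → Bool) : address (stepMap p f d x) = address x := by
  simp [stepMap, address, flag, aux, setOccupation]

theorem stepMap_flag (p : Fin n) (f : Fin 4) (d : Bool) (x : Wire n (kh + 1) kl lam m → Bool) :
    stepMap p f d x (flag f) = xor (x (flag f)) (xor (occupation x p) d) :=
  Function.update_self ..

theorem stepMap_of_ne (p : Fin n) (f : Fin 4) (d : Bool) (x : Wire n (kh + 1) kl lam m → Bool)
    {q : Ancilla (kh + 1) kl lam m (m + 2 + 6)} (hq : (.inl q : Wire n (kh + 1) kl lam m) ≠ flag f) :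
    stepMap p f d x (.inl q) = x (.inl q) := by
  rw [stepMap, Function.update_of_ne hq]
  rfl

theorem ScratchClean.stepMap {x : Wire n (kh + 1) kl lam m → Bool} (hx : ScratchClean x)
    (p : Fin n) (f : Fin 4) (d : Bool) : ScratchClean (stepMap p f d x) := fun i hi =>
  (stepMap_of_ne p f d x (scratch_ne_flag _ _)).trans (hx i hi)

theorem CellsClean.stepMap {x : Wire n (kh + 1) kl lam m → Bool} (hc : CellsClean x)
    (p : Fin n) (f : Fin 4) (d : Bool) : CellsClean (stepMap p f d x) := fun i b =>
  (stepMap_of_ne p f d x (by simp [flag, aux])).trans (hc i b)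

theorem step_mulVec_ket {p0 : Fin n} {μ : Address (kh + 1) kl → Fin n}
    {U : Circuit (Wire n (kh + 1) kl lam m)} (hU : ActsAsSwapUp p0 μ U) (f : Fin 4) (c0 c1 : Bool)
    (x : Wire n (kh + 1) kl lam m → Bool) (hx : ScratchClean x) (hc : CellsClean x) :
    Circuit.matrix (stepPieces p0 U f c0 c1).flatten *ᵥ ket x =
      (if x validWire then jwSign (μ (address x)) (occupation x) else 1 : ℂ) •
      ket (if x validWire then
        stepMap (μ (address x)) f (xor c0 (c1 && (address x).1 0)) x else x) := by
  have hl : (stepPieces p0 U f c0 c1).flatten =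
      (parityCircuit n ++ (U ++ cz validWire (.inr p0) ++ Circuit.inv U) ++
        Circuit.inv (parityCircuit n)) ++
        (U ++ flipCircuit validWire (.inr p0) (flag f) (.inl (.hi 0)) c0 c1 ++
          Circuit.inv U) := by
    simp [stepPieces]
  have e1 := sends_parityCircuit x n
  set y := setOccupation x fun p =>
      if p.val ≤ n then parityBelow (occupation x) (p.val + 1) else occupation x p with hy
  have hyx : ScratchClean y := hx
  have hyc : CellsClean y := hc
  have e2 := hU y hyx hyc
  have hocc : occupation y = fun p : Fin n => parityBelow (occupation x) (p.val + 1) := by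
    funext p
    simp [hy, occupation, setOccupation]
  have haddr : address y = address x := rfl
  -- The sign flip in the parity basis.
  have e3 := e1.conj (e2.conj (cz_mulVec_ket (a := validWire) (b := .inr p0) (by simp) _) e2) e1
  rw [hl, Circuit.append_mulVec, e3, Matrix.mulVec_smul]
  have e4 := hU x hx hc
  set v := setOccupation x fun p => occupation x (Equiv.swap p0 (μ (address x)) p) with hv
  have e5 := flipCircuit_mulVec_ket (v := validWire) (p := .inr p0) (f := flag f)
    (h := .inl (.hi 0)) (by simp) (by simp [flag, aux]) (by simp [flag, aux]) (by simp)
    (by simp [flag, aux]) c0 c1 v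
  -- Flipping the first system qubit between SWAP-UP and its inverse is flipping the mode `μ a`.
  have hU' : Sends U (if x validWire then
        stepMap (μ (address x)) f (xor c0 (c1 && (address x).1 0)) x else x)
      (Function.update (Function.update v (flag f) (xor (v (flag f))
        (v validWire && xor (v (.inr p0)) (xor c0 (c1 && v (.inl (.hi 0)))))))
        (.inr p0) (xor (v (.inr p0)) (v validWire))) := by
    have hvv : v validWire = x validWire := rfl
    have hvf : v (flag f) = x (flag f) := rfl
    have hvh : v (.inl (.hi 0)) = (address x).1 0 := rfl
    have hvp : v (.inr p0) = occupation x (μ (address x)) := by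
      simp [hv, setOccupation]
    rw [hvv, hvf, hvh, hvp]
    cases hval : x validWire
    · simp only [Bool.false_and, Bool.xor_false, ← hvf, ← hvp, Function.update_eq_self]
      exact e4
    · simp only [if_true, Bool.true_and, Bool.xor_true]
      refine (hU _ (hx.stepMap _ _ _) (hc.stepMap _ _ _)).congr (funext fun q => ?_)
      rw [address_stepMap, occupation_stepMap]
      rcases q with q | p
      · rw [Function.update_of_ne (by simp)]
        simp only [setOccupation, Sum.elim_inl]
        by_cases hq : (.inl q : Wire n (kh + 1) kl lam m) = flag f
        · rw [hq, Function.update_self, stepMap_flag]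
        · rw [Function.update_of_ne hq, stepMap_of_ne _ _ _ _ hq]
          rfl
      · by_cases hp : p = p0
        · subst hp
          simp [setOccupation, flipMode]
        · rw [Function.update_of_ne (by simpa using hp), Function.update_of_ne (by simp [flag, aux])]
          have : Equiv.swap p0 (μ (address x)) p ≠ μ (address x) := by
            intro h
            exact hp ((Equiv.swap p0 (μ (address x))).injective
              (h.trans (Equiv.swap_apply_left _ _).symm))
          simp [hv, setOccupation, flipMode, this]
  rw [e4.conj e5 hU', smul_smul]
  congr 1
  have h1 : v validWire = x validWire := rfl
  have h2 : v (.inr p0) = occupation x (μ (address x)) := by simp [hv, setOccupation]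
  have h3 : setOccupation y (fun p => occupation y (Equiv.swap p0 (μ (address y)) p)) validWire =
    x validWire := rfl
  have h4 : setOccupation y (fun p => occupation y (Equiv.swap p0 (μ (address y)) p)) (.inr p0) =
      xor (parityBelow (occupation x) (μ (address x))) (occupation x (μ (address x))) := by
    simp only [setOccupation, Sum.elim_inr, Equiv.swap_apply_left, haddr, hocc]
    rw [parityBelow, dif_pos (μ (address x)).2]
  rw [h1, h2, h3, h4, jwSign_eq_parityBelow]
  cases x validWire <;> cases parityBelow (occupation x) (μ (address x)) <;>
    cases occupation x (μ (address x)) <;> simp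

theorem tCount_stepPieces_le (p0 : Fin n) (U : Circuit (Wire n (kh + 1) kl lam m)) (f : Fin 4)
    (c0 c1 : Bool) :
    Circuit.tCount (stepPieces p0 U f c0 c1).flatten ≤ 4 * Circuit.tCount U + 14 := by
  have h := tCount_flipCircuit_le (validWire : Wire n (kh + 1) kl lam m) (.inr p0) (flag f)
    (.inl (.hi 0)) c0 c1
  simp only [stepPieces, List.flatten_cons, List.flatten_nil, List.append_nil,
    Circuit.tCount_append, Circuit.tCount_inv, tCount_parityCircuit, tCount_cz]
  omega

/-- Computes the conjunctions of the negated flags `0, 1` and of the negated flags `2, 3`. -/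
def conjunctionCircuit : Circuit (Wire n kh kl lam m) :=
  Circuit.pauliX (flag 0) ++ Circuit.pauliX (flag 1) ++ Circuit.pauliX (flag 2) ++
    Circuit.pauliX (flag 3) ++ ccx (flag 0) (flag 1) (aux 4) ++ ccx (flag 2) (flag 3) (aux 5)

/-- Flips the validation qubit if all flags are `0`. -/
def validateCircuit : Circuit (Wire n kh kl lam m) :=
  conjunctionCircuit ++ ccx (aux 4) (aux 5) validWire ++ Circuit.inv conjunctionCircuit

theorem flag_ne {i j : Fin 4} (h : i ≠ j) : (flag i : Wire n kh kl lam m) ≠ flag j := by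
  rwa [flag, flag, ne_eq, aux_inj, Fin.castAdd_inj]

theorem flag_ne_aux (i : Fin 4) (j : Fin 6) (h : i.val < j.val) :
    (flag i : Wire n kh kl lam m) ≠ aux j := by
  rw [flag, ne_eq, aux_inj, Fin.ext_iff, Fin.val_castAdd]
  omega

theorem sends_validateCircuit (x : Wire n kh kl lam m → Bool) (h4 : x (aux 4) = false)
    (h5 : x (aux 5) = false) :
    Sends validateCircuit x (Function.update x validWire (xor (x validWire)
      (!x (flag 0) && !x (flag 1) && (!x (flag 2) && !x (flag 3))))) := by
  have hva : ∀ j, (aux j : Wire n kh kl lam m) ≠ validWire := fun j => by simp [aux]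
  have hvf : ∀ j, (flag j : Wire n kh kl lam m) ≠ validWire := fun j => hva _
  have h45 : (aux 4 : Wire n kh kl lam m) ≠ aux 5 := by rw [ne_eq, aux_inj]; decide
  have hf4 : ∀ j, (flag j : Wire n kh kl lam m) ≠ aux 4 := fun j => flag_ne_aux _ _ j.2
  have hf5 : ∀ j, (flag j : Wire n kh kl lam m) ≠ aux 5 := fun j =>
    flag_ne_aux _ _ (j.2.trans (by decide))
  have f01 : (flag 0 : Wire n kh kl lam m) ≠ flag 1 := flag_ne (by decide)
  have f02 : (flag 0 : Wire n kh kl lam m) ≠ flag 2 := flag_ne (by decide)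
  have f03 : (flag 0 : Wire n kh kl lam m) ≠ flag 3 := flag_ne (by decide)
  have f12 : (flag 1 : Wire n kh kl lam m) ≠ flag 2 := flag_ne (by decide)
  have f13 : (flag 1 : Wire n kh kl lam m) ≠ flag 3 := flag_ne (by decide)
  have f23 : (flag 2 : Wire n kh kl lam m) ≠ flag 3 := flag_ne (by decide)
  have key : ∃ y : Wire n kh kl lam m → Bool,
      (∀ b, Sends conjunctionCircuit (Function.update x validWire b)
        (Function.update y validWire b)) ∧
      y (aux 4) = (!x (flag 0) && !x (flag 1)) ∧ y (aux 5) = (!x (flag 2) && !x (flag 3)) := by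
    refine ⟨Function.update (Function.update (Function.update (Function.update (Function.update
      (Function.update x (flag 0) (!x (flag 0))) (flag 1) (!x (flag 1))) (flag 2) (!x (flag 2)))
      (flag 3) (!x (flag 3))) (aux 4) (!x (flag 0) && !x (flag 1))) (aux 5)
      (!x (flag 2) && !x (flag 3)), fun b => ?_, ?_, ?_⟩
    · refine ((((((sends_pauliX (flag 0) _).append (sends_pauliX (flag 1) _)).append
        (sends_pauliX (flag 2) _)).append (sends_pauliX (flag 3) _)).append
        (sends_ccx f01 (hf4 0) (hf4 1) _)).append (sends_ccx f23 (hf5 2) (hf5 3) _)).congr ?_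
      simp only [Function.update_self, Function.update_of_ne f01, Function.update_of_ne f01.symm,
        Function.update_of_ne f02, Function.update_of_ne f02.symm,
        Function.update_of_ne f03, Function.update_of_ne f03.symm,
        Function.update_of_ne f12, Function.update_of_ne f12.symm,
        Function.update_of_ne f13, Function.update_of_ne f13.symm,
        Function.update_of_ne f23, Function.update_of_ne f23.symm,
        Function.update_of_ne (hf4 _), Function.update_of_ne (hf4 _).symm,
        Function.update_of_ne (hf5 _).symm,
        Function.update_of_ne (hva _), Function.update_of_ne (hvf _),
        Function.update_of_ne h45.symm, h4, h5, Bool.false_xor,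
        Function.update_comm (hva _).symm, Function.update_comm (hvf _).symm]
    · rw [Function.update_of_ne h45, Function.update_self]
    · rw [Function.update_self]
  obtain ⟨y, hy, hy4, hy5⟩ := key
  have e := hy (x validWire)
  rw [Function.update_eq_self] at e
  refine e.conj' ((sends_ccx h45 (hva 4) (hva 5) _).congr ?_) (hy _)
  rw [Function.update_self, Function.update_idem, Function.update_of_ne (hva 4),
    Function.update_of_ne (hva 5), hy4, hy5]

theorem tCount_validateCircuit :
    Circuit.tCount (validateCircuit : Circuit (Wire n kh kl lam m)) = 35 := by
  have h : ∀ q : Wire n kh kl lam m, Circuit.tCount (Circuit.pauliX q) = 0 := fun q => rfl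
  simp only [validateCircuit, conjunctionCircuit, Circuit.tCount_append, Circuit.tCount_inv,
    tCount_ccx, h]

/-- The pieces that apply the four ladder operators, controlled by the validation qubit. The two
Boolean constants of each step encode `wanted two i = xor c0 (c1 && two)`. -/
def ladderPieces (p0 : Fin n) (U : Fin 4 → Circuit (Wire n (kh + 1) kl lam m)) :
    List (Circuit (Wire n (kh + 1) kl lam m)) :=
  stepPieces p0 (U 0) 0 true false ++ stepPieces p0 (U 1) 1 false true ++
    stepPieces p0 (U 2) 2 true true ++ stepPieces p0 (U 3) 3 false false

/-- The pieces of the sparsity oracle. After the validation qubit has been flipped on the states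
that survive, the inverse ladder operators undo everything on the other states. -/
def sparsityPieces (p0 : Fin n) (U : Fin 4 → Circuit (Wire n (kh + 1) kl lam m)) :
    List (Circuit (Wire n (kh + 1) kl lam m)) :=
  ladderPieces p0 U ++ [validateCircuit] ++ (ladderPieces p0 U).reverse.map Circuit.inv

theorem inv_flatten {Q : Type} (l : List (Circuit Q)) :
    Circuit.inv l.flatten = (l.reverse.map Circuit.inv).flatten := by
  induction l with
  | nil => rfl
  | cons c l ih =>
    have : Circuit.inv (c ++ l.flatten) = Circuit.inv l.flatten ++ Circuit.inv c := by
      simp [Circuit.inv]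
    rw [List.flatten_cons, this, ih]
    simp

theorem Circuit.append_smul {Q : Type} [DecidableEq Q] [Fintype Q] {c d : Circuit Q}
    {x y z : Q → Bool} {u u' : ℂ} (h : c.matrix *ᵥ ket x = u • ket y)
    (h' : d.matrix *ᵥ ket y = u' • ket z) :
    Circuit.matrix (c ++ d) *ᵥ ket x = (u * u') • ket z := by
  rw [Circuit.append_mulVec, h, Matrix.mulVec_smul, h', smul_smul]

section Sparsity

variable {p0 : Fin n} {μ : Fin 4 → Address (kh + 1) kl → Fin n}
  {U : Fin 4 → Circuit (Wire n (kh + 1) kl lam m)}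

/-- Without the validation qubit, the ladder operators do nothing. So on the surviving states, for
which the validation qubit has been cleared, their inverses do nothing either. -/
theorem sends_ladderPieces_of_not_valid (hU : ∀ i, ActsAsSwapUp p0 (μ i) (U i))
    (x : Wire n (kh + 1) kl lam m → Bool)
    (hx : ScratchClean x) (hc : CellsClean x) (hv : x validWire = false) :
    Sends (ladderPieces p0 U).flatten x x := by
  have h : ∀ i f c0 c1, Sends (stepPieces p0 (U i) f c0 c1).flatten x x := fun i f c0 c1 => by
    have := step_mulVec_ket (hU i) f c0 c1 x hx hc
    simpa [hv, Sends] using this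
  simp only [ladderPieces, List.flatten_append]
  exact (((h _ _ _ _).append (h _ _ _ _)).append (h _ _ _ _)).append (h _ _ _ _)

/-- With the validation qubit, the four ladder operators act without their projections, and the `i`-th
flag tells whether the `i`-th of them should have annihilated the state. -/
theorem ladderPieces_mulVec_ket (hU : ∀ i, ActsAsSwapUp p0 (μ i) (U i))
    (x : Wire n (kh + 1) kl lam m → Bool)
    (hx : ScratchClean x) (hc : CellsClean x) (hv : x validWire = true)
    (hf : ∀ i, x (flag i) = false) :
    ∃ y : Wire n (kh + 1) kl lam m → Bool,
      Circuit.matrix (ladderPieces p0 U).flatten *ᵥ ket x =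
        pathSign (fun i => μ i (address x)) (occupation x) • ket y ∧
      occupation y = path (fun i => μ i (address x)) (occupation x) 4 ∧
      (∀ i : Fin 4, y (flag i) = xor (path (fun i => μ i (address x)) (occupation x) i
        (μ i (address x))) (wanted ((address x).1 0) i)) ∧
      ∀ q, (∀ i, .inl q ≠ (flag i : Wire n (kh + 1) kl lam m)) → y (.inl q) = x (.inl q) := by
  have hvf : ∀ j, (validWire : Wire n (kh + 1) kl lam m) ≠ flag j := fun j => by simp [flag, aux]
  have hs : ∀ i f c0 c1 (y : Wire n (kh + 1) kl lam m → Bool), ScratchClean y → CellsClean y →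
      y validWire = true → address y = address x →
      Circuit.matrix (stepPieces p0 (U i) f c0 c1).flatten *ᵥ ket y =
        jwSign (μ i (address x)) (occupation y) • ket
          (stepMap (μ i (address x)) f (xor c0 (c1 && (address x).1 0)) y) := by
    intro i f c0 c1 y h1 h2 h3 h4
    have := step_mulVec_ket (hU i) f c0 c1 y h1 h2
    rwa [if_pos h3, if_pos h3, h4] at this
  set a := address x
  have e0 := hs 0 0 true false x hx hc hv rfl
  set x1 := stepMap (μ 0 a) 0 (xor true (false && a.1 0)) x with hx1
  have s1 : ScratchClean x1 := hx.stepMap _ _ _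
  have c1 : CellsClean x1 := hc.stepMap _ _ _
  have v1 : x1 validWire = true := (stepMap_of_ne _ _ _ _ (hvf _)).trans hv
  have a1 : address x1 = a := address_stepMap _ _ _ _
  have o1 : occupation x1 = flipMode (μ 0 a) (occupation x) := occupation_stepMap _ _ _ _
  have e1 := hs 1 1 false true x1 s1 c1 v1 a1
  set x2 := stepMap (μ 1 a) 1 (xor false (true && a.1 0)) x1 with hx2
  have s2 : ScratchClean x2 := s1.stepMap _ _ _
  have c2 : CellsClean x2 := c1.stepMap _ _ _
  have v2 : x2 validWire = true := (stepMap_of_ne _ _ _ _ (hvf _)).trans v1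
  have a2 : address x2 = a := (address_stepMap _ _ _ _).trans a1
  have o2 : occupation x2 = flipMode (μ 1 a) (occupation x1) := occupation_stepMap _ _ _ _
  have e2 := hs 2 2 true true x2 s2 c2 v2 a2
  set x3 := stepMap (μ 2 a) 2 (xor true (true && a.1 0)) x2 with hx3
  have s3 : ScratchClean x3 := s2.stepMap _ _ _
  have c3 : CellsClean x3 := c2.stepMap _ _ _
  have v3 : x3 validWire = true := (stepMap_of_ne _ _ _ _ (hvf _)).trans v2
  have a3 : address x3 = a := (address_stepMap _ _ _ _).trans a2
  have o3 : occupation x3 = flipMode (μ 2 a) (occupation x2) := occupation_stepMap _ _ _ _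
  have e3 := hs 3 3 false false x3 s3 c3 v3 a3
  set x4 := stepMap (μ 3 a) 3 (xor false (false && a.1 0)) x3 with hx4
  have o4 : occupation x4 = flipMode (μ 3 a) (occupation x3) := occupation_stepMap _ _ _ _
  have p1 : occupation x1 = path (fun i => μ i a) (occupation x) 1 := o1
  have p2 : occupation x2 = path (fun i => μ i a) (occupation x) 2 := by rw [o2, p1]; rfl
  have p3 : occupation x3 = path (fun i => μ i a) (occupation x) 3 := by rw [o3, p2]; rfl
  have f1 : ∀ j, j ≠ 0 → x1 (flag j) = x (flag j) := fun j hj =>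
    stepMap_of_ne _ _ _ _ (flag_ne hj)
  have f2 : ∀ j, j ≠ 1 → x2 (flag j) = x1 (flag j) := fun j hj =>
    stepMap_of_ne _ _ _ _ (flag_ne hj)
  have f3 : ∀ j, j ≠ 2 → x3 (flag j) = x2 (flag j) := fun j hj =>
    stepMap_of_ne _ _ _ _ (flag_ne hj)
  have f4 : ∀ j, j ≠ 3 → x4 (flag j) = x3 (flag j) := fun j hj =>
    stepMap_of_ne _ _ _ _ (flag_ne hj)
  refine ⟨x4, ?_, by rw [o4, p3]; rfl, ?_, ?_⟩
  · simp only [ladderPieces, List.flatten_append]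
    rw [Circuit.append_smul (Circuit.append_smul (Circuit.append_smul e0 e1) e2) e3, p1, p2, p3,
      pathSign, Fin.prod_univ_four]
    rfl
  · have g0 : x4 (flag 0) = xor (occupation x (μ 0 a)) (xor true (false && a.1 0)) := by
      rw [f4 0 (by decide), f3 0 (by decide), f2 0 (by decide), hx1, stepMap_flag, hf,
        Bool.false_xor]
    have g1 : x4 (flag 1) = xor (occupation x1 (μ 1 a)) (xor false (true && a.1 0)) := by
      rw [f4 1 (by decide), f3 1 (by decide), hx2, stepMap_flag, f1 1 (by decide), hf,
        Bool.false_xor]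
    have g2 : x4 (flag 2) = xor (occupation x2 (μ 2 a)) (xor true (true && a.1 0)) := by
      rw [f4 2 (by decide), hx3, stepMap_flag, f2 2 (by decide), f1 2 (by decide), hf,
        Bool.false_xor]
    have g3 : x4 (flag 3) = xor (occupation x3 (μ 3 a)) (xor false (false && a.1 0)) := by
      rw [hx4, stepMap_flag, f3 3 (by decide), f2 3 (by decide), f1 3 (by decide), hf,
        Bool.false_xor]
    rw [p1] at g1
    rw [p2] at g2
    rw [p3] at g3
    intro i
    fin_cases i
    · exact g0.trans (by simp [wanted, path])
    · exact g1.trans (by simp [wanted])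
    · exact g2.trans (by simp [wanted])
    · exact g3.trans (by simp [wanted])
  · intro q hq
    rw [hx4, stepMap_of_ne _ _ _ _ (hq _), hx3, stepMap_of_ne _ _ _ _ (hq _), hx2,
      stepMap_of_ne _ _ _ _ (hq _), hx1, stepMap_of_ne _ _ _ _ (hq _)]

open Classical in
/-- The action of the sparsity oracle at an arbitrary index, also one without a monomial. -/
theorem sparsityPieces_mulVec_ket (hU : ∀ i, ActsAsSwapUp p0 (μ i) (U i))
    (x : Wire n (kh + 1) kl lam m → Bool)
    (hx : WorkClean x) (hc : CellsClean x) (hv : x validWire = true) :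
    Circuit.matrix (sparsityPieces p0 U).flatten *ᵥ ket x =
      if Survives ((address x).1 0) (fun i => μ i (address x)) (occupation x) then
        pathSign (fun i => μ i (address x)) (occupation x) •
          ket (setOccupation (Function.update x validWire false)
            (path (fun i => μ i (address x)) (occupation x) 4))
      else ket x := by
  obtain ⟨y, e1, ho, hf, hq⟩ := ladderPieces_mulVec_ket hU x hx.scratchClean hc hv fun i => hx _
  have hva : ∀ j, (aux j : Wire n (kh + 1) kl lam m) ≠ validWire := fun j => by simp [aux]
  have hy4 : y (aux 4) = false :=
    (hq _ fun i => (flag_ne_aux i 4 i.2).symm).trans (hx _)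
  have hy5 : y (aux 5) = false :=
    (hq _ fun i => (flag_ne_aux i 5 (i.2.trans (by decide))).symm).trans (hx _)
  have hyv : y validWire = true := (hq _ fun i => by simp [flag, aux]).trans hv
  have e2 := sends_validateCircuit y hy4 hy5
  have hfS : Survives ((address x).1 0) (fun i => μ i (address x)) (occupation x) ↔
      ∀ i, y (flag i) = false := by
    refine forall_congr' fun i => ?_
    rw [hf]
    simp
  simp only [sparsityPieces, List.flatten_append, ← inv_flatten, List.flatten_cons,
    List.flatten_nil, List.append_nil]
  rw [Circuit.append_mulVec, Circuit.append_mulVec, e1, Matrix.mulVec_smul, e2, Matrix.mulVec_smul]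
  by_cases hS : Survives ((address x).1 0) (fun i => μ i (address x)) (occupation x)
  · rw [if_pos hS]
    have hff := hfS.1 hS
    simp only [hff, hyv, Bool.not_false, Bool.and_self, Bool.xor_self]
    have hyx : Function.update y validWire false = setOccupation (Function.update x validWire false)
            (path (fun i => μ i (address x)) (occupation x) 4) := by
      funext q
      rcases q with q | p
      · simp only [setOccupation, Sum.elim_inl]
        by_cases hqv : q = .valid
        · subst hqv; simp
        · rw [Function.update_of_ne (by simpa using hqv), Function.update_of_ne (by simpa using hqv)]
          by_cases hqf : ∃ i, (.inl q : Wire n (kh + 1) kl lam m) = flag i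
          · obtain ⟨i, hi⟩ := hqf
            rw [hi, hff i]
            exact (hx _).symm
          · exact hq q fun i hi => hqf ⟨i, hi⟩
      · rw [Function.update_of_ne (by simp)]
        simp only [setOccupation, Sum.elim_inr, ← ho]
        rfl
    rw [hyx]
    congr 1
    have hx' : ScratchClean (setOccupation (Function.update x validWire false)
            (path (fun i => μ i (address x)) (occupation x) 4)) := fun i hi => by
      rw [← hyx, Function.update_of_ne (by simp [scratch]), scratch, hq _ fun j => scratch_ne_flag i j]
      exact hx _
    have hc' : CellsClean (setOccupation (Function.update x validWire false)
            (path (fun i => μ i (address x)) (occupation x) 4)) := fun i b => by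
      rw [← hyx, Function.update_of_ne (by simp), hq _ fun j => by simp [flag, aux]]
      exact hc _ _
    exact (sends_ladderPieces_of_not_valid hU _ hx' hc' (by rw [← hyx, Function.update_self])).inv
  · rw [if_neg hS]
    have hb : (!y (flag 0) && !y (flag 1) && (!y (flag 2) && !y (flag 3))) = false := by
      by_contra h
      refine hS (hfS.2 fun i => ?_)
      simp only [Bool.not_eq_false, Bool.and_eq_true, Bool.not_eq_true'] at h
      fin_cases i
      · exact h.1.1
      · exact h.1.2
      · exact h.2.1
      · exact h.2.2
    -- The validation qubit is still `1`, so that the inverse ladder operators act and undo all.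
    rw [hb, Bool.xor_false, Function.update_eq_self,
      Circuit.inv_mulVec_of_eq_smul e1 (pathSign_mul_self _ _), smul_smul, pathSign_mul_self,
      one_smul]

theorem isSparsityOracle_sparsityPieces (hU : ∀ i, ActsAsSwapUp p0 (μ i) (U i))
    (S : Finset (Term n)) (addr : Term n → Address (kh + 1) kl)
    (htwo : ∀ t ∈ S, (addr t).1 0 = t.isTwo) (hμ : ∀ t ∈ S, ∀ i, μ i (addr t) = t.mode i) :
    IsSparsityOracle S addr (sparsityPieces p0 U).flatten := by
  classical
  intro t ht x hx hc hv ha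
  have e := sparsityPieces_mulVec_ket hU x hx hc hv
  have hm : (fun i => μ i (address x)) = t.mode := funext fun i => by rw [ha, hμ t ht]
  rw [hm, ha, htwo t ht] at e
  have hmon : ∀ i, t.monomial i (occupation x) =
      (if Survives t.isTwo t.mode (occupation x) then
        pathSign t.mode (occupation x) • ket (path t.mode (occupation x) 4) else 0) i := by
    intro i
    rw [← t.monomial_mulVec_ket, mulVec_ket]
  constructor
  · rintro ⟨i, hi⟩
    have hS : Survives t.isTwo t.mode (occupation x) := by
      by_contra hS
      rw [hmon, if_neg hS] at hi
      exact hi rfl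
    rw [e, if_pos hS]
    simp only [hmon, if_pos hS]
    rw [Finset.sum_eq_single (path t.mode (occupation x) 4)]
    · simp [ket_apply]
    · intro j _ hj
      simp [ket_apply, hj]
    · simp
  · intro h
    rw [e, if_neg]
    intro hS
    have := h (path t.mode (occupation x) 4)
    rw [hmon, if_pos hS, Pi.smul_apply, ket_apply, if_pos rfl, smul_eq_mul, mul_one] at this
    have h1 := pathSign_mul_self t.mode (occupation x)
    rw [this] at h1
    simp at h1

end Sparsity

theorem tCount_sparsityPieces_le (p0 : Fin n) (U : Fin 4 → Circuit (Wire n (kh + 1) kl lam m))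
    (T : ℕ) (hT : ∀ i, Circuit.tCount (U i) ≤ T) :
    Circuit.tCount (sparsityPieces p0 U).flatten ≤ 32 * T + 147 := by
  have h0 := tCount_stepPieces_le p0 (U 0) 0 true false
  have h1 := tCount_stepPieces_le p0 (U 1) 1 false true
  have h2 := tCount_stepPieces_le p0 (U 2) 2 true true
  have h3 := tCount_stepPieces_le p0 (U 3) 3 false false
  have t0 := hT 0
  have t1 := hT 1
  have t2 := hT 2
  have t3 := hT 3
  simp only [sparsityPieces, List.flatten_append, ← inv_flatten, List.flatten_cons,
    List.flatten_nil, List.append_nil, Circuit.tCount_append, Circuit.tCount_inv,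
    tCount_validateCircuit, ladderPieces]
  omega

theorem length_sparsityPieces (p0 : Fin n) (U : Fin 4 → Circuit (Wire n (kh + 1) kl lam m)) :
    (sparsityPieces p0 U).length = 65 := by
  simp [sparsityPieces, ladderPieces, stepPieces]

/-- Every piece of the sparsity oracle is a SWAP-UP circuit, its inverse, or a circuit with at most
`35` T gates. -/
theorem mem_sparsityPieces {p0 : Fin n} {U : Fin 4 → Circuit (Wire n (kh + 1) kl lam m)}
    {c : Circuit (Wire n (kh + 1) kl lam m)} (hc : c ∈ sparsityPieces p0 U) :
    (∃ i, c = U i ∨ c = Circuit.inv (U i)) ∨ Circuit.tCount c ≤ 35 := by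
  have hstep : ∀ i f c0 c1, ∀ c ∈ stepPieces p0 (U i) f c0 c1,
      (∃ i, c = U i ∨ c = Circuit.inv (U i)) ∨ Circuit.tCount c ≤ 35 := by
    intro i f c0 c1 c hc
    simp only [stepPieces, List.mem_cons, List.not_mem_nil, or_false] at hc
    rcases hc with rfl | rfl | rfl | rfl | rfl | rfl | rfl | rfl
    · right; simp [tCount_parityCircuit]
    · exact Or.inl ⟨i, Or.inl rfl⟩
    · right; simp [tCount_cz]
    · exact Or.inl ⟨i, Or.inr rfl⟩
    · right; simp [tCount_parityCircuit, Circuit.tCount_inv]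
    · exact Or.inl ⟨i, Or.inl rfl⟩
    · exact Or.inr ((tCount_flipCircuit_le _ _ _ _ _ _).trans (by norm_num))
    · exact Or.inl ⟨i, Or.inr rfl⟩
  have hlad : ∀ c ∈ ladderPieces p0 U,
      (∃ i, c = U i ∨ c = Circuit.inv (U i)) ∨ Circuit.tCount c ≤ 35 := by
    intro c hc
    simp only [ladderPieces, List.mem_append] at hc
    rcases hc with ((hc | hc) | hc) | hc <;> exact hstep _ _ _ _ c hc
  simp only [sparsityPieces, List.mem_append, List.mem_singleton, List.mem_map,
    List.mem_reverse] at hc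
  rcases hc with (hc | rfl) | ⟨d, hd, rfl⟩
  · exact hlad c hc
  · exact Or.inr tCount_validateCircuit.le
  · rcases hlad d hd with ⟨i, rfl | rfl⟩ | h
    · exact Or.inl ⟨i, Or.inr rfl⟩
    · exact Or.inl ⟨i, Or.inl (Circuit.inv_inv _)⟩
    · exact Or.inr ((Circuit.tCount_inv _).trans_le h)

end

section

/-! ### The block encoding -/

variable {n kh kl lam m : ℕ}

/-- All ancillas that the amplitude oracle writes to are `0`. -/
structure Blank (x : Wire n kh kl lam m → Bool) : Prop where
  work : WorkClean x
  cells : CellsClean x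
  word : ∀ b, x (.inl (.word b)) = false
  sample : ∀ b, x (.inl (.sample b)) = false
  amp : x (.inl .amp) = false

section Amplitude

variable {p0 : Fin n} {i0 : Fin lam} {μ : Fin 4 → Address (kh + 1) kl → Fin n}
  {U : Fin 4 → Circuit (Wire n (kh + 1) kl lam m)}
  {data : (Fin (kh + 1) → Bool) → Fin lam → Word m}
  {C : Oracles n (kh + 1) kl lam m (m + 2 + 6)}

/-- If the amplitude qubit and the sampling register end up in `0`, then the amplitude oracle has
multiplied the state by the number represented by the data word. -/
theorem sparsity_amplitude_apply (hkh : kh + 1 ≤ m + 1) (hkl : kl ≤ m + 1) (hi0 : i0.val = 0)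
    (hU : ∀ i, ActsAsSwapUp p0 (μ i) (U i)) (hsel : C.select = selectCircuit data)
    (hswap : C.swap = swapCircuit) (hsam : C.sampling = samplingCircuit)
    (hspa : C.sparsity = (sparsityPieces p0 U).flatten)
    (x y : Wire n (kh + 1) kl lam m → Bool) (hx : Blank x) (hv : x validWire = true)
    (hys : ∀ b, y (.inl (.sample b)) = false) (hya : y (.inl .amp) = false) :
    (Circuit.matrix C.sparsity *ᵥ (Circuit.matrix C.amplitude *ᵥ ket x)) y =
      ((lookedUp data i0 (address x)).value : ℂ) * (Circuit.matrix C.sparsity *ᵥ ket x) y := by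
  set x1 := xorWord x (lookedUp data i0 (address x)) with hx1
  have hlook := fun z hz hz' => sends_lookup (n := n) hkh hkl data i0 hi0 C hsel hswap z hz hz'
  have e1 : Sends C.lookup x x1 := hlook x hx.work.scratchClean hx.cells
  have hx1w : wordOf x1 = lookedUp data i0 (address x) := by
    funext b
    simp [wordOf, hx1, xorWord, hx.word]
  -- The second lookup clears the word, as sampling has not changed it.
  have e1' : Sends C.lookup x1 x := by
    refine (hlook x1 hx.work.scratchClean hx.cells).congr (funext fun q => ?_)
    have ha : address x1 = address x := rfl
    rcases q with (_ | _ | _ | b | _ | _ | _ | _) | p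
    case inl.word => rw [ha]; simp [hx1, xorWord]
    all_goals rfl
  have hsum : Circuit.matrix samplingCircuit *ᵥ ket x1 =
      ∑ z, Circuit.matrix samplingCircuit z x1 • ket z := by
    ext z
    rw [mulVec_ket]
    simp [ket_apply]
  rw [Oracles.amplitude, Circuit.append_mulVec, Circuit.append_mulVec, e1, hsam, hsum,
    Matrix.mulVec_sum, Matrix.mulVec_sum, Finset.sum_apply, Finset.sum_eq_single x1]
  · rw [Matrix.mulVec_smul, e1', Matrix.mulVec_smul, Pi.smul_apply, smul_eq_mul,
      samplingCircuit_apply_of_eq x1 x1 hx.work.scratchClean hx.sample hx.amp fun _ _ => rfl,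
      if_neg (by rw [show x1 (.inl .amp) = x (.inl .amp) from rfl, hx.amp]; simp), hx1w]
  · intro z _ hz
    rw [Matrix.mulVec_smul, Matrix.mulVec_smul, Pi.smul_apply, smul_eq_mul]
    by_cases hagree : ∃ q, z q ≠ x1 q ∧ q ≠ .inl .amp ∧ ∀ b, q ≠ .inl (.sample b)
    · rw [samplingCircuit_apply_eq_zero x1 z hx.work.scratchClean hx.sample hx.amp hagree, zero_mul]
    · have hag : ∀ q, q ≠ .inl .amp → (∀ b, q ≠ .inl (.sample b)) → z q = x1 q := by
        intro q h1 h2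
        by_contra h
        exact hagree ⟨q, h, h1, h2⟩
      have hzw : WorkClean z := fun i => (hag _ (by simp) (by simp)).trans (hx.work i)
      have hzc : CellsClean z := fun i b => (hag _ (by simp) (by simp)).trans (hx.cells i b)
      rw [hlook z hzw.scratchClean hzc]
      set z' := xorWord z (lookedUp data i0 (address z)) with hz'
      have hzv : z' validWire = true := (hag _ (by simp) (by simp)).trans hv
      have e2 := sparsityPieces_mulVec_ket hU z' hzw hzc hzv
      -- The sparsity oracle leaves the sampling register and the amplitude qubit as they are, so
      -- that no outcome of the sampling other than `x1` reaches `y`.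
      have hframe : ∃ (c : ℂ) (w : Wire n (kh + 1) kl lam m → Bool),
          Circuit.matrix C.sparsity *ᵥ ket z' = c • ket w ∧
            ∀ q, q ≠ Ancilla.valid → w (.inl q) = z' (.inl q) := by
        rw [hspa, e2]
        split_ifs
        · refine ⟨_, _, rfl, fun q hq => ?_⟩
          simp [setOccupation, hq]
        · exact ⟨1, z', (one_smul _ _).symm, fun _ _ => rfl⟩
      obtain ⟨c, w, hw, hwq⟩ := hframe
      rw [hw, Pi.smul_apply, ket_apply, if_neg, smul_zero, mul_zero]
      rintro rfl
      refine hz (funext fun q => ?_)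
      by_cases h1 : q = .inl .amp
      · subst h1
        have := hwq .amp (by simp)
        rw [hya] at this
        exact this.symm.trans hx.amp.symm
      · by_cases h2 : ∀ b, q ≠ .inl (.sample b)
        · exact hag q h1 h2
        · push Not at h2
          obtain ⟨b, rfl⟩ := h2
          have := hwq (.sample b) (by simp)
          rw [hys] at this
          exact this.symm.trans (hx.sample b).symm
  · simp

/-- The wires of the index register. -/
def indexWire : Fin (kh + 1) ⊕ Fin kl → Wire n (kh + 1) kl lam m :=
  Sum.elim (fun i => .inl (.hi i)) fun i => .inl (.lo i)

theorem indexWire_injective :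
    Function.Injective (indexWire : _ → Wire n (kh + 1) kl lam m) := by
  rintro (i | i) (j | j) h <;> simp [indexWire] at h ⊢ <;> exact h

theorem diffusion_eq : Oracles.diffusion n (kh + 1) kl lam m (m + 2 + 6) =
    ((((List.finRange (kh + 1)).map fun i => .inl (.hi i)) ++
      (List.finRange kl).map fun i => .inl (.lo i) : List (Wire n (kh + 1) kl lam m))).map
        Gate.hadamard := by
  simp [Oracles.diffusion, Function.comp_def]

open Classical in
/-- The matrix entries of the block of the complete circuit in which all ancillas are `0`. -/
theorem circuit_apply (hkh : kh + 1 ≤ m + 1) (hkl : kl ≤ m + 1) (hi0 : i0.val = 0)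
    (hU : ∀ i, ActsAsSwapUp p0 (μ i) (U i)) (hsel : C.select = selectCircuit data)
    (hswap : C.swap = swapCircuit) (hsam : C.sampling = samplingCircuit)
    (hspa : C.sparsity = (sparsityPieces p0 U).flatten) (i j : Fin n → Bool) :
    Circuit.matrix C.circuit (Sum.elim (fun _ => false) i) (Sum.elim (fun _ => false) j) =
      1 / 2 ^ (kh + 1 + kl) * ∑ a : Address (kh + 1) kl, ((lookedUp data i0 a).value : ℂ) *
        (if Survives (a.1 0) (fun k => μ k a) j then
          pathSign (fun k => μ k a) j • ket (path (fun k => μ k a) j 4) else 0 :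
            (Fin n → Bool) → ℂ) i := by
  set qs : List (Wire n (kh + 1) kl lam m) := ((List.finRange (kh + 1)).map fun i => .inl (.hi i)) ++
      (List.finRange kl).map fun i => .inl (.lo i) with hqsdef
  have hqs : ∀ q, q ∈ qs ↔ ∃ i, indexWire i = q := by
    intro q
    simp [hqsdef, indexWire]
  have hnd : qs.Nodup := by
    refine List.Nodup.append ((List.nodup_finRange _).map ?_) ((List.nodup_finRange _).map ?_) ?_
    · intro a b h; simpa using h
    · intro a b h; simpa using h
    · intro q h1 h2
      obtain ⟨a, _, rfl⟩ := List.mem_map.1 h1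
      obtain ⟨b, _, hb⟩ := List.mem_map.1 h2
      simp at hb
  have hlen : qs.length = kh + 1 + kl := by simp [hqsdef]
  set x0 : Wire n (kh + 1) kl lam m → Bool := Sum.elim (fun _ => false) j with hx0
  set y0 : Wire n (kh + 1) kl lam m → Bool := Sum.elim (fun _ => false) i with hy0
  obtain ⟨xb, hxb⟩ : ∃ xb, xb = Function.update x0 validWire true := ⟨_, rfl⟩
  have hxb0 : ∀ q, q ≠ Ancilla.valid → xb (.inl q) = false := fun q hq => by
    rw [hxb, Function.update_of_ne (by simpa using hq)]
    rfl
  have hxb1 : ∀ p, xb (.inr p) = j p := fun p => by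
    rw [hxb, Function.update_of_ne (by simp)]
    rfl
  have hX : Sends (Circuit.pauliX validWire) x0 xb := hxb ▸ sends_pauliX _ _
  have hqout : ∀ q : Wire n (kh + 1) kl lam m, (∀ i, indexWire i ≠ q) →
      ∀ (s : Fin (kh + 1) ⊕ Fin kl → Bool) (z : Wire n (kh + 1) kl lam m → Bool),
      Function.extend indexWire s z q = z q := fun q hq s z =>
    Function.extend_apply' _ _ _ (by simpa using hq)
  have hxbq : ∀ q ∈ qs, xb q = false := by
    intro q hq
    obtain ⟨k, rfl⟩ := (hqs q).1 hq
    rcases k with k | k <;> exact hxb0 _ (by simp)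
  have hy0q : ∀ q ∈ qs, y0 q = false := by
    intro q hq
    obtain ⟨k, rfl⟩ := (hqs q).1 hq
    rcases k with k | k <;> simp [hy0, indexWire]
  have hxs : ∀ s : Fin (kh + 1) ⊕ Fin kl → Bool, Blank (Function.extend indexWire s xb) := by
    intro s
    constructor
    · intro b; rw [hqout _ (by simp [indexWire])]; exact hxb0 _ (by simp)
    · intro a b; rw [hqout _ (by simp [indexWire])]; exact hxb0 _ (by simp)
    · intro b; rw [hqout _ (by simp [indexWire])]; exact hxb0 _ (by simp)
    · intro b; rw [hqout _ (by simp [indexWire])]; exact hxb0 _ (by simp)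
    · rw [hqout _ (by simp [indexWire])]; exact hxb0 _ (by simp)
  have hxv : ∀ s : Fin (kh + 1) ⊕ Fin kl → Bool,
      Function.extend indexWire s xb validWire = true := by
    intro s
    rw [hqout _ (by simp [indexWire])]; simp [hxb]
  have hxa : ∀ s : Fin (kh + 1) ⊕ Fin kl → Bool,
      address (Function.extend indexWire s xb) = (fun k => s (.inl k), fun k => s (.inr k)) := by
    intro s
    refine Prod.ext (funext fun k => ?_) (funext fun k => ?_)
    · exact indexWire_injective.extend_apply s xb (.inl k)
    · exact indexWire_injective.extend_apply s xb (.inr k)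
  have hxo : ∀ s : Fin (kh + 1) ⊕ Fin kl → Bool,
      occupation (Function.extend indexWire s xb) = j := by
    intro s
    funext p
    rw [occupation, hqout _ (by simp [indexWire])]
    exact hxb1 p
  -- The final index and occupation numbers must match, and the validation qubit must be cleared.
  have hfin : ∀ s s' : Fin (kh + 1) ⊕ Fin kl → Bool, ∀ v : Fin n → Bool,
      Function.extend indexWire s' y0 = setOccupation
        (Function.update (Function.extend indexWire s xb) validWire false) v ↔ s' = s ∧ i = v := by
    intro s s' v
    constructor
    · intro h
      constructor
      · funext k
        have := congrFun h (indexWire k)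
        rw [indexWire_injective.extend_apply] at this
        rw [this, ← indexWire_injective.extend_apply s xb k]
        rcases k with k | k <;> simp [indexWire, setOccupation]
      · funext p
        have := congrFun h (.inr p)
        rw [hqout _ (by simp [indexWire])] at this
        simpa [hy0, setOccupation] using this
    · rintro ⟨rfl, rfl⟩
      funext q
      rcases q with q | p
      · simp only [setOccupation, Sum.elim_inl]
        by_cases hqv : q = .valid
        · subst hqv
          rw [hqout _ (by simp [indexWire]), Function.update_self]
          simp [hy0]
        · rw [Function.update_of_ne (by simpa using hqv)]
          by_cases hk : ∃ k, indexWire k = (.inl q : Wire n (kh + 1) kl lam m)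
          · obtain ⟨k, hk⟩ := hk
            rw [← hk, indexWire_injective.extend_apply, indexWire_injective.extend_apply]
          · push Not at hk
            rw [hqout _ hk, hqout _ hk, hxb0 q hqv]
            simp [hy0]
      · rw [hqout _ (by simp [indexWire])]
        simp [hy0, setOccupation]
  have hterm : ∀ s s' : Fin (kh + 1) ⊕ Fin kl → Bool,
      (Circuit.matrix C.sparsity *ᵥ (Circuit.matrix C.amplitude *ᵥ
        ket (Function.extend indexWire s xb))) (Function.extend indexWire s' y0) =
      if s' = s then
        ((lookedUp data i0 (fun k => s (.inl k), fun k => s (.inr k))).value : ℂ) *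
        (if Survives (s (.inl 0)) (fun k => μ k (fun k => s (.inl k), fun k => s (.inr k))) j then
          pathSign (fun k => μ k (fun k => s (.inl k), fun k => s (.inr k))) j •
            ket (path (fun k => μ k (fun k => s (.inl k), fun k => s (.inr k))) j 4) else 0 :
            (Fin n → Bool) → ℂ) i else 0 := by
    intro s s'
    rw [sparsity_amplitude_apply hkh hkl hi0 hU hsel hswap hsam hspa _ _ (hxs s) (hxv s), hspa,
      sparsityPieces_mulVec_ket hU _ (hxs s).work (hxs s).cells (hxv s), hxa, hxo]
    · split_ifs with h1 h2 h2
      · congr 1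
        rw [Pi.smul_apply, Pi.smul_apply, ket_apply, ket_apply]
        simp only [hfin, h2, true_and]
      · rw [Pi.smul_apply, ket_apply, if_neg (fun h => h2 ((hfin _ _ _).1 h).1)]
        simp
      · rw [ket_apply, if_neg]
        · simp
        · intro h
          have := congrFun h validWire
          rw [hxv, hqout _ (by simp [indexWire])] at this
          simp [hy0] at this
      · rw [ket_apply, if_neg]
        · simp
        · intro h
          have := congrFun h validWire
          rw [hxv, hqout _ (by simp [indexWire])] at this
          simp [hy0] at this
    · intro b; rw [hqout _ (by simp [indexWire])]; simp [hy0]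
    · rw [hqout _ (by simp [indexWire])]; simp [hy0]
  rw [← mulVec_ket (Circuit.matrix C.circuit), Oracles.circuit, Circuit.append_mulVec,
    Circuit.append_mulVec, Circuit.append_mulVec, Circuit.append_mulVec, hX, diffusion_eq,
    hadamardLayer_mulVec_ket indexWire_injective hqs hnd xb hxbq,
    hadamardLayer_mulVec_apply indexWire_injective hqs hnd y0 hy0q, hlen]
  simp only [Matrix.mulVec_smul, Matrix.mulVec_sum, Pi.smul_apply, Finset.sum_apply, hterm,
    smul_eq_mul, Finset.sum_ite_eq, Finset.mem_univ, if_true]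
  rw [← Finset.mul_sum, ← mul_assoc, layerCoeff_mul_self,
    ← (Equiv.sumArrowEquivProdArrow (Fin (kh + 1)) (Fin kl) Bool).sum_comp]
  rfl

/-- The block is `2 ^ (-k)` times the sum of the monomials with the represented numbers as
coefficients. The monomials have norm at most `1`, so that the errors `ε / card S` add up to `ε`. -/
theorem isBlockEncoding_circuit (hkh : kh + 1 ≤ m + 1) (hkl : kl ≤ m + 1) (hi0 : i0.val = 0)
    (hU : ∀ i, ActsAsSwapUp p0 (μ i) (U i)) (hsel : C.select = selectCircuit data)
    (hswap : C.swap = swapCircuit) (hsam : C.sampling = samplingCircuit)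
    (hspa : C.sparsity = (sparsityPieces p0 U).flatten)
    {S : Finset (Term n)} {addr : Term n → Address (kh + 1) kl} {h : Term n → ℝ} {α ε : ℝ}
    (hα : 0 < α) (hε : 0 ≤ ε) (haddr : Set.InjOn addr S)
    (htwo : ∀ t ∈ S, (addr t).1 0 = t.isTwo) (hμ : ∀ t ∈ S, ∀ i, μ i (addr t) = t.mode i)
    (hzero : ∀ a, (∀ t ∈ S, addr t ≠ a) → (lookedUp data i0 a).value = 0)
    (happrox : ∀ t ∈ S, |h t - α / 2 ^ (kh + 1 + kl) * (lookedUp data i0 (addr t)).value| ≤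
      ε / S.card) :
    IsBlockEncoding α ε (hamiltonian S h) (Circuit.matrix C.circuit) := by
  classical
  refine ⟨hα, Circuit.matrix_mem_unitaryGroup _, ?_⟩
  have hsub : hamiltonian S h - (α : ℂ) • (Circuit.matrix C.circuit).submatrix
      (Sum.elim fun _ => false) (Sum.elim fun _ => false) =
      ∑ t ∈ S, ((h t - α / 2 ^ (kh + 1 + kl) * (lookedUp data i0 (addr t)).value : ℝ) : ℂ) •
        t.monomial := by
    ext i j
    rw [Matrix.sub_apply, Matrix.smul_apply, Matrix.submatrix_apply,
      circuit_apply hkh hkl hi0 hU hsel hswap hsam hspa, hamiltonian, Matrix.sum_apply,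
      Matrix.sum_apply]
    have hS : ∑ a : Address (kh + 1) kl, ((lookedUp data i0 a).value : ℂ) *
        (if Survives (a.1 0) (fun k => μ k a) j then
          pathSign (fun k => μ k a) j • ket (path (fun k => μ k a) j 4) else 0 :
            (Fin n → Bool) → ℂ) i =
        ∑ t ∈ S, ((lookedUp data i0 (addr t)).value : ℂ) * t.monomial i j := by
      rw [← Finset.sum_subset (Finset.subset_univ (S.image addr)), Finset.sum_image haddr]
      · refine Finset.sum_congr rfl fun t ht => ?_
        rw [← mulVec_ket t.monomial, t.monomial_mulVec_ket, htwo t ht,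
          show (fun k => μ k (addr t)) = t.mode from funext fun k => hμ t ht k]
      · intro a _ ha
        rw [hzero a fun t ht h => ha (Finset.mem_image.2 ⟨t, ht, h⟩)]
        simp
    rw [hS, smul_eq_mul, ← mul_assoc, Finset.mul_sum, ← Finset.sum_sub_distrib]
    refine Finset.sum_congr rfl fun t _ => ?_
    simp only [Matrix.smul_apply, smul_eq_mul]
    push_cast
    ring
  rw [hsub]
  have hcard : ∀ t ∈ S, ‖((h t - α / 2 ^ (kh + 1 + kl) * (lookedUp data i0 (addr t)).value : ℝ) : ℂ) •
        t.monomial‖ ≤ ε / S.card := by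
    intro t ht
    rw [norm_smul, Complex.norm_real, Real.norm_eq_abs]
    calc _ ≤ ε / S.card * 1 := mul_le_mul (happrox t ht) t.norm_monomial_le (norm_nonneg _)
          (by positivity)
      _ = _ := mul_one _
  refine (norm_sum_le _ _).trans ((Finset.sum_le_sum hcard).trans ?_)
  rw [Finset.sum_const, nsmul_eq_mul]
  rcases Nat.eq_zero_or_pos S.card with h0 | h0
  · simp [h0, hε]
  · have : (0 : ℝ) < S.card := by exact_mod_cast h0
    rw [mul_div_cancel₀ _ this.ne']

end Amplitude

end

section

/-! ### Data words, indices and mode codes -/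

variable {n kh kl lam m : ℕ}

/-- Rounding down the magnitude gives a data word for a number of absolute value at most `β / 2`,
with an error of at most one unit in the last place. -/
theorem exists_word_abs_sub_le (m : ℕ) {β x : ℝ} (hβ : 0 < β) (hx : |x| ≤ β / 2) :
    ∃ b : Word m, |x - β * b.value| ≤ β / 2 ^ m := by
  have hp : (0 : ℝ) < 2 ^ m := by positivity
  set y := |x| * 2 ^ m / β with hy
  have hy0 : 0 ≤ y := by positivity
  set v := ⌊y⌋₊ with hv
  have hyl : y < 2 ^ m := by
    rw [hy, div_lt_iff₀ hβ, mul_comm]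
    nlinarith
  have hvl : v < 2 ^ m := by
    rw [hv, Nat.floor_lt hy0]
    exact_mod_cast hyl
  have h1 : (v : ℝ) ≤ y := Nat.floor_le hy0
  have h2 : y < v + 1 := Nat.lt_floor_add_one y
  set b : Word m := Fin.cons (decide (x < 0)) (fun i : Fin m => v.testBit i) with hb
  have hbv : b.value = b.sign * v / 2 ^ m := by
    rw [Word.value, show (fun i : Fin m => b i.succ) = fun i : Fin m => v.testBit i from rfl,
      Nat.ofBits_testBit, Nat.mod_eq_of_lt hvl]
  have hbs : b.sign * |x| = x ∧ |b.sign| = 1 := by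
    by_cases h : x < 0
    · have : b.sign = -1 := by simp [Word.sign, hb, h]
      rw [this, abs_of_neg h]; simp
    · have : b.sign = 1 := by simp [Word.sign, hb, h]
      rw [this, abs_of_nonneg (not_lt.1 h)]; simp
  refine ⟨b, ?_⟩
  have hxy : |x| = β * y / 2 ^ m := by rw [hy]; field_simp
  have : x - β * b.value = b.sign * (β / 2 ^ m * (y - v)) := by
    rw [hbv]
    nth_rewrite 1 [← hbs.1]
    rw [hxy]; ring
  rw [this, abs_mul, hbs.2, one_mul, abs_of_nonneg (by have := sub_nonneg.2 h1; positivity)]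
  have hq : 0 < β / 2 ^ m := by positivity
  nlinarith

theorem ofBits_injective : Function.Injective (Nat.ofBits : (Fin kl → Bool) → ℕ) := by
  intro f g h
  funext i
  have := congrArg (fun v => v.testBit i) h
  simpa [Nat.testBit_ofBits] using this

/-- Words for the monomials of `S` can be stored at their indices, with zeros elsewhere. -/
theorem exists_data {S : Finset (Term n)} {addr : Term n → Address kh kl}
    (haddr : Set.InjOn addr S) (hkl : 2 ^ kl ≤ lam) (i0 : Fin lam) (hi0 : i0.val = 0)
    (word : Term n → Word m) :
    ∃ data : (Fin kh → Bool) → Fin lam → Word m,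
      (∀ t ∈ S, lookedUp data i0 (addr t) = word t) ∧
      ∀ a : Address kh kl, (∀ t ∈ S, addr t ≠ a) → lookedUp data i0 a = fun _ => false := by
  classical
  have hlt : ∀ l : Fin kl → Bool, Nat.ofBits l < lam := fun l =>
    (Nat.ofBits_lt_two_pow l).trans_le hkl
  have hval : ∀ l : Fin kl → Bool, (wordSwap lam l i0).val = Nat.ofBits l := fun l =>
    wordSwap_val l i0 hi0 (hlt l)
  have hinj : ∀ l l' : Fin kl → Bool, (wordSwap lam l i0).val = (wordSwap lam l' i0).val →
      l = l' := by
    intro l l' h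
    rw [hval, hval] at h
    exact ofBits_injective h
  have hkey : ∀ (a : Address kh kl) t, (addr t).1 = a.1 ∧
      wordSwap lam (addr t).2 i0 = wordSwap lam a.2 i0 ↔ addr t = a := by
    intro a t
    constructor
    · rintro ⟨h1, h2⟩
      exact Prod.ext h1 (hinj _ _ (congrArg Fin.val h2))
    · rintro rfl
      exact ⟨rfl, rfl⟩
  refine ⟨fun g i => if h : ∃ t ∈ S, (addr t).1 = g ∧ wordSwap lam (addr t).2 i0 = i then
    word h.choose else fun _ => false, ?_, ?_⟩
  · intro t ht
    have h : ∃ t' ∈ S, (addr t').1 = (addr t).1 ∧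
      wordSwap lam (addr t').2 i0 = wordSwap lam (addr t).2 i0 := ⟨t, ht, rfl, rfl⟩
    rw [lookedUp, dif_pos h]
    congr 1
    exact haddr h.choose_spec.1 ht ((hkey _ _).1 h.choose_spec.2)
  · intro a ha
    rw [lookedUp, dif_neg]
    rintro ⟨t, ht, h⟩
    exact ha t ht ((hkey _ _).1 h)

/-- An injective indexing of `S` whose leading bit marks the two-body monomials. -/
theorem exists_addr (S : Finset (Term n)) (hcard : S.card ≤ 2 ^ kh * 2 ^ kl) :
    ∃ addr : Term n → Address (kh + 1) kl, Set.InjOn addr S ∧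
      ∀ t, (addr t).1 0 = t.isTwo := by
  classical
  have : Nonempty (S ↪ (Fin kh → Bool) × (Fin kl → Bool)) := by
    rw [Function.Embedding.nonempty_iff_card_le]
    simpa using hcard
  obtain ⟨f⟩ := this
  set ι : Term n → (Fin kh → Bool) × (Fin kl → Bool) := fun t =>
    if h : t ∈ S then f ⟨t, h⟩ else (fun _ => false, fun _ => false) with hι
  refine ⟨fun t => (Fin.cons t.isTwo (ι t).1, (ι t).2), ?_, fun t => rfl⟩
  intro t ht t' ht' h
  simp only [Prod.mk.injEq, Fin.cons_inj] at h
  have h2 : ι t = ι t' := Prod.ext h.1.2 h.2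
  simp only [hι, dif_pos (Finset.mem_coe.1 ht), dif_pos (Finset.mem_coe.1 ht')] at h2
  simpa using f.injective h2

theorem two_pow_clog_le {x : ℕ} (hx : 1 ≤ x) : 2 ^ Nat.clog 2 x ≤ 2 * x := by
  rcases Nat.lt_or_ge 1 x with h | h
  · have h1 := Nat.pow_pred_clog_lt_self (b := 2) (by norm_num) h
    have h2 : 0 < Nat.clog 2 x := Nat.clog_pos (by norm_num) h
    have : 2 ^ Nat.clog 2 x = 2 ^ (Nat.clog 2 x).pred * 2 := by
      rw [← pow_succ]; congr 1; exact (Nat.succ_pred_eq_of_pos h2).symm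
    omega
  · have : x = 1 := by omega
    subst this; simp

/-- Only the modes that occur in `S` need a code, so that codes of `log₂ (card S)` bits suffice. -/
theorem exists_code (S : Finset (Term n)) (p0 : Fin n) (f : Term n → Fin n) {k : ℕ}
    (hk : k = min (Nat.clog 2 n) (Nat.clog 2 S.card)) :
    ∃ (code : Fin n → Fin k → Bool) (dec : (Fin k → Bool) → Fin n),
      ∀ t ∈ S, dec (code (f t)) = f t := by
  classical
  have : Nonempty (Fin n) := ⟨p0⟩
  have hcard : (S.image f).card ≤ 2 ^ k := by
    rcases le_total (Nat.clog 2 n) (Nat.clog 2 S.card) with h | h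
    · rw [hk, min_eq_left h]
      exact ((Finset.card_le_univ _).trans_eq (Fintype.card_fin n)).trans
        (Nat.le_pow_clog (by norm_num) _)
    · rw [hk, min_eq_right h]
      exact Finset.card_image_le.trans (Nat.le_pow_clog (by norm_num) _)
  have : Nonempty ((S.image f) ↪ (Fin k → Bool)) := by
    rw [Function.Embedding.nonempty_iff_card_le, Fintype.card_coe]
    simpa only [Fintype.card_fun, Fintype.card_bool, Fintype.card_fin] using hcard
  obtain ⟨e⟩ := this
  set code : Fin n → Fin k → Bool := fun p =>
    if h : p ∈ S.image f then e ⟨p, h⟩ else fun _ => false with hcode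
  have hinj : Set.InjOn code (S.image f) := by
    intro p hp q hq h
    simp only [hcode, dif_pos (Finset.mem_coe.1 hp), dif_pos (Finset.mem_coe.1 hq)] at h
    simpa using e.injective h
  exact ⟨code, Function.invFunOn code (S.image f), fun t ht =>
    hinj.leftInvOn_invFunOn (Finset.mem_coe.2 (Finset.mem_image_of_mem f ht))⟩

theorem card_ancilla_le (kh kl lam m w : ℕ) :
    Fintype.card (Ancilla kh kl lam m w) ≤ kh + kl + lam * (m + 1) + (m + 1) + m + 2 + w := by
  let g : Ancilla kh kl lam m w → Fin kh ⊕ Fin kl ⊕ (Fin lam × Fin (m + 1)) ⊕ Fin (m + 1) ⊕ Fin m ⊕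
      Fin 2 ⊕ Fin w := fun a => match a with
    | .hi i => .inl i
    | .lo i => .inr (.inl i)
    | .cell i b => .inr (.inr (.inl (i, b)))
    | .word b => .inr (.inr (.inr (.inl b)))
    | .sample b => .inr (.inr (.inr (.inr (.inl b))))
    | .amp => .inr (.inr (.inr (.inr (.inr (.inl 0)))))
    | .valid => .inr (.inr (.inr (.inr (.inr (.inl 1)))))
    | .work i => .inr (.inr (.inr (.inr (.inr (.inr i)))))
  have hg : Function.Injective g := by
    intro a b h
    cases a <;> cases b <;> simp_all [g]
  refine (Fintype.card_le_of_injective g hg).trans ?_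
  simp only [Fintype.card_sum, Fintype.card_prod, Fintype.card_fin]
  omega

/-! ### The circuit for given parameters -/

/-- For every number `lam` of words, all parts of the construction exist, with explicit constants
in the bounds. -/
theorem exists_oracles {K β ε : ℝ} (hK : 65 ≤ K) (hβ : 0 < β) (hε : 0 < ε) {S : Finset (Term n)}
    (hS : S.Nonempty) {h : Term n → ℝ} (hh : ∀ t ∈ S, |h t| ≤ β / 2) {m lam : ℕ}
    (hm : β * S.card / ε ≤ 2 ^ m) (hmS : S.card ≤ 2 ^ m) (hlam : 1 ≤ lam) (hlamS : lam ≤ S.card) :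
    ∃ (α : ℝ) (kh kl w : ℕ) (C : Oracles n kh kl lam m w),
      C.Encodes K S h α ε ∧ α ≤ 4 * β * S.card ∧
      (Fintype.card (Ancilla kh kl lam m w) : ℝ) ≤ 13 * (lam * (m + 1)) ∧
      (C.circuit.tCount : ℝ) ≤ 7616 * (n + ⌈(S.card : ℝ) / lam⌉₊ + lam * (m + 1)) := by
  classical
  obtain ⟨t0, ht0⟩ := hS
  have hL : 1 ≤ S.card := Finset.card_pos.2 ⟨t0, ht0⟩
  have hn : 0 < n := (t0.mode 0).pos
  set p0 : Fin n := ⟨0, hn⟩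
  set i0 : Fin lam := ⟨0, hlam⟩
  -- The index has `log₂ (card S)` bits, of which the low part addresses `2 ^ kl ≤ lam` words, plus a
  -- leading bit for the type of the monomial.
  set kl := Nat.log 2 lam with hkl
  set k0 := Nat.clog 2 S.card with hk0
  have hklk0 : kl ≤ k0 := (Nat.log_mono_right hlamS).trans (Nat.log_le_clog 2 _)
  set kh := k0 - kl with hkh
  have hk0m : k0 ≤ m := Nat.clog_le_of_le_pow hmS
  have hpow : 2 ^ kh * 2 ^ kl = 2 ^ k0 := by rw [← pow_add]; congr 1; omega
  have hklam : 2 ^ kl ≤ lam := Nat.pow_log_le_self 2 (by omega)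
  have hlamk : lam < 2 ^ (kl + 1) := Nat.lt_pow_succ_log_self (by norm_num) lam
  have hk0L : 2 ^ k0 ≤ 2 * S.card := two_pow_clog_le hL
  obtain ⟨addr, haddr, htwo⟩ := exists_addr (kh := kh) (kl := kl) S
    (hpow ▸ Nat.le_pow_clog (by norm_num) _)
  set k := min (Nat.clog 2 n) (Nat.clog 2 S.card) with hk
  have hkm : k ≤ m + 1 := (min_le_right _ _).trans (by omega)
  have hcode := fun i : Fin 4 => exists_code S p0 (fun t => t.mode i) hk
  choose code dec hdec using hcode
  -- The code of the `i`-th mode is padded to a data word, so that SWAP-UP can use the same lookup.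
  have hcodeData := fun i : Fin 4 => exists_data (m := m) haddr hklam i0 rfl fun t b =>
    if hb : b.val < k then code i (t.mode i) ⟨b, hb⟩ else false
  choose codeData hcodeData _ using hcodeData
  -- The factor `β` between coefficients and data words is `α / 2 ^ (kh + 1 + kl)`.
  have hw : ∀ t, ∃ b : Word m, t ∈ S → |h t - β * b.value| ≤ β / 2 ^ m := by
    intro t
    by_cases ht : t ∈ S
    · obtain ⟨b, hb⟩ := exists_word_abs_sub_le m hβ (hh t ht)
      exact ⟨b, fun _ => hb⟩
    · exact ⟨fun _ => false, fun h => absurd h ht⟩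
  choose word hword using hw
  obtain ⟨data, hdata, hdata0⟩ := exists_data haddr hklam i0 rfl word
  set U : Fin 4 → Circuit (Wire n (kh + 1) kl lam m) := fun i =>
    swapUp p0 i0 hkm (codeData i) (dec i) with hUdef
  set μ : Fin 4 → Address (kh + 1) kl → Fin n := fun i a =>
    dec i fun b => lookedUp (codeData i) i0 a (Fin.castLE hkm b) with hμdef
  have hkh1 : kh + 1 ≤ m + 1 := by omega
  have hkl1 : kl ≤ m + 1 := by omega
  have hμ : ∀ t ∈ S, ∀ i, μ i (addr t) = t.mode i := by
    intro t ht i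
    rw [← hdec i t ht, hμdef]
    simp only [hcodeData i t ht]
    congr 1
    funext b
    rw [dif_pos (show (Fin.castLE hkm b).val < k from b.2)]
    rfl
  have hU : ∀ i, ActsAsSwapUp p0 (μ i) (U i) := fun i x hx hc =>
    sends_swapUp hkh1 hkl1 p0 i0 hkm (codeData i) (dec i) x hx hc
  have hUup : ∀ i, IsSwapUp S addr (fun t => t.mode i) (U i) := fun i =>
    isSwapUp_swapUp hkh1 hkl1 p0 rfl i0 hkm (codeData i) (dec i) S addr _ fun t ht => hμ t ht i
  set C : Oracles n (kh + 1) kl lam m (m + 2 + 6) :=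
    ⟨selectCircuit data, swapCircuit, samplingCircuit, (sparsityPieces p0 U).flatten⟩ with hC
  set α := β * 2 ^ (kh + 1 + kl) with hα
  have hαdiv : α / 2 ^ (kh + 1 + kl) = β := by rw [hα]; field_simp
  have hLpos : (0 : ℝ) < S.card := by exact_mod_cast hL
  have hprec : β / 2 ^ m ≤ ε / S.card := by
    rw [div_le_iff₀ hε] at hm
    rw [div_le_div_iff₀ (by positivity) hLpos]
    linarith
  have happrox : ∀ t ∈ S, |h t - α / 2 ^ (kh + 1 + kl) * (lookedUp data i0 (addr t)).value| ≤
      ε / S.card := fun t ht => by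
    rw [hαdiv, hdata t ht]
    exact (hword t ht).trans hprec
  refine ⟨α, kh + 1, kl, m + 2 + 6, C, ⟨?_, addr, data, haddr, ?_, ?_, ?_, ?_, ?_, ?_⟩, ?_, ?_, ?_⟩
  · refine isBlockEncoding_circuit (i0 := i0) (data := data) hkh1 hkl1 rfl hU rfl rfl rfl rfl
      (by positivity) hε.le haddr (fun t _ => htwo t) hμ (fun a ha => ?_) happrox
    rw [hdata0 a ha, Word.value]
    have : Nat.ofBits (fun _ : Fin m => false) = 0 := by
      apply Nat.eq_of_testBit_eq
      simp [Nat.testBit_ofBits]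
    simp [this]
  · intro t ht
    refine ⟨wordSwap lam (addr t).2 i0, wordSwap_val _ i0 rfl
      ((Nat.ofBits_lt_two_pow _).trans_le hklam), happrox t ht⟩
  · exact fun x hx => sends_selectCircuit hkh1 data x hx.scratchClean
  · exact ⟨wordSwap lam, wordSwap_val, fun x hx => sends_swapCircuit hkl1 x hx.scratchClean⟩
  · exact isSampling_samplingCircuit
  · exact isSparsityOracle_sparsityPieces hU S addr (fun t _ => htwo t) hμ
  · refine ⟨sparsityPieces p0 U, rfl, ?_, fun c hc => ?_⟩
    · rw [length_sparsityPieces]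
      exact_mod_cast hK
    · rcases mem_sparsityPieces hc with ⟨i, rfl | rfl⟩ | hc
      · exact Or.inl ⟨fun t => t.mode i, fun t _ => t.mode_mem i, Or.inl (hUup i)⟩
      · exact Or.inl ⟨fun t => t.mode i, fun t _ => t.mode_mem i, Or.inr ⟨U i, hUup i, rfl⟩⟩
      · right
        have h1 : (Circuit.tCount c : ℝ) ≤ 35 := by exact_mod_cast hc
        have h2 : (0 : ℝ) ≤ m := Nat.cast_nonneg m
        nlinarith
  · have h1 : (2 : ℝ) ^ (kh + 1 + kl) ≤ 4 * S.card := by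
      have : 2 ^ (kh + 1 + kl) ≤ 4 * S.card := by
        have : 2 ^ (kh + 1 + kl) = 2 * (2 ^ kh * 2 ^ kl) := by ring
        omega
      exact_mod_cast this
    calc α ≤ β * (4 * S.card) := by rw [hα]; gcongr
      _ = 4 * β * S.card := by ring
  · have h1 := card_ancilla_le (kh + 1) kl lam m (m + 2 + 6)
    have h2 : m + 1 ≤ lam * (m + 1) := Nat.le_mul_of_pos_left _ hlam
    have h3 : Fintype.card (Ancilla (kh + 1) kl lam m (m + 2 + 6)) ≤ 13 * (lam * (m + 1)) := by
      omega
    exact_mod_cast h3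
  · have hT := fun i => tCount_swapUp_le (kl := kl) p0 i0 hkm (codeData i) (dec i)
    have h1 := tCount_sparsityPieces_le p0 U _ hT
    have h2 := tCount_lookup_le data C rfl rfl
    have h3 := tCount_samplingCircuit_le (n := n) (kh := kh + 1) (kl := kl) (lam := lam) (m := m)
    have h4 : Circuit.tCount (Oracles.diffusion n (kh + 1) kl lam m (m + 2 + 6)) = 0 := by
      rw [diffusion_eq, tCount_hadamardLayer]
    have hC1 : C.circuit.tCount = 2 * C.lookup.tCount +
        Circuit.tCount (samplingCircuit : Circuit (Wire n (kh + 1) kl lam m)) +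
        Circuit.tCount (sparsityPieces p0 U).flatten := by
      rw [Oracles.circuit, Oracles.amplitude]
      simp only [Circuit.tCount_append, h4]
      rw [show Circuit.tCount (Circuit.pauliX (.inl .valid : Wire n (kh + 1) kl lam m)) = 0 from rfl]
      simp only [hC]
      ring
    have hw : 2 ^ kl * (m + 1) ≤ lam * (m + 1) := Nat.mul_le_mul_right _ hklam
    have hkn : 2 ^ k ≤ 2 * n :=
      (Nat.pow_le_pow_right (by norm_num) (min_le_left _ _)).trans (two_pow_clog_le hn)
    have h2' : m + 1 ≤ lam * (m + 1) := Nat.le_mul_of_pos_left _ hlam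
    -- The number of groups of words is `O(card S / lam)`, as `lam < 2 ^ (kl + 1)`.
    have hceil : 2 ^ (kh + 1) ≤ 8 * ⌈(S.card : ℝ) / lam⌉₊ := by
      have hle : 2 ^ (kh + 1) * lam ≤ 8 * S.card := by
        calc 2 ^ (kh + 1) * lam ≤ 2 ^ (kh + 1) * 2 ^ (kl + 1) := Nat.mul_le_mul_left _ hlamk.le
          _ = 4 * (2 ^ kh * 2 ^ kl) := by ring
          _ ≤ 8 * S.card := by rw [hpow]; omega
      have hlampos : (0 : ℝ) < lam := by exact_mod_cast hlam
      have hle' : ((2 ^ (kh + 1) : ℕ) : ℝ) ≤ 8 * ((S.card : ℝ) / lam) := by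
        rw [← mul_div_assoc, le_div_iff₀ hlampos]
        exact_mod_cast hle
      have := Nat.le_ceil ((S.card : ℝ) / lam)
      have h' : ((2 ^ (kh + 1) : ℕ) : ℝ) ≤ 8 * (⌈(S.card : ℝ) / lam⌉₊ : ℝ) := by linarith
      exact_mod_cast h'
    have htot : C.circuit.tCount ≤ 7616 * (n + ⌈(S.card : ℝ) / lam⌉₊ + lam * (m + 1)) := by
      rw [hC1]
      omega
    exact_mod_cast htot

/-! ### The word length and the number of words -/

/-- The number of magnitude bits of a data word, such that the rounding error `β / 2 ^ m` of a
coefficient is at most `ε / L`. -/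
def magnitudeBits (β : ℝ) (L : ℕ) (ε : ℝ) : ℕ := ⌈Real.logb 2 (β * L / ε)⌉₊

theorem le_two_pow_magnitudeBits {β ε : ℝ} {L : ℕ} (hβ : 0 < β) (hL : 1 ≤ L) (hε : 0 < ε) :
    β * L / ε ≤ 2 ^ magnitudeBits β L ε := by
  have hL' : (0 : ℝ) < L := by exact_mod_cast hL
  have hpos : 0 < β * L / ε := by positivity
  rw [← Real.rpow_natCast, ← Real.logb_le_iff_le_rpow (by norm_num) hpos]
  exact Nat.le_ceil _

theorem one_le_logb {ε : ℝ} {L : ℕ} (hL : 1 ≤ L) (hε : 0 < ε) (hε2 : ε ≤ 1 / 2) :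
    1 ≤ Real.logb 2 (L / ε) := by
  have hL' : (1 : ℝ) ≤ L := by exact_mod_cast hL
  rw [Real.le_logb_iff_rpow_le (by norm_num) (by positivity), Real.rpow_one, le_div_iff₀ hε]
  linarith

theorem magnitudeBits_add_one_le {β ε : ℝ} {L : ℕ} (hβ : 2 ≤ β) (hL : 1 ≤ L) (hε : 0 < ε)
    (hε2 : ε ≤ 1 / 2) :
    (magnitudeBits β L ε : ℝ) + 1 ≤ (Real.logb 2 β + 3) * Real.logb 2 (L / ε) := by
  have hL' : (0 : ℝ) < L := by exact_mod_cast hL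
  have h1 := one_le_logb hL hε hε2
  have h2 : 0 ≤ Real.logb 2 β := Real.logb_nonneg (by norm_num) (by linarith)
  have h3 : Real.logb 2 (β * L / ε) = Real.logb 2 β + Real.logb 2 (L / ε) := by
    rw [mul_div_assoc, Real.logb_mul (by positivity) (by positivity)]
  have h4 := Nat.ceil_lt_add_one (a := Real.logb 2 (β * L / ε)) (by rw [h3]; positivity)
  rw [magnitudeBits]
  rw [h3] at h4 ⊢
  nlinarith

/-- The choice of `lam` that balances the cost `L / lam` of SELECT and the cost `lam * mb` of SWAP.
If words are longer than `L`, then a single word is best, and `mb` is bounded by assumption. -/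
theorem exists_lam {L n mb : ℕ} {c : ℝ} (hL : 1 ≤ L) (hmb : 1 ≤ mb) (hc : 0 ≤ c)
    (h : (mb : ℝ) ≤ c * (n + L)) :
    ∃ lam : ℕ, 1 ≤ lam ∧ lam ≤ L ∧
      (n + ⌈(L : ℝ) / lam⌉₊ + lam * mb : ℝ) ≤ (c + 4) * (n + √(L * mb)) := by
  have hL' : (1 : ℝ) ≤ L := by exact_mod_cast hL
  have hmb' : (1 : ℝ) ≤ mb := by exact_mod_cast hmb
  have hn : (0 : ℝ) ≤ n := Nat.cast_nonneg n
  set s := √((L : ℝ) * mb) with hs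
  have hss : s * s = L * mb := Real.mul_self_sqrt (by positivity)
  have hs1 : 1 ≤ s := by
    rw [hs, Real.one_le_sqrt]; nlinarith
  rcases le_or_gt mb L with hle | hlt
  · have hle' : (mb : ℝ) ≤ L := by exact_mod_cast hle
    have hms : (mb : ℝ) ≤ s := by
      rw [hs]; apply Real.le_sqrt_of_sq_le; nlinarith
    -- Here `lam = ⌈√(L / mb)⌉`, which is at most `L` because `√(L * mb) ≤ L * mb`.
    set r := s / mb with hr
    have hr0 : 0 < r := by positivity
    have hrm : r * mb = s := by rw [hr]; field_simp
    have hrs : r * s = L := by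
      have : r * s * mb = L * mb := by rw [← hss]; rw [← hrm]; ring
      exact mul_right_cancel₀ (by positivity) this
    have hrL : r ≤ L := by nlinarith
    have hlam1 : 1 ≤ ⌈r⌉₊ := Nat.ceil_pos.2 hr0
    refine ⟨⌈r⌉₊, hlam1, Nat.ceil_le.2 hrL, ?_⟩
    have h1 : r ≤ ⌈r⌉₊ := Nat.le_ceil r
    have h2 : (⌈r⌉₊ : ℝ) < r + 1 := Nat.ceil_lt_add_one hr0.le
    have h3 : (L : ℝ) / ⌈r⌉₊ ≤ s := by
      rw [div_le_iff₀ (by linarith)]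
      nlinarith
    have h4 : (⌈(L : ℝ) / ⌈r⌉₊⌉₊ : ℝ) < L / ⌈r⌉₊ + 1 := Nat.ceil_lt_add_one (by positivity)
    have h5 : (⌈r⌉₊ : ℝ) * mb ≤ s + mb := by nlinarith
    have h6 : 0 ≤ c * (n + s) := by positivity
    nlinarith
  · have hlt' : (L : ℝ) ≤ mb := by exact_mod_cast hlt.le
    have hLs : (L : ℝ) ≤ s := by
      rw [hs]; apply Real.le_sqrt_of_sq_le; nlinarith
    -- Now `lam * mb = mb ≤ c * (n + L)` and `L ≤ √(L * mb)`.
    refine ⟨1, le_rfl, hL, ?_⟩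
    have h1 : ⌈(L : ℝ) / (1 : ℕ)⌉₊ = L := by simp
    rw [h1]
    push_cast
    have h2 : c * (n + L) ≤ c * (n + s) := by gcongr
    nlinarith

end

end FermionEncoding

end

theorem mainTheorem1 (B : ℝ) :
    ∃ (K : ℝ) (m : ℕ → ℝ → ℕ), 0 < K ∧
      (∀ (L : ℕ) (ε : ℝ), 1 ≤ L → 0 < ε → ε ≤ 1 / 2 →
        (m L ε : ℝ) + 1 ≤ K * Real.logb 2 (L / ε)) ∧
      ∀ (n : ℕ) (S : Finset (FermionEncoding.Term n)) (h : FermionEncoding.Term n → ℝ)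
        (ε : ℝ) (L mb : ℕ),
        S.Nonempty → (∀ t ∈ S, |h t| ≤ B) → 0 < ε → ε ≤ 1 / 2 →
        L = S.card → mb = m L ε + 1 →
        (∀ lam : ℕ, 1 ≤ lam → lam ≤ L →
          ∃ (α : ℝ) (kh kl w : ℕ) (C : FermionEncoding.Oracles n kh kl lam (m L ε) w),
            C.Encodes K S h α ε ∧
            α ≤ K * L ∧
            (Fintype.card (FermionEncoding.Ancilla kh kl lam (m L ε) w) : ℝ) ≤ K * (lam * mb) ∧
            (C.circuit.tCount : ℝ) ≤ K * (n + ⌈(L : ℝ) / lam⌉₊ + lam * mb)) ∧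
        (Real.logb 2 (L / ε) ≤ n + L →
          ∃ lam : ℕ, 1 ≤ lam ∧ lam ≤ L ∧
          ∃ (α : ℝ) (kh kl w : ℕ) (C : FermionEncoding.Oracles n kh kl lam (m L ε) w),
            C.Encodes K S h α ε ∧
            α ≤ K * L ∧
            (Fintype.card (FermionEncoding.Ancilla kh kl lam (m L ε) w) : ℝ) ≤ K * (lam * mb) ∧
            (C.circuit.tCount : ℝ) ≤ K * (n + √(L * mb)) ∧
            (C.circuit.tDepth : ℝ) ≤ K * (n + √(L * mb))) := by
  -- `β / 2` bounds the coefficients, and `β ≥ 2` makes words long enough to hold an index of `S`.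
  set β : ℝ := 2 * max B 1 with hβ
  have hB : B ≤ β / 2 := by rw [hβ]; linarith [le_max_left B 1]
  have hβ2 : 2 ≤ β := by rw [hβ]; linarith [le_max_right B 1]
  set c : ℝ := Real.logb 2 β + 3 with hc
  have hc0 : 3 ≤ c := by
    have := Real.logb_nonneg (b := 2) (x := β) (by norm_num) (by linarith)
    linarith
  set K : ℝ := 7616 * (c + 4) + 4 * β with hK
  have hKpos : 0 < K := by linarith
  refine ⟨K, FermionEncoding.magnitudeBits β, hKpos, fun L ε hL hε hε2 => ?_, ?_⟩
  · refine (FermionEncoding.magnitudeBits_add_one_le hβ2 hL hε hε2).trans ?_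
    have := FermionEncoding.one_le_logb hL hε hε2
    gcongr
    linarith
  intro n S h ε L mb hS hh hε hε2 hL hmb
  have hL1 : 1 ≤ L := hL ▸ Finset.card_pos.2 hS
  have hL1' : (1 : ℝ) ≤ L := by exact_mod_cast hL1
  have hm := FermionEncoding.le_two_pow_magnitudeBits (β := β) (by linarith) hL1 hε
  have hmS : L ≤ 2 ^ FermionEncoding.magnitudeBits β L ε := by
    have h1 : (L : ℝ) ≤ β * L / ε := by
      rw [le_div_iff₀ hε]
      nlinarith
    exact_mod_cast h1.trans hm
  have hmb' : (FermionEncoding.magnitudeBits β L ε : ℝ) + 1 = mb := by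
    rw [hmb]; push_cast; rfl
  subst hL
  have hmain : ∀ lam : ℕ, 1 ≤ lam → lam ≤ S.card →
      ∃ (α : ℝ) (kh kl w : ℕ)
        (C : FermionEncoding.Oracles n kh kl lam (FermionEncoding.magnitudeBits β S.card ε) w),
        C.Encodes K S h α ε ∧ α ≤ K * S.card ∧
        (Fintype.card (FermionEncoding.Ancilla kh kl lam
          (FermionEncoding.magnitudeBits β S.card ε) w) : ℝ) ≤ K * (lam * mb) ∧
        (C.circuit.tCount : ℝ) ≤ 7616 * (n + ⌈(S.card : ℝ) / lam⌉₊ + lam * mb) := by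
    intro lam hlam hlamL
    obtain ⟨α, kh, kl, w, C, hC, hα, ha, hT⟩ := FermionEncoding.exists_oracles (K := K)
      (β := β) (by linarith) (by linarith) hε hS (fun t ht => (hh t ht).trans hB)
      hm hmS hlam hlamL
    rw [hmb'] at ha hT
    refine ⟨α, kh, kl, w, C, hC, hα.trans ?_, ha.trans ?_, hT⟩
    · gcongr
      linarith
    · gcongr
      linarith
  refine ⟨fun lam hlam hlamL => ?_, fun hlog => ?_⟩
  · obtain ⟨α, kh, kl, w, C, hC, hα, ha, hT⟩ := hmain lam hlam hlamL
    refine ⟨α, kh, kl, w, C, hC, hα, ha, hT.trans ?_⟩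
    gcongr
    linarith
  · have hword : (mb : ℝ) ≤ c * (n + S.card) := by
      rw [← hmb']
      refine (FermionEncoding.magnitudeBits_add_one_le hβ2 hL1 hε hε2).trans ?_
      gcongr
    obtain ⟨lam, hlam, hlamL, hcost⟩ :=
      FermionEncoding.exists_lam hL1 (by omega) (by linarith) hword
    obtain ⟨α, kh, kl, w, C, hC, hα, ha, hT⟩ := hmain lam hlam hlamL
    have hT' : (C.circuit.tCount : ℝ) ≤ K * (n + √(S.card * mb)) := by
      calc (C.circuit.tCount : ℝ) ≤ 7616 * ((c + 4) * (n + √(S.card * mb))) := by linarith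
        _ = 7616 * (c + 4) * (n + √(S.card * mb)) := by ring
        _ ≤ K * (n + √(S.card * mb)) := by gcongr; linarith
    refine ⟨lam, hlam, hlamL, α, kh, kl, w, C, hC, hα, ha, hT', le_trans ?_ hT'⟩
    exact_mod_cast FermionEncoding.Circuit.tDepth_le_tCount C.circuit
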